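/- Let $d\in\mathbb N$, let $1\le p,\theta\le\infty$ (with $1/\infty:=0$) and let $s>1/p$. **Cubature rule.** Let $\xi_1<\dots<\xi_d$ be the (real and distinct) roots of $P_d(t)=\prod_{j=1}^d(t-2j+1)-1$, let $\widetilde T=(\xi_i^{\,j-1})_{i,j=1}^d$, and for $n\in\mathbb N$ put $T_n=(n\det\widetilde T)^{-1/d}\,\widetilde T$, $\mathbb X_n=T_n(\mathbb Z^d)$. Frolov's cubature rule is $$Q_n(f)=\frac1n\sum_{x\in\mathbb X_n\cap[0,1)^d}f(x).$$ **Function space.** Let $L\in\mathbb N_0$ with $L+1>s$, and let $\Psi_0,\Psi_1\in C_0^\infty(\mathbb R)$ be complex-valued functions such that, for some $\varepsilon>0$, $\mathcal F\Psi_0(\xi)\ne0$ for $|\xi|<\varepsilon$, $\mathcal F\Psi_1(\xi)\neq0$ for $\varepsilon/2<|\xi|<2\varepsilon$, and $D^\alpha\mathcal F\Psi_1(0)=0$ for $0\le\alpha\le L$, where $\mathcal Ff(\xi)=\int_{\mathbb R} f(y)e^{-2\pi i\xi y}\,dy$. Put $\Psi_j(x)=2^{j-1}\Psi_1(2^{j-1}x)$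 for $j\ge1$ and $\Psi_m(x)=\prod_{i=1}^d\Psi_{m_i}(x_i)$ for $m\in\mathbb N_0^d$, $x\in\mathbb R^d$. The Besov space of dominating mixed smoothness $\mathbf B^s_{p,\theta}$ consists of all tempered distributions $f\in\mathcal S'(\mathbb R^d)$ with $$\|f\|_{\mathbf B^s_{p,\theta}}=\Big(\sum_{m\in\mathbb N_0^d}2^{s|m|_1\theta}\,\|\Psi_m*f\|_{L_p(\mathbb R^d)}^\theta\Big)^{1/\theta}<\infty$$ (a supremum over $m$ if $\theta=\infty$), where $|m|_1=m_1+\dots+m_d$ and $(\Psi_m*f)(x)=f(\Psi_m(x-\cdot))$, and $\mathring{\mathbf B}^s_{p,\theta}=\{f\in\mathbf B^s_{p,\theta}:\operatorname{supp}f\subset[0,1]^d\}$. Since $s>1/p$, every element of this space is a bounded continuous function (this is part of the claim), so that point values and $$e(Q_n,\mathring{\mathbf B}^s_{p,\theta})=\sup\Big\{\Big|\int_{[0,1]^d}f(x)\,dx-Q_n(f)\Big| : f\in\mathring{\mathbf B}^s_{p,\theta},\ \|f\|_{\mathbf B^s_{p,\theta}}\le1\Big\}$$ make sense. **Theorem.**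 There are constants $0<c\le C<\infty$, which depend only on $d,p,\theta,s$ and on the kernels $\Psi_0,\Psi_1$ that fix the norm, such that for all integers $n\ge2$ $$c\,n^{-s}(\log n)^{(d-1)(1-1/\theta)}\ \le\ e(Q_n,\mathring{\mathbf B}^s_{p,\theta})\ \le\ C\,n^{-s}(\log n)^{(d-1)(1-1/\theta)}.$$ -/

import Mathlib

open MeasureTheory
open scoped ENNReal ContDiff SchwartzMap FourierTransform BoundedContinuousFunction

namespace FrolovBesov

noncomputable section

/-! ### Frolov's cubature rule -/

/-- The polynomial `P_d(t) = ∏_{j=1}^d (t - 2j + 1) - 1` (here `j` runs over `0, …, d-1`). -/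
def frolovPoly (d : ℕ) : Polynomial ℝ :=
  (∏ j : Fin d, (Polynomial.X - Polynomial.C (2 * ((j : ℕ) : ℝ) + 1))) - 1

/-- The real roots `ξ₁ < ⋯ < ξ_d` of `P_d`, in increasing order. The polynomial `P_d` has `d`
distinct real roots, so the default value of `getD` is never used. -/
def frolovRoot (d : ℕ) (i : Fin d) : ℝ :=
  ((frolovPoly d).roots.sort (fun a b => a ≤ b)).getD (i : ℕ) 0

/-- The Vandermonde matrix `(ξ_i^{j-1})_{i,j=1}^d`. Its determinant is positive because the roots
are listed in increasing order. -/
def frolovMatrix (d : ℕ) : Matrix (Fin d) (Fin d) ℝ :=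
  Matrix.vandermonde (frolovRoot d)

/-- The generator `T_n`, the multiple of the Vandermonde matrix that has determinant `1 / n`. -/
def frolovGenerator (d n : ℕ) : Matrix (Fin d) (Fin d) ℝ :=
  ((n : ℝ) * (frolovMatrix d).det) ^ (-(1 / (d : ℝ))) • frolovMatrix d

/-- The lattice `X_n = T_n(ℤ^d)`. -/
def frolovLattice (d n : ℕ) : Set (EuclideanSpace ℝ (Fin d)) :=
  Set.range fun k : Fin d → ℤ =>
    WithLp.toLp 2 ((frolovGenerator d n).mulVec fun i => (k i : ℝ))

/-- The cube `[0,1]^d`. -/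
def unitCube (d : ℕ) : Set (EuclideanSpace ℝ (Fin d)) :=
  {x | ∀ i, x i ∈ Set.Icc (0 : ℝ) 1}

/-- The half-open cube `[0,1)^d`. -/
def unitCubeHalfOpen (d : ℕ) : Set (EuclideanSpace ℝ (Fin d)) :=
  {x | ∀ i, x i ∈ Set.Ico (0 : ℝ) 1}

/-- Frolov's cubature rule `Q_n(f) = (1/n) ∑ f(x)`, the sum over `x ∈ X_n ∩ [0,1)^d`
(a finite set for `n ≥ 1`). -/
def frolovRule (d n : ℕ) (f : EuclideanSpace ℝ (Fin d) → ℂ) : ℂ :=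
  (1 / (n : ℂ)) * ∑ᶠ x ∈ frolovLattice d n ∩ unitCubeHalfOpen d, f x

/-! ### Besov spaces of dominating mixed smoothness, through local means -/

/-- A pair of kernels `Ψ₀, Ψ₁ ∈ C₀^∞(ℝ)` that satisfies the Tauberian conditions for some `ε > 0`
and for which the derivatives of `𝓕 Ψ₁` of order `0, …, L` vanish at the origin. -/
structure LocalMeans (L : ℕ) where
  ψ₀ : ℝ → ℂ
  ψ₁ : ℝ → ℂ
  contDiff_ψ₀ : ContDiff ℝ ∞ ψ₀
  contDiff_ψ₁ : ContDiff ℝ ∞ ψ₁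
  hasCompactSupport_ψ₀ : HasCompactSupport ψ₀
  hasCompactSupport_ψ₁ : HasCompactSupport ψ₁
  tauberian : ∃ ε : ℝ, 0 < ε ∧
    (∀ ξ : ℝ, |ξ| < ε → 𝓕 ψ₀ ξ ≠ 0) ∧
    (∀ ξ : ℝ, ε / 2 < |ξ| → |ξ| < 2 * ε → 𝓕 ψ₁ ξ ≠ 0)
  moments : ∀ α : ℕ, α ≤ L → iteratedDeriv α (𝓕 ψ₁) 0 = 0

namespace LocalMeans

variable {L : ℕ} (Ψ : LocalMeans L)

/-- The dilated kernels: `Ψ₀` itself and `Ψ_j(x) = 2^{j-1} Ψ₁(2^{j-1} x)` for `j ≥ 1`. -/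
def dilated : ℕ → ℝ → ℂ
  | 0, t => Ψ.ψ₀ t
  | j + 1, t => (2 : ℂ) ^ j * Ψ.ψ₁ ((2 : ℝ) ^ j * t)

/-- The tensorized kernel `Ψ_m(x) = ∏ i, Ψ_{m_i}(x_i)`. -/
def tensor {d : ℕ} (m : Fin d → ℕ) (x : EuclideanSpace ℝ (Fin d)) : ℂ :=
  ∏ i, Ψ.dilated (m i) (x i)

theorem contDiff_dilated (j : ℕ) : ContDiff ℝ ∞ (Ψ.dilated j) := by
  cases j with
  | zero => exact Ψ.contDiff_ψ₀
  | succ j =>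
    exact contDiff_const.mul (Ψ.contDiff_ψ₁.comp (contDiff_const.mul contDiff_id))

theorem hasCompactSupport_dilated (j : ℕ) : HasCompactSupport (Ψ.dilated j) := by
  cases j with
  | zero => exact Ψ.hasCompactSupport_ψ₀
  | succ j =>
    have h := Ψ.hasCompactSupport_ψ₁.comp_homeomorph
      (Homeomorph.mulLeft₀ ((2 : ℝ) ^ j) (by positivity))
    exact h.mul_left (f := fun _ => (2 : ℂ) ^ j)

theorem contDiff_tensor {d : ℕ} (m : Fin d → ℕ) : ContDiff ℝ ∞ (Ψ.tensor m) := by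
  unfold tensor
  refine contDiff_prod fun i _ => (Ψ.contDiff_dilated (m i)).comp ?_
  fun_prop

theorem hasCompactSupport_tensor {d : ℕ} (m : Fin d → ℕ) :
    HasCompactSupport (Ψ.tensor m) := by
  have hK : IsCompact (Set.univ.pi fun i => tsupport (Ψ.dilated (m i))) :=
    isCompact_univ_pi fun i => Ψ.hasCompactSupport_dilated (m i)
  have hK' := hK.image (PiLp.continuous_toLp 2 (fun _ : Fin d => ℝ))
  refine HasCompactSupport.intro hK' fun x hx => ?_
  by_contra h
  refine hx ⟨WithLp.ofLp x, fun i _ => ?_, rfl⟩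
  exact subset_tsupport _ (fun h0 => h (Finset.prod_eq_zero (Finset.mem_univ i) h0))

/-- The test function `y ↦ Ψ_m(x - y)`. -/
def shifted {d : ℕ} (m : Fin d → ℕ) (x : EuclideanSpace ℝ (Fin d)) :
    𝓢(EuclideanSpace ℝ (Fin d), ℂ) :=
  HasCompactSupport.toSchwartzMap (f := fun y => Ψ.tensor m (x - y))
    ((Ψ.hasCompactSupport_tensor m).comp_homeomorph (Homeomorph.subLeft x))
    ((Ψ.contDiff_tensor m).comp (contDiff_const.sub contDiff_id))

/-- The convolution `(Ψ_m * u)(x) = u(Ψ_m(x - ·))` with a tempered distribution `u`. -/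
def conv {d : ℕ} (m : Fin d → ℕ) (u : 𝓢'(EuclideanSpace ℝ (Fin d), ℂ))
    (x : EuclideanSpace ℝ (Fin d)) : ℂ :=
  u (Ψ.shifted m x)

/-- The weighted term `2^{s |m|₁} ‖Ψ_m * u‖_p`. -/
def besovTerm {d : ℕ} (p : ℝ≥0∞) (s : ℝ) (u : 𝓢'(EuclideanSpace ℝ (Fin d), ℂ))
    (m : Fin d → ℕ) : ℝ≥0∞ :=
  ENNReal.ofReal ((2 : ℝ) ^ (s * ((∑ i, m i : ℕ) : ℝ))) * eLpNorm (Ψ.conv m u) p volume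

/-- The norm `‖u‖` of `u` in the Besov space `B^s_{p,θ}(ℝ^d)` of dominating mixed smoothness;
it is `∞` exactly when `u` does not belong to the space. -/
def besovNorm {d : ℕ} (p θ : ℝ≥0∞) (s : ℝ) (u : 𝓢'(EuclideanSpace ℝ (Fin d), ℂ)) : ℝ≥0∞ :=
  if θ = ⊤ then ⨆ m : Fin d → ℕ, Ψ.besovTerm p s u m
  else (∑' m : Fin d → ℕ, Ψ.besovTerm p s u m ^ θ.toReal) ^ (1 / θ.toReal)

/-- The space of all `u ∈ B^s_{p,θ}(ℝ^d)` with support in `[0,1]^d`. -/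
def besovCube (d : ℕ) (p θ : ℝ≥0∞) (s : ℝ) : Set 𝓢'(EuclideanSpace ℝ (Fin d), ℂ) :=
  {u | Ψ.besovNorm p θ s u < ⊤ ∧ Distribution.dsupport u ⊆ unitCube d}

end LocalMeans

/-! ### Worst-case error -/

/-- The tempered distribution `u` is the bounded continuous function `f`. -/
def IsRepresentedBy {d : ℕ} (u : 𝓢'(EuclideanSpace ℝ (Fin d), ℂ))
    (f : EuclideanSpace ℝ (Fin d) →ᵇ ℂ) : Prop :=
  ∀ φ : 𝓢(EuclideanSpace ℝ (Fin d), ℂ), u φ = ∫ x, φ x * f x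

/-- The error `|∫_{[0,1]^d} f - Q_n(f)|`, where `f` is the bounded continuous function that
represents `u`. This `f` is unique if it exists; a distribution that is not a bounded continuous
function has error `∞` (the infimum over the empty set), so such elements are not ignored. -/
def frolovError {d : ℕ} (n : ℕ) (u : 𝓢'(EuclideanSpace ℝ (Fin d), ℂ)) : ℝ≥0∞ :=
  ⨅ (f : EuclideanSpace ℝ (Fin d) →ᵇ ℂ) (_ : IsRepresentedBy u f),
    ENNReal.ofReal ‖(∫ x in unitCube d, f x) - frolovRule d n f‖

/-- The worst-case error of Frolov's rule `Q_n` on the unit ball of the space of all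
`u ∈ B^s_{p,θ}(ℝ^d)` with support in `[0,1]^d`. -/
def worstCaseError {L : ℕ} (Ψ : LocalMeans L) (d : ℕ) (p θ : ℝ≥0∞) (s : ℝ) (n : ℕ) : ℝ≥0∞ :=
  ⨆ u ∈ {u ∈ Ψ.besovCube d p θ s | Ψ.besovNorm p θ s u ≤ 1}, frolovError n u

end

end FrolovBesov

/-! Upper bound. The Tauberian conditions allow Fourier multipliers that invert the local means
(`DualMeans`), and hence a decomposition of a distribution into pieces h_m. Each piece is the
convolution of g_m = Ψ_m * u with a reflected dual kernel whose Fourier transform is supported in a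
box of side lengths about 2^{m_i} (`DualMeans.tendsto_sum_integral_conv`,
`DualMeans.exists_hasSum_synth`). The functions g_m are supported in one fixed box, so no cut-off is
needed. Since f vanishes off [0,1)^d, the rule is a sum over the whole lattice.

By Poisson summation, the error on h_m only sees its Fourier transform at the nonzero points of the
dual lattice. The roots ξ_i are conjugate algebraic integers, so products of coordinates of lattice
points are norms. Norms of nonzero elements are bounded below, and this passes to the dual lattice:
∏|ξ_i| ≥ cn at every nonzero dual point (`exists_prod_dual_lower`). Hence the rule is exact on h_m
as long as 2^{|m|₁} stays below a constant times n (`DualMeans.tsum_synth_lattice`).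

For larger m, the integral of h_m and its lattice average are estimated separately. The sum of a
kernel over the lattice is at most about 2^{|m|₁} + n pointwise and about n in L_1 of the box.
Hölder's inequality then bounds the error by (2^{|m|₁}/n)^{1/p} ‖g_m‖_p up to a constant
(`DualMeans.exists_synth_error_le`). With M about log₂ n it remains to sum 2^{-(s-1/p)|m|₁} times an
ℓ_θ sequence over |m|₁ ≥ M. About M^{d-1} indices have length M, and Hölder's inequality in ℓ_θ
turns this number into M^{(d-1)(1-1/θ)} (`exists_weighted_tail_le`).

Lower bound. For a large enough multiple 2^M of n, each of the N ≍ M^{d-1} dyadic partitions of the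
cube into 2^M boxes has at least half of its boxes free of lattice points. The sum of nonnegative
bumps over all free boxes of all N partitions vanishes on the lattice, and its integral is at least
a constant times N. The local means of a bump family of shape j decay geometrically in |m - j|₁
after weighting. So the weighted sequence is bounded by a constant times 2^{sM} in ℓ_∞ and by a
constant times 2^{sM} N in ℓ_1, hence by one times 2^{sM} N^{1/θ} in ℓ_θ
(`LocalMeans.exists_besovNorm_foolingDistribution_le`). Dividing the integral by the norm gives
2^{-sM} N^{1-1/θ}. -/

namespace FrolovBesov

/-! ### Irreducibility and real roots of the Frolov polynomial -/

section FrolovPolynomial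

open Polynomial

/-- The polynomial `P_d` with integer coefficients. -/
noncomputable def frolovPolyInt (d : ℕ) : Polynomial ℤ :=
  (∏ j : Fin d, (X - C (2 * ((j : ℕ) : ℤ) + 1))) - 1

theorem map_frolovPolyInt (d : ℕ) :
    (frolovPolyInt d).map (Int.castRingHom ℝ) = frolovPoly d := by
  simp only [frolovPolyInt, frolovPoly, Polynomial.map_prod, Polynomial.map_sub, map_X, map_C,
    Polynomial.map_one]
  simp

theorem natDegree_prod_X_sub_odd (d : ℕ) :
    (∏ j : Fin d, (X - C (2 * ((j : ℕ) : ℤ) + 1)) : ℤ[X]).natDegree = d := by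
  rw [natDegree_prod_of_monic _ _ (fun i _ => monic_X_sub_C _)]
  simp only [natDegree_X_sub_C]
  simp

theorem monic_frolovPolyInt {d : ℕ} (hd : 1 ≤ d) : (frolovPolyInt d).Monic := by
  refine (monic_prod_of_monic _ _ (fun i _ => monic_X_sub_C _)).sub_of_left ?_
  rw [degree_one, degree_eq_natDegree (monic_prod_of_monic _ _ (fun i _ => monic_X_sub_C _)).ne_zero,
    natDegree_prod_X_sub_odd]
  exact_mod_cast hd

theorem natDegree_frolovPolyInt {d : ℕ} (hd : 1 ≤ d) : (frolovPolyInt d).natDegree = d := by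
  rw [frolovPolyInt, natDegree_sub_eq_left_of_natDegree_lt]
  · exact natDegree_prod_X_sub_odd d
  · rw [natDegree_prod_X_sub_odd, natDegree_one]; exact hd

/-- If P = fg with monic nonconstant integer factors, then f·g = -1 at the d odd numbers 1, 3, …,
2d-1, so one factor is 1 and the other -1 there. Thus f + g has d zeros but degree below d. It
follows that g = -f, which is impossible for two monic polynomials. -/
theorem irreducible_frolovPolyInt {d : ℕ} (hd : 1 ≤ d) : Irreducible (frolovPolyInt d) := by
  have hm := monic_frolovPolyInt hd
  have hdeg := natDegree_frolovPolyInt hd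
  rw [hm.irreducible_iff_natDegree']
  refine ⟨fun h => ?_, fun f g hf hg hfg hmem => ?_⟩
  · rw [h, natDegree_one] at hdeg; omega
  rw [hdeg, Finset.mem_Ioc] at hmem
  have hsum : f.natDegree + g.natDegree = d := by
    rw [← hf.natDegree_mul hg, hfg, hdeg]
  have hinj : Function.Injective fun j : Fin d => 2 * ((j : ℕ) : ℤ) + 1 := by
    intro i j hij
    have : (i : ℕ) = j := by simp only at hij; omega
    exact Fin.ext this
  have heval : ∀ j : Fin d, (f + g).eval (2 * ((j : ℕ) : ℤ) + 1) = 0 := by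
    intro j
    have h1 : f.eval (2 * ((j : ℕ) : ℤ) + 1) * g.eval (2 * ((j : ℕ) : ℤ) + 1) = -1 := by
      rw [← eval_mul, hfg, frolovPolyInt, eval_sub, eval_prod,
        Finset.prod_eq_zero (Finset.mem_univ j) (by simp)]
      simp
    rw [eval_add]
    rcases Int.isUnit_iff.1 (IsUnit.of_mul_eq_one (-g.eval (2 * ((j : ℕ) : ℤ) + 1))
      (by rw [mul_neg, h1]; norm_num)) with h | h <;> rw [h] at h1 ⊢ <;> linarith
  have hlt : (f + g).natDegree < Fintype.card (Fin d) := by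
    rw [Fintype.card_fin]
    exact (natDegree_add_le _ _).trans_lt (max_lt (by omega) (by omega))
  have h0 := eq_zero_of_natDegree_lt_card_of_eval_eq_zero _ hinj heval hlt
  have hgf : g = -f := by linear_combination h0
  have := hg.leadingCoeff
  rw [hgf, leadingCoeff_neg, hf.leadingCoeff] at this
  norm_num at this

theorem sign_prod_sub_odd {d : ℕ} (i : ℕ) (x : ℝ)
    (h1 : ∀ j : Fin d, (j : ℕ) < i → 2 * (j : ℝ) + 1 < x)
    (h2 : ∀ j : Fin d, i ≤ (j : ℕ) → x < 2 * (j : ℝ) + 1) :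
    (-1) ^ (d - i) * ∏ j : Fin d, (x - (2 * ((j : ℕ) : ℝ) + 1))
      = ∏ j : Fin d, |x - (2 * ((j : ℕ) : ℝ) + 1)| := by
  have hs : ((-1 : ℝ)) ^ (d - i) = ∏ j : Fin d, if (j : ℕ) < i then (1 : ℝ) else -1 := by
    rw [Fin.prod_univ_eq_prod_range (fun j => if j < i then (1 : ℝ) else -1) d,
      Finset.prod_ite]
    simp only [Finset.prod_const_one, one_mul, Finset.prod_const]
    congr 1
    rw [show Finset.filter (fun x => ¬ x < i) (Finset.range d) = Finset.Ico i d by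
      ext; simp; tauto]
    simp
  rw [hs, ← Finset.prod_mul_distrib]
  refine Finset.prod_congr rfl fun j _ => ?_
  split_ifs with h
  · rw [one_mul, abs_of_pos (sub_pos.2 (h1 j h))]
  · rw [neg_one_mul, abs_of_neg (sub_neg.2 (h2 j (not_lt.1 h)))]

/-- A point between the `i`-th and the `(i+1)`-st zero of `∏ (t - 2j + 1)`. -/
noncomputable def frolovSep (d i : ℕ) : ℝ := if i < d then 2 * i else 2 * i + 2

/-- At an even integer every factor of the product is an odd integer, so the product has absolute
value at least 1. Subtracting 1 cannot spoil a negative sign. When the product is positive it must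
exceed 1 strictly, and for that a factor of absolute value at least 3 is exhibited. -/
theorem frolovSep_sign {d : ℕ} (hd : 1 ≤ d) (i : ℕ) (hi : i ≤ d) :
    0 < (-1) ^ (d - i) * (frolovPoly d).eval (frolovSep d i) := by
  have hleft : ∀ j : Fin d, (j : ℕ) < i → 2 * (j : ℝ) + 1 < frolovSep d i := by
    intro j hj
    have : (j : ℝ) + 1 ≤ i := by exact_mod_cast hj
    unfold frolovSep; split_ifs <;> linarith
  have hright : ∀ j : Fin d, i ≤ (j : ℕ) → frolovSep d i < 2 * (j : ℝ) + 1 := by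
    intro j hj
    have h3 : (i : ℝ) ≤ j := by exact_mod_cast hj
    have : i < d := hj.trans_lt j.2
    unfold frolovSep; rw [if_pos this]; linarith
  have hsgn := sign_prod_sub_odd i (frolovSep d i) hleft hright
  have habs : ∀ j : Fin d, 1 ≤ |frolovSep d i - (2 * ((j : ℕ) : ℝ) + 1)| := by
    intro j
    have h3 : frolovSep d i - (2 * ((j : ℕ) : ℝ) + 1)
        = ((if i < d then 2 * (i : ℤ) - (2 * j + 1) else 2 * i + 2 - (2 * j + 1) : ℤ) : ℝ) := by
      unfold frolovSep; split_ifs <;> push_cast <;> ring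
    rw [h3, ← Int.cast_abs]
    have : (1 : ℤ) ≤ |(if i < d then 2 * (i : ℤ) - (2 * j + 1) else 2 * i + 2 - (2 * j + 1) : ℤ)| := by
      apply Int.one_le_abs; split_ifs <;> omega
    exact_mod_cast this
  have heval : (frolovPoly d).eval (frolovSep d i)
      = ∏ j : Fin d, (frolovSep d i - (2 * ((j : ℕ) : ℝ) + 1)) - 1 := by
    simp [frolovPoly, eval_prod]
  rw [heval, mul_sub, hsgn, mul_one, sub_pos]
  have hone : (1 : ℝ) ≤ ∏ j : Fin d, |frolovSep d i - (2 * ((j : ℕ) : ℝ) + 1)| := by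
    calc (1 : ℝ) = ∏ _j : Fin d, (1 : ℝ) := Finset.prod_const_one.symm
      _ ≤ _ := Finset.prod_le_prod (fun _ _ => zero_le_one) (fun j _ => habs j)
  rcases Nat.even_or_odd (d - i) with h | h
  · rw [h.neg_one_pow]
    have hex : ∃ j : Fin d, 1 < |frolovSep d i - (2 * ((j : ℕ) : ℝ) + 1)| := by
      rcases hi.lt_or_eq with hlt | rfl
      · have : i + 1 < d := by
          by_contra hcon
          have : d - i = 1 := by omega
          rw [this] at h; exact absurd h (by decide)
        refine ⟨⟨i + 1, this⟩, ?_⟩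
        unfold frolovSep; rw [if_pos hlt, lt_abs]; right; push_cast; linarith
      -- This case is why the last separating point is 2d + 2 and not 2d: for d = 1 the point 2 is
      -- itself the root.
      · refine ⟨⟨0, hd⟩, ?_⟩
        have : (1 : ℝ) ≤ i := by exact_mod_cast hd
        unfold frolovSep; rw [if_neg (lt_irrefl _), lt_abs]; left; push_cast; linarith
    obtain ⟨j, hj⟩ := hex
    calc (1 : ℝ) = ∏ _j : Fin d, (1 : ℝ) := Finset.prod_const_one.symm
      _ < _ := Finset.prod_lt_prod (fun _ _ => one_pos) (fun j _ => habs j)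
          ⟨j, Finset.mem_univ _, hj⟩
  · rw [h.neg_one_pow]; linarith

theorem exists_root_between {d : ℕ} (hd : 1 ≤ d) (i : Fin d) :
    ∃ x, (frolovPoly d).eval x = 0 ∧ frolovSep d i < x ∧ x < frolovSep d (i + 1) := by
  have h1 := frolovSep_sign hd i i.2.le
  have h2 := frolovSep_sign hd (i + 1) i.2
  rw [show d - (i : ℕ) = (d - (i + 1)) + 1 by have := i.2; omega, pow_succ] at h1
  have hle : frolovSep d i ≤ frolovSep d (i + 1) := by
    unfold frolovSep; split_ifs <;> push_cast <;> linarith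
  set σ : ℝ := (-1) ^ (d - ((i : ℕ) + 1))
  have hc : ContinuousOn (fun x => σ * (frolovPoly d).eval x)
      (Set.Icc (frolovSep d i) (frolovSep d (i + 1))) :=
    (continuous_const.mul (frolovPoly d).continuous).continuousOn
  obtain ⟨x, hx, h0⟩ := intermediate_value_Ioo hle hc
    (show (0 : ℝ) ∈ _ from ⟨by linarith, h2⟩)
  refine ⟨x, ?_, hx.1, hx.2⟩
  have hσ : σ ≠ 0 := pow_ne_zero _ (by norm_num)
  exact (mul_eq_zero.1 h0).resolve_left hσ

/-- The d sign changes produce d distinct roots, and the degree leaves room neither for another root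
nor for a multiple one. -/
theorem card_roots_frolovPoly {d : ℕ} (hd : 1 ≤ d) :
    (frolovPoly d).roots.Nodup ∧ (frolovPoly d).roots.card = d := by
  have hne : frolovPoly d ≠ 0 := by
    rw [← map_frolovPolyInt]; exact ((monic_frolovPolyInt hd).map _).ne_zero
  have hdeg : (frolovPoly d).natDegree = d := by
    rw [← map_frolovPolyInt, (monic_frolovPolyInt hd).natDegree_map, natDegree_frolovPolyInt hd]
  choose r hr h1 h2 using fun i : Fin d => exists_root_between hd i
  have hmono : Monotone (frolovSep d) := by
    intro a b hab
    have : (a : ℝ) ≤ b := by exact_mod_cast hab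
    unfold frolovSep; split_ifs <;> linarith
  have hsm : StrictMono r := by
    intro i j hij
    exact (h2 i).trans_le ((hmono (by exact_mod_cast hij)).trans (h1 j).le)
  have hc1 : d ≤ (frolovPoly d).roots.toFinset.card := by
    calc d = (Finset.univ.image r).card := by
          rw [Finset.card_image_of_injective _ hsm.injective]; simp
      _ ≤ _ := by
        refine Finset.card_le_card fun x hx => ?_
        obtain ⟨i, -, rfl⟩ := Finset.mem_image.1 hx
        rw [Multiset.mem_toFinset, mem_roots hne]; exact hr i
  have hc2 := Multiset.toFinset_card_le (frolovPoly d).roots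
  have hc3 := card_roots' (frolovPoly d)
  refine ⟨Multiset.toFinset_card_eq_card_iff_nodup.1 (by omega), by omega⟩

theorem frolovRoot_eq {d : ℕ} (hd : 1 ≤ d) (i : Fin d) :
    ∃ h : (i : ℕ) < ((frolovPoly d).roots.sort (fun a b => a ≤ b)).length,
      frolovRoot d i = ((frolovPoly d).roots.sort (fun a b => a ≤ b))[(i : ℕ)] := by
  have h : (i : ℕ) < ((frolovPoly d).roots.sort (fun a b => a ≤ b)).length := by
    rw [Multiset.length_sort, (card_roots_frolovPoly hd).2]; exact i.2
  exact ⟨h, List.getD_eq_getElem _ _ h⟩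

theorem eval_frolovRoot {d : ℕ} (hd : 1 ≤ d) (i : Fin d) :
    (frolovPoly d).eval (frolovRoot d i) = 0 := by
  obtain ⟨h, he⟩ := frolovRoot_eq hd i
  have : frolovRoot d i ∈ (frolovPoly d).roots := by
    rw [he, ← Multiset.mem_sort (fun a b => a ≤ b)]; exact List.getElem_mem h
  exact isRoot_of_mem_roots this

theorem strictMono_frolovRoot {d : ℕ} (hd : 1 ≤ d) : StrictMono (frolovRoot d) := by
  intro i j hij
  obtain ⟨hi, hei⟩ := frolovRoot_eq hd i
  obtain ⟨hj, hej⟩ := frolovRoot_eq hd j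
  have hnd : ((frolovPoly d).roots.sort (fun a b => a ≤ b)).Nodup := by
    rw [← Multiset.coe_nodup, Multiset.sort_eq]; exact (card_roots_frolovPoly hd).1
  rw [hei, hej]
  refine lt_of_le_of_ne ?_ fun h => ?_
  · exact List.pairwise_iff_getElem.1 (Multiset.pairwise_sort _ _) _ _ hi hj hij
  · exact absurd ((hnd.getElem_inj_iff).1 h) (by have : (i : ℕ) < j := hij; omega)

theorem det_frolovMatrix_pos {d : ℕ} (hd : 1 ≤ d) : 0 < (frolovMatrix d).det := by
  rw [frolovMatrix, Matrix.det_vandermonde]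
  refine Finset.prod_pos fun i _ => Finset.prod_pos fun j hj => ?_
  exact sub_pos.2 (strictMono_frolovRoot hd (Finset.mem_Ioi.1 hj))

end FrolovPolynomial

/-! ### Norm bounds for the lattice and its dual, and lattice points in boxes -/

section Admissible

open Polynomial

/-- Multiplication by an integer polynomial modulo `P_d` is an integer matrix that the Vandermonde
matrix diagonalizes. -/
theorem exists_int_matrix {d : ℕ} (hd : 1 ≤ d) (Q : ℤ[X]) :
    ∃ M : Matrix (Fin d) (Fin d) ℤ,
      frolovMatrix d * M.map (Int.cast : ℤ → ℝ)
        = Matrix.diagonal (fun i => aeval (frolovRoot d i) Q) * frolovMatrix d := by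
  have hm := monic_frolovPolyInt hd
  have hne1 : frolovPolyInt d ≠ 1 := fun h => by
    have := natDegree_frolovPolyInt hd
    rw [h, natDegree_one] at this; omega
  -- Column j holds the coefficients of Q·X^j reduced modulo the monic P_d. Evaluation at a root
  -- does not see the reduction.
  refine ⟨fun l j => (Q * X ^ (j : ℕ) %ₘ frolovPolyInt d).coeff l, ?_⟩
  ext i j
  rw [Matrix.diagonal_mul, Matrix.mul_apply]
  have hroot : aeval (frolovRoot d i) (frolovPolyInt d) = 0 := by
    rw [aeval_def, ← eval_map]
    have := eval_frolovRoot hd i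
    rwa [← map_frolovPolyInt] at this
  have h1 : aeval (frolovRoot d i) (Q * X ^ (j : ℕ) %ₘ frolovPolyInt d)
      = aeval (frolovRoot d i) Q * frolovRoot d i ^ (j : ℕ) := by
    conv_rhs => rw [← aeval_X (R := ℤ) (frolovRoot d i), ← map_pow, aeval_X, ← map_mul,
      ← modByMonic_add_div (Q * X ^ (j : ℕ)) (frolovPolyInt d), map_add, map_mul, hroot]
    simp
  have h2 : (Q * X ^ (j : ℕ) %ₘ frolovPolyInt d).natDegree < d := by
    have := natDegree_modByMonic_lt (Q * X ^ (j : ℕ)) hm hne1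
    rwa [natDegree_frolovPolyInt hd] at this
  rw [frolovMatrix, Matrix.vandermonde_apply, ← h1, aeval_eq_sum_range' h2,
    ← Fin.sum_univ_eq_sum_range
      (fun l => (Q * X ^ (j : ℕ) %ₘ frolovPolyInt d).coeff l • frolovRoot d i ^ l) d]
  refine Finset.sum_congr rfl fun l _ => ?_
  rw [zsmul_eq_mul, mul_comm]
  rfl

theorem isUnit_frolovMatrix_det {d : ℕ} (hd : 1 ≤ d) : IsUnit (frolovMatrix d).det :=
  (det_frolovMatrix_pos hd).ne'.isUnit

/-- The norm of Q(ξ) is the determinant of multiplication by Q, which is an integer matrix. -/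
theorem exists_int_prod {d : ℕ} (hd : 1 ≤ d) (Q : ℤ[X]) :
    ∃ a : ℤ, ∏ i, aeval (frolovRoot d i) Q = (a : ℝ) := by
  obtain ⟨M, hM⟩ := exists_int_matrix hd Q
  refine ⟨M.det, ?_⟩
  have h := congrArg Matrix.det hM
  rw [Matrix.det_mul, Matrix.det_mul, Matrix.det_diagonal, mul_comm] at h
  rw [← mul_right_cancel₀ (det_frolovMatrix_pos hd).ne' h]
  exact ((Int.castRingHom ℝ).map_det M).symm

/-- Likewise, the sum over the conjugates is the trace of multiplication by Q. -/
theorem exists_int_sum {d : ℕ} (hd : 1 ≤ d) (Q : ℤ[X]) :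
    ∃ a : ℤ, ∑ i, aeval (frolovRoot d i) Q = (a : ℝ) := by
  obtain ⟨M, hM⟩ := exists_int_matrix hd Q
  refine ⟨M.trace, ?_⟩
  have h : Matrix.diagonal (fun i => aeval (frolovRoot d i) Q)
      = frolovMatrix d * M.map (Int.cast : ℤ → ℝ) * (frolovMatrix d)⁻¹ := by
    rw [hM, Matrix.mul_nonsing_inv_cancel_right _ _ (isUnit_frolovMatrix_det hd)]
  rw [← Matrix.trace_diagonal, h, Matrix.trace_mul_comm, ← Matrix.mul_assoc,
    Matrix.nonsing_inv_mul _ (isUnit_frolovMatrix_det hd), Matrix.one_mul]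
  simp [Matrix.trace]

/-- By Gauss's lemma P_d stays irreducible over ℚ, so it is the minimal polynomial of each of its
roots. -/
theorem aeval_frolovRoot_ne_zero {d : ℕ} (hd : 1 ≤ d) (i : Fin d) {Q : ℤ[X]} (hQ : Q ≠ 0)
    (hdeg : Q.natDegree < d) : aeval (frolovRoot d i) Q ≠ 0 := by
  intro h0
  have hm := monic_frolovPolyInt hd
  have hirr := (hm.irreducible_iff_irreducible_map_fraction_map (K := ℚ)).1
    (irreducible_frolovPolyInt hd)
  have hroot : aeval (frolovRoot d i) (frolovPolyInt d) = 0 := by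
    rw [aeval_def, ← eval_map]
    have := eval_frolovRoot hd i
    rwa [← map_frolovPolyInt] at this
  have hmin := minpoly.eq_of_irreducible_of_monic hirr
    (x := frolovRoot d i) (by rw [aeval_map_algebraMap]; exact hroot) (hm.map _)
  have hdvd := minpoly.dvd ℚ (frolovRoot d i) (p := Q.map (algebraMap ℤ ℚ))
    (by rw [aeval_map_algebraMap]; exact h0)
  rw [← hmin] at hdvd
  have hinj : Function.Injective (algebraMap ℤ ℚ) := Int.cast_injective
  have hle := natDegree_le_of_dvd hdvd ((Polynomial.map_ne_zero_iff hinj).2 hQ)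
  rw [hm.natDegree_map, natDegree_map_eq_of_injective hinj, natDegree_frolovPolyInt hd] at hle
  omega

/-- The coordinates of the vector are the values of Q = ∑ k_j X^j at the conjugate roots. Their
product is a norm: an integer, and nonzero because deg Q < d. -/
theorem one_le_prod_frolovMatrix_mulVec {d : ℕ} (hd : 1 ≤ d) {k : Fin d → ℤ} (hk : k ≠ 0) :
    1 ≤ ∏ i, |(frolovMatrix d).mulVec (fun j => (k j : ℝ)) i| := by
  set Q : ℤ[X] := ∑ j : Fin d, monomial (j : ℕ) (k j) with hQdef
  have hcoeff : ∀ j : Fin d, Q.coeff j = k j := by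
    intro j
    rw [hQdef, finsetSum_coeff, Finset.sum_eq_single j]
    · simp
    · intro b _ hb
      rw [coeff_monomial, if_neg fun h => hb (Fin.ext h)]
    · simp
  have hQ0 : Q ≠ 0 := by
    rintro h
    refine hk (funext fun j => ?_)
    rw [← hcoeff j, h]; simp
  have hdeg : Q.natDegree < d := by
    rw [natDegree_lt_iff_degree_lt hQ0]
    refine (degree_sum_le _ _).trans_lt ?_
    rw [Finset.sup_lt_iff (by exact_mod_cast WithBot.bot_lt_coe d)]
    intro j _
    exact (degree_monomial_le _ _).trans_lt (by exact_mod_cast j.2)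
  have heq : ∀ i, (frolovMatrix d).mulVec (fun j => (k j : ℝ)) i = aeval (frolovRoot d i) Q := by
    intro i
    simp [hQdef, frolovMatrix, Matrix.mulVec, dotProduct, Matrix.vandermonde_apply, mul_comm,
      aeval_monomial]
  obtain ⟨a, ha⟩ := exists_int_prod hd Q
  simp_rw [heq]
  rw [← Finset.abs_prod, ha]
  have ha0 : a ≠ 0 := by
    rintro rfl
    rw [Int.cast_zero, Finset.prod_eq_zero_iff] at ha
    obtain ⟨i, -, hi⟩ := ha
    exact aeval_frolovRoot_ne_zero hd i hQ0 hdeg hi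
  rw [← Int.cast_abs]
  exact_mod_cast Int.one_le_abs ha0

/-- The inverse transpose of the Vandermonde matrix inherits the product lower bound, since the
Gram matrix of the Vandermonde matrix is an integer matrix. -/
theorem exists_prod_inv_transpose_lower {d : ℕ} (hd : 1 ≤ d) :
    ∃ c : ℝ, 0 < c ∧ ∀ k : Fin d → ℤ, k ≠ 0 →
      c ≤ ∏ i, |((frolovMatrix d)⁻¹.transpose).mulVec (fun j => (k j : ℝ)) i| := by
  classical
  set V := frolovMatrix d with hV
  have hu := isUnit_frolovMatrix_det hd
  choose a ha using fun m : ℕ => exists_int_sum hd (X ^ m : ℤ[X])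
  -- The entries of VᵀV are the power sums ∑_l ξ_l^{i+j}, which are traces and so integers.
  set G : Matrix (Fin d) (Fin d) ℤ := fun i j => a (i + j) with hG
  have hGV : V.transpose * V = G.map (Int.cast : ℤ → ℝ) := by
    ext i j
    rw [Matrix.mul_apply, Matrix.map_apply]
    simp only [hG]
    rw [← ha]
    refine Finset.sum_congr rfl fun l _ => ?_
    simp [hV, frolovMatrix, Matrix.vandermonde_apply, pow_add]
  have hdetG : (G.det : ℝ) = V.det ^ 2 := by
    have := congrArg Matrix.det hGV
    rw [Matrix.det_mul, Matrix.det_transpose] at this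
    rw [pow_two, this]
    exact (Int.castRingHom ℝ).map_det G
  have hdet0 : (G.det : ℝ) ≠ 0 := by
    rw [hdetG]; exact pow_ne_zero _ (det_frolovMatrix_pos hd).ne'
  have hdetpos : 0 < |(G.det : ℝ)| := abs_pos.2 hdet0
  refine ⟨(|(G.det : ℝ)| ^ d)⁻¹, by positivity, fun k hk => ?_⟩
  -- With this integer vector G k' = det G · k, hence V k' = V⁻ᵀ G k' = det G · V⁻ᵀ k. The bound for
  -- V at k' becomes the bound for V⁻ᵀ at k, at the cost of |det G|^d.
  set k' : Fin d → ℤ := G.adjugate.mulVec k with hk'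
  have hGk' : G.mulVec k' = G.det • k := by
    rw [hk', Matrix.mulVec_mulVec, Matrix.mul_adjugate, Matrix.smul_mulVec, Matrix.one_mulVec]
  have hk'0 : k' ≠ 0 := by
    rintro h
    rw [h, Matrix.mulVec_zero] at hGk'
    have : G.det ≠ 0 := by exact_mod_cast hdet0
    exact hk ((smul_eq_zero.1 hGk'.symm).resolve_left this)
  have hcast : (G.map (Int.cast : ℤ → ℝ)).mulVec (fun j => (k' j : ℝ))
      = (G.det : ℝ) • fun j => (k j : ℝ) := by
    funext i
    have := congrFun hGk' i
    simp only [Matrix.mulVec, dotProduct, Pi.smul_apply, smul_eq_mul, Matrix.map_apply] at this ⊢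
    exact_mod_cast this
  have hVk : V.mulVec (fun j => (k' j : ℝ))
      = (G.det : ℝ) • (V⁻¹.transpose).mulVec (fun j => (k j : ℝ)) := by
    have h := congrArg (fun v => (V⁻¹.transpose).mulVec v) hcast
    rw [← hGV, Matrix.mulVec_mulVec, ← Matrix.mul_assoc, ← Matrix.transpose_mul,
      Matrix.mul_nonsing_inv _ hu, Matrix.transpose_one, Matrix.one_mul, Matrix.mulVec_smul] at h
    exact h
  have h1 := one_le_prod_frolovMatrix_mulVec hd hk'0
  rw [← hV, hVk] at h1
  simp only [Pi.smul_apply, smul_eq_mul, abs_mul, Finset.prod_mul_distrib, Finset.prod_const,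
    Finset.card_univ, Fintype.card_fin] at h1
  rwa [inv_le_iff_one_le_mul₀' (by positivity)]

theorem det_frolovGenerator {d n : ℕ} (hd : 1 ≤ d) (hn : 1 ≤ n) :
    (frolovGenerator d n).det = (n : ℝ)⁻¹ := by
  have hn' : (0 : ℝ) < n := by exact_mod_cast hn
  have hpos : 0 < (n : ℝ) * (frolovMatrix d).det := mul_pos hn' (det_frolovMatrix_pos hd)
  have hd0 : (d : ℝ) ≠ 0 := by positivity
  rw [frolovGenerator, Matrix.det_smul, Fintype.card_fin, ← Real.rpow_natCast,
    ← Real.rpow_mul hpos.le]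
  rw [show -(1 / (d : ℝ)) * d = -1 by field_simp, Real.rpow_neg_one, mul_inv]
  field_simp [(det_frolovMatrix_pos hd).ne']

theorem exists_prod_generator_lower {d : ℕ} (hd : 1 ≤ d) :
    ∃ c : ℝ, 0 < c ∧ ∀ n : ℕ, 1 ≤ n → ∀ k : Fin d → ℤ, k ≠ 0 →
      c / n ≤ ∏ i, |(frolovGenerator d n).mulVec (fun j => (k j : ℝ)) i| := by
  refine ⟨((frolovMatrix d).det)⁻¹, inv_pos.2 (det_frolovMatrix_pos hd), fun n hn k hk => ?_⟩
  have hn' : (0 : ℝ) < n := by exact_mod_cast hn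
  have hpos : 0 < (n : ℝ) * (frolovMatrix d).det := mul_pos hn' (det_frolovMatrix_pos hd)
  have hd0 : (d : ℝ) ≠ 0 := by positivity
  have h1 := one_le_prod_frolovMatrix_mulVec hd hk
  rw [frolovGenerator]
  simp only [Matrix.smul_mulVec, Pi.smul_apply, smul_eq_mul, abs_mul, Finset.prod_mul_distrib,
    Finset.prod_const, Finset.card_univ, Fintype.card_fin]
  rw [abs_of_nonneg (Real.rpow_nonneg hpos.le _), ← Real.rpow_natCast, ← Real.rpow_mul hpos.le,
    show -(1 / (d : ℝ)) * d = -1 by field_simp, Real.rpow_neg_one, mul_inv, div_eq_mul_inv,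
    mul_comm ((n : ℝ)⁻¹)]
  have := (det_frolovMatrix_pos hd)
  exact le_mul_of_one_le_right (by positivity) h1

/-- The dual generator is α⁻¹V⁻ᵀ with α^{-d} = n det V, so the product of d coordinates gains the
factor n. In other words, the hyperbolic cross ∏|ξ_i| < cn contains no nonzero point of the dual
lattice. -/
theorem exists_prod_dual_lower {d : ℕ} (hd : 1 ≤ d) :
    ∃ c : ℝ, 0 < c ∧ ∀ n : ℕ, 1 ≤ n → ∀ k : Fin d → ℤ, k ≠ 0 →
      c * n ≤ ∏ i, |((frolovGenerator d n)⁻¹.transpose).mulVec (fun j => (k j : ℝ)) i| := by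
  obtain ⟨c, hc, h⟩ := exists_prod_inv_transpose_lower hd
  have hdet := det_frolovMatrix_pos hd
  refine ⟨(frolovMatrix d).det * c, by positivity, fun n hn k hk => ?_⟩
  have hn' : (0 : ℝ) < n := by exact_mod_cast hn
  have hpos : 0 < (n : ℝ) * (frolovMatrix d).det := mul_pos hn' hdet
  have hd0 : (d : ℝ) ≠ 0 := by positivity
  set α : ℝ := ((n : ℝ) * (frolovMatrix d).det) ^ (-(1 / (d : ℝ))) with hα
  have hαpos : 0 < α := Real.rpow_pos_of_pos hpos _
  have hinv : (frolovGenerator d n)⁻¹ = α⁻¹ • (frolovMatrix d)⁻¹ := by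
    apply Matrix.inv_eq_right_inv
    rw [frolovGenerator, Matrix.smul_mul, Matrix.mul_smul, smul_smul, mul_inv_cancel₀ hαpos.ne',
      one_smul, Matrix.mul_nonsing_inv _ (isUnit_frolovMatrix_det hd)]
  have hαd : (α⁻¹) ^ d = n * (frolovMatrix d).det := by
    rw [inv_pow, hα, ← Real.rpow_natCast, ← Real.rpow_mul hpos.le,
      show -(1 / (d : ℝ)) * d = -1 by field_simp, Real.rpow_neg_one, inv_inv]
  rw [hinv]
  simp only [Matrix.transpose_smul, Matrix.smul_mulVec, Pi.smul_apply, smul_eq_mul, abs_mul,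
    Finset.prod_mul_distrib, Finset.prod_const, Finset.card_univ, Fintype.card_fin]
  rw [abs_of_nonneg (inv_nonneg.2 hαpos.le), hαd]
  calc (frolovMatrix d).det * c * n = n * (frolovMatrix d).det * c := by ring
    _ ≤ _ := mul_le_mul_of_nonneg_left (h k hk) hpos.le

/-- Counting lattice points in boxes. -/
theorem exists_card_box_le {d : ℕ} (hd : 1 ≤ d) :
    ∃ C : ℝ, 0 < C ∧ ∀ n : ℕ, 1 ≤ n → ∀ (a l : Fin d → ℝ), (∀ i, 0 < l i) →
      ∀ S : Finset (Fin d → ℤ),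
        (∀ k ∈ S, ∀ i, a i ≤ (frolovGenerator d n).mulVec (fun j => (k j : ℝ)) i ∧
          (frolovGenerator d n).mulVec (fun j => (k j : ℝ)) i < a i + l i) →
        (S.card : ℝ) ≤ 1 + C * n * ∏ i, l i := by
  obtain ⟨c, hc, h⟩ := exists_prod_generator_lower hd
  refine ⟨c⁻¹, inv_pos.2 hc, fun n hn a l hl S hS => ?_⟩
  have hn' : (0 : ℝ) < n := by exact_mod_cast hn
  set i0 : Fin d := ⟨0, hd⟩
  -- The box is cut into M equal slabs across the first axis, with M just large enough that a slab
  -- has volume below c/n. Two lattice points in one slab would differ by a lattice vector that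
  -- violates the product bound, so each slab holds at most one point.
  set M : ℕ := ⌊c⁻¹ * n * ∏ i, l i⌋₊ + 1 with hM
  have hMlt : c⁻¹ * n * ∏ i, l i < M := by rw [hM]; push_cast; exact Nat.lt_floor_add_one _
  have hMle : (M : ℝ) ≤ 1 + c⁻¹ * n * ∏ i, l i := by
    have hp : 0 < ∏ i, l i := Finset.prod_pos fun i _ => hl i
    have := Nat.floor_le (show 0 ≤ c⁻¹ * n * ∏ i, l i by positivity)
    rw [hM]; push_cast; linarith
  have hMpos : (0 : ℝ) < M := by rw [hM]; push_cast; positivity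
  refine le_trans ?_ hMle
  set x : (Fin d → ℤ) → Fin d → ℝ := fun k => (frolovGenerator d n).mulVec (fun j => (k j : ℝ))
  set φ : (Fin d → ℤ) → ℕ := fun k => ⌊(x k i0 - a i0) / l i0 * M⌋₊ with hφ
  have hcard : S.card ≤ (Finset.range M).card := by
    refine Finset.card_le_card_of_injOn φ (fun k hk => ?_) (fun k hk k' hk' hkk => ?_)
    · rw [Finset.coe_range, Set.mem_Iio]
      have h1 := hS k hk i0
      rw [hφ, Nat.floor_lt (by have := hl i0; have := sub_nonneg.2 h1.1; positivity)]
      have : (x k i0 - a i0) / l i0 < 1 := by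
        rw [div_lt_one (hl i0)]; have := h1.2; simp only [x]; linarith
      calc _ < 1 * (M : ℝ) := mul_lt_mul_of_pos_right this hMpos
        _ = M := one_mul _
    · by_contra hne
      have hlow := h n hn (k - k') (sub_ne_zero.2 hne)
      have hdiff : (frolovGenerator d n).mulVec (fun j => (((k - k') j : ℤ) : ℝ)) = x k - x k' := by
        simp only [x]
        rw [← Matrix.mulVec_sub]
        congr 1
        funext j; simp
      rw [hdiff] at hlow
      have hbd : ∀ i, |(x k - x k') i| ≤ if i = i0 then l i / M else l i := by
        intro i
        have h1 := hS k hk i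
        have h2 := hS k' hk' i
        split_ifs with hi
        · subst hi
          have e1 := Nat.floor_le (show 0 ≤ (x k i0 - a i0) / l i0 * M by
            have := hl i0; have := sub_nonneg.2 h1.1; positivity)
          have e2 := Nat.lt_floor_add_one ((x k i0 - a i0) / l i0 * M)
          have e3 := Nat.floor_le (show 0 ≤ (x k' i0 - a i0) / l i0 * M by
            have := hl i0; have := sub_nonneg.2 h2.1; positivity)
          have e4 := Nat.lt_floor_add_one ((x k' i0 - a i0) / l i0 * M)
          have hkk' : (⌊(x k i0 - a i0) / l i0 * M⌋₊ : ℝ) = ⌊(x k' i0 - a i0) / l i0 * M⌋₊ := by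
            exact_mod_cast hkk
          have hl0 := hl i0
          have key : |(x k i0 - a i0) / l i0 * M - (x k' i0 - a i0) / l i0 * M| ≤ 1 := by
            rw [abs_le]; constructor <;> linarith
          have e5 : (x k i0 - a i0) / l i0 * M - (x k' i0 - a i0) / l i0 * M
              = (x k i0 - x k' i0) * (M / l i0) := by field_simp; ring
          rw [e5, abs_mul, abs_of_pos (show 0 < (M : ℝ) / l i0 by positivity)] at key
          rw [Pi.sub_apply, le_div_iff₀ hMpos]
          calc |x k i0 - x k' i0| * M = |x k i0 - x k' i0| * (M / l i0) * l i0 := by field_simp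
            _ ≤ 1 * l i0 := mul_le_mul_of_nonneg_right key hl0.le
            _ = l i0 := one_mul _
        · rw [Pi.sub_apply, abs_le]
          simp only [x]
          constructor <;> linarith [h1.1, h1.2, h2.1, h2.2]
      have hprod := Finset.prod_le_prod (s := Finset.univ) (fun i _ => abs_nonneg ((x k - x k') i))
        (fun i _ => hbd i)
      have hval : (∏ i, if i = i0 then l i / (M : ℝ) else l i) = (∏ i, l i) / M := by
        rw [← Finset.mul_prod_erase _ _ (Finset.mem_univ i0),
          ← Finset.mul_prod_erase _ l (Finset.mem_univ i0), if_pos rfl, div_mul_eq_mul_div]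
        congr 2
        exact Finset.prod_congr rfl fun i hi => if_neg (Finset.ne_of_mem_erase hi)
      rw [hval] at hprod
      have : (∏ i, l i) / M < c / n := by
        rw [div_lt_div_iff₀ hMpos hn']
        have : c * (c⁻¹ * n * ∏ i, l i) < c * M := mul_lt_mul_of_pos_left hMlt hc
        calc (∏ i, l i) * n = c * (c⁻¹ * n * ∏ i, l i) := by field_simp
          _ < _ := this
      linarith
  rw [Finset.card_range] at hcard
  exact_mod_cast hcard

end Admissible


/-! ### Hölder's inequality between L_1 and L_∞ -/

section Interpolation

theorem lintegral_rpow_le_of_le {α : Type*} [MeasurableSpace α] (μ : Measure α) {q : ℝ}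
    (hq : 1 ≤ q) {W : α → ℝ≥0∞} (hW : AEMeasurable W μ) {A : ℝ≥0∞} (hA : ∀ x, W x ≤ A) :
    ∫⁻ x, W x ^ q ∂μ ≤ A ^ (q - 1) * ∫⁻ x, W x ∂μ := by
  rw [← lintegral_const_mul'' _ hW]
  refine lintegral_mono fun x => ?_
  calc W x ^ q = W x ^ (q - 1) * W x ^ (1 : ℝ) := by
        rw [← ENNReal.rpow_add_of_nonneg _ _ (by linarith) (by norm_num)]; congr 1; ring
    _ ≤ A ^ (q - 1) * W x := by
        rw [ENNReal.rpow_one]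
        gcongr; exact hA x

/-- Hölder's inequality for a weight that is controlled in `L_∞` and in `L_1`. -/
theorem lintegral_mul_le_eLpNorm_mul {α : Type*} [MeasurableSpace α] (μ : Measure α)
    {p : ℝ≥0∞} (hp : 1 ≤ p) {f W : α → ℝ≥0∞} (hf : AEMeasurable f μ) (hW : AEMeasurable W μ)
    {A B : ℝ≥0∞} (hA : ∀ x, W x ≤ A) (hB : ∫⁻ x, W x ∂μ ≤ B) :
    ∫⁻ x, f x * W x ∂μ
      ≤ eLpNorm f p μ * (A ^ (p⁻¹).toReal * B ^ (1 - (p⁻¹).toReal)) := by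
  rcases eq_or_ne p ⊤ with rfl | hpt
  · simp only [ENNReal.inv_top, ENNReal.toReal_zero, ENNReal.rpow_zero, one_mul, sub_zero,
      ENNReal.rpow_one, eLpNorm_exponent_top]
    calc ∫⁻ x, f x * W x ∂μ ≤ ∫⁻ x, eLpNormEssSup f μ * W x ∂μ := by
          refine lintegral_mono_ae ?_
          filter_upwards [enorm_ae_le_eLpNormEssSup f μ] with x hx
          rw [enorm_eq_self] at hx
          gcongr
      _ = eLpNormEssSup f μ * ∫⁻ x, W x ∂μ := lintegral_const_mul'' _ hW
      _ ≤ _ := by gcongr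
  rcases hp.eq_or_lt with rfl | hp1
  · simp only [inv_one, ENNReal.toReal_one, ENNReal.rpow_one, sub_self, ENNReal.rpow_zero,
      mul_one, eLpNorm_one_eq_lintegral_enorm, enorm_eq_self]
    rw [← lintegral_mul_const'' _ hf]
    exact lintegral_mono fun x => by gcongr; exact hA x
  · set r := p.toReal with hr
    have hr1 : 1 < r := by
      rw [hr, ← ENNReal.toReal_one]; exact (ENNReal.toReal_lt_toReal (by simp) hpt).2 hp1
    have hconj : r.HolderConjugate (Real.conjExponent r) := Real.HolderConjugate.conjExponent hr1
    set q := Real.conjExponent r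
    have hq1 : 1 < q := hconj.symm.lt
    have hp0 : p ≠ 0 := (zero_lt_one.trans hp1).ne'
    have hinv : (p⁻¹).toReal = 1 / r := by rw [ENNReal.toReal_inv, one_div]
    have h1 : (q - 1) * (1 / q) = 1 / r := by
      have h2 := hconj.inv_add_inv_eq_one
      have : q ≠ 0 := by linarith
      have h3 : 1 / r = 1 - 1 / q := by rw [one_div, one_div]; linarith
      rw [h3]; field_simp
    have h2 : 1 / q = 1 - 1 / r := by
      have := hconj.inv_add_inv_eq_one
      rw [one_div, one_div]; linarith
    calc ∫⁻ x, f x * W x ∂μ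
        ≤ (∫⁻ x, f x ^ r ∂μ) ^ (1 / r) * (∫⁻ x, W x ^ q ∂μ) ^ (1 / q) :=
          ENNReal.lintegral_mul_le_Lp_mul_Lq μ hconj hf hW
      _ ≤ (∫⁻ x, f x ^ r ∂μ) ^ (1 / r) * (A ^ (q - 1) * B) ^ (1 / q) := by
          gcongr
          exact (lintegral_rpow_le_of_le μ hq1.le hW hA).trans (by gcongr)
      _ = _ := by
          rw [eLpNorm_eq_lintegral_rpow_enorm_toReal hp0 hpt,
            ENNReal.mul_rpow_of_nonneg _ _ (by positivity), ← ENNReal.rpow_mul, h1, hinv, ← h2]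
          simp only [enorm_eq_self]
          rfl

/-- The norm of `ℓ_θ` for sequences of extended nonnegative numbers. -/
noncomputable def ellNorm {ι : Type*} (θ : ℝ≥0∞) (a : ι → ℝ≥0∞) : ℝ≥0∞ :=
  if θ = ⊤ then ⨆ m, a m else (∑' m, a m ^ θ.toReal) ^ (1 / θ.toReal)

theorem ellNorm_eq_eLpNorm {ι : Type*} [MeasurableSpace ι] [MeasurableSingletonClass ι]
    [Countable ι] {θ : ℝ≥0∞} (hθ : 1 ≤ θ)
    (a : ι → ℝ≥0∞) : ellNorm θ a = eLpNorm a θ Measure.count := by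
  unfold ellNorm
  split_ifs with h
  · subst h
    rw [eLpNorm_exponent_top, eLpNormEssSup, essSup_count]
    simp only [enorm_eq_self]
  · rw [eLpNorm_eq_lintegral_rpow_enorm_toReal (zero_lt_one.trans_le hθ).ne' h, lintegral_count]
    simp only [enorm_eq_self]

theorem tsum_mul_le_ellNorm_mul {ι : Type*} [Countable ι] {θ : ℝ≥0∞} (hθ : 1 ≤ θ)
    (a W : ι → ℝ≥0∞) {A B : ℝ≥0∞} (hA : ∀ x, W x ≤ A) (hB : ∑' x, W x ≤ B) :
    ∑' m, a m * W m ≤ ellNorm θ a * (A ^ (θ⁻¹).toReal * B ^ (1 - (θ⁻¹).toReal)) := by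
  let _ : MeasurableSpace ι := ⊤
  have _ : MeasurableSingletonClass ι := ⟨fun _ => trivial⟩
  rw [ellNorm_eq_eLpNorm hθ, ← lintegral_count]
  exact lintegral_mul_le_eLpNorm_mul _ hθ measurable_from_top.aemeasurable
    measurable_from_top.aemeasurable hA (by rwa [lintegral_count])

/-- For finite θ this is a^θ ≤ A^{θ-1} a, summed. It turns the sup and sum bounds for the local
means of the fooling function into the power 1/θ of the number of levels. -/
theorem ellNorm_le_interp {ι : Type*} {θ : ℝ≥0∞} (hθ : 1 ≤ θ)
    (a : ι → ℝ≥0∞) {A B : ℝ≥0∞} (hA : ∀ x, a x ≤ A) (hB : ∑' x, a x ≤ B) :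
    ellNorm θ a ≤ A ^ (1 - (θ⁻¹).toReal) * B ^ (θ⁻¹).toReal := by
  let _ : MeasurableSpace ι := ⊤
  have _ : MeasurableSingletonClass ι := ⟨fun _ => trivial⟩
  unfold ellNorm
  split_ifs with h
  · subst h; simpa using hA
  · have h1 : 1 ≤ θ.toReal := by
      rw [← ENNReal.toReal_one]; exact ENNReal.toReal_mono h hθ
    have hpos : 0 < θ.toReal := by linarith
    have hl := lintegral_rpow_le_of_le (Measure.count : Measure ι) h1
      measurable_from_top.aemeasurable hA
    rw [lintegral_count, lintegral_count] at hl
    have hinv : (θ⁻¹).toReal = 1 / θ.toReal := by rw [ENNReal.toReal_inv, one_div]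
    calc (∑' m, a m ^ θ.toReal) ^ (1 / θ.toReal)
        ≤ (A ^ (θ.toReal - 1) * B) ^ (1 / θ.toReal) := by
          gcongr; exact hl.trans (by gcongr)
      _ = _ := by
          rw [ENNReal.mul_rpow_of_nonneg _ _ (by positivity), ← ENNReal.rpow_mul, hinv]
          congr 2
          field_simp

end Interpolation

/-! ### Counting multi-indices by their length -/

section Counting

/-- After the shift l = k + M, the inequality k + M + 1 ≤ (M + 1)(k + 1) splits off r^M (M + 1)^e
and leaves a convergent series that does not depend on M. -/
theorem tsum_pow_tail_le (e : ℕ) {r : ℝ} (hr0 : 0 < r) (hr1 : r < 1) :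
    ∃ C : ℝ, 0 < C ∧ ∀ M : ℕ,
      ∑' l : ℕ, ((l + 1 : ℕ) : ℝ≥0∞) ^ e * (if M ≤ l then ENNReal.ofReal (r ^ l) else 0)
        ≤ ENNReal.ofReal (C * (r ^ M * ((M : ℝ) + 1) ^ e)) := by
  have hs : Summable fun k : ℕ => ((k : ℝ) + 1) ^ e * r ^ k := by
    have h1 := (summable_pow_mul_geometric_of_norm_lt_one e
      (show ‖r‖ < 1 by rwa [Real.norm_of_nonneg hr0.le]))
    have h2 := (summable_nat_add_iff 1).2 h1
    refine (h2.mul_left r⁻¹).congr fun k => ?_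
    push_cast
    rw [pow_succ]
    field_simp
  have hnn : ∀ k : ℕ, 0 ≤ ((k : ℝ) + 1) ^ e * r ^ k := fun k => by positivity
  refine ⟨(∑' k : ℕ, ((k : ℝ) + 1) ^ e * r ^ k) + 1, add_pos_of_nonneg_of_pos (tsum_nonneg hnn) one_pos, fun M => ?_⟩
  have hsplit : ∑' l : ℕ, ((l + 1 : ℕ) : ℝ≥0∞) ^ e * (if M ≤ l then ENNReal.ofReal (r ^ l) else 0)
      = ∑' k : ℕ, ((k + M + 1 : ℕ) : ℝ≥0∞) ^ e * ENNReal.ofReal (r ^ (k + M)) := by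
    rw [← ENNReal.summable.sum_add_tsum_nat_add' (f := fun l : ℕ =>
      ((l + 1 : ℕ) : ℝ≥0∞) ^ e * (if M ≤ l then ENNReal.ofReal (r ^ l) else 0)) (k := M)]
    rw [Finset.sum_eq_zero, zero_add]
    · refine tsum_congr fun k => ?_
      rw [if_pos (Nat.le_add_left _ _)]
    · intro l hl
      rw [if_neg (not_le.2 (Finset.mem_range.1 hl)), mul_zero]
  rw [hsplit]
  calc ∑' k : ℕ, ((k + M + 1 : ℕ) : ℝ≥0∞) ^ e * ENNReal.ofReal (r ^ (k + M))
      ≤ ∑' k : ℕ, ENNReal.ofReal (r ^ M * ((M : ℝ) + 1) ^ e)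
          * ENNReal.ofReal (((k : ℝ) + 1) ^ e * r ^ k) := by
        refine ENNReal.tsum_le_tsum fun k => ?_
        rw [← ENNReal.ofReal_natCast, ← ENNReal.ofReal_pow (by positivity),
          ← ENNReal.ofReal_mul (by positivity), ← ENNReal.ofReal_mul (by positivity)]
        refine ENNReal.ofReal_le_ofReal ?_
        have h1 : ((k + M + 1 : ℕ) : ℝ) ≤ ((M : ℝ) + 1) * ((k : ℝ) + 1) := by
          push_cast; nlinarith [mul_nonneg (Nat.cast_nonneg (α := ℝ) k) (Nat.cast_nonneg (α := ℝ) M)]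
        calc ((k + M + 1 : ℕ) : ℝ) ^ e * r ^ (k + M)
            ≤ (((M : ℝ) + 1) * ((k : ℝ) + 1)) ^ e * r ^ (k + M) := by gcongr
          _ = _ := by rw [mul_pow, pow_add]; ring
    _ = ENNReal.ofReal (r ^ M * ((M : ℝ) + 1) ^ e)
          * ENNReal.ofReal (∑' k : ℕ, ((k : ℝ) + 1) ^ e * r ^ k) := by
        rw [ENNReal.tsum_mul_left, ENNReal.ofReal_tsum_of_nonneg hnn hs]
    _ ≤ _ := by
        rw [← ENNReal.ofReal_mul (by positivity)]
        refine ENNReal.ofReal_le_ofReal ?_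
        rw [mul_comm]
        gcongr
        linarith

/-- A multi-index is determined by its length l and its last d - 1 coordinates, each of which lies
in {0, …, l}. -/
theorem tsum_multiindex_le {d : ℕ} (hd : 1 ≤ d) (g : ℕ → ℝ≥0∞) :
    ∑' m : Fin d → ℕ, g (∑ i, m i) ≤ ∑' l : ℕ, ((l + 1 : ℕ) : ℝ≥0∞) ^ (d - 1) * g l := by
  obtain ⟨e, rfl⟩ : ∃ e, d = e + 1 := ⟨d - 1, by omega⟩
  let φ : (Fin (e + 1) → ℕ) → (Σ l : ℕ, Fin e → Fin (l + 1)) := fun m =>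
    ⟨∑ i, m i, fun i => ⟨m i.succ, Nat.lt_succ_of_le
      (Finset.single_le_sum (f := m) (fun _ _ => Nat.zero_le _) (Finset.mem_univ i.succ))⟩⟩
  have hφ : Function.Injective φ := by
    intro m m' h
    have h1 : ∑ i, m i = ∑ i, m' i := congrArg Sigma.fst h
    have h2 : ∀ i : Fin e, m i.succ = m' i.succ := by
      intro i
      have := congrArg (fun x : (Σ l : ℕ, Fin e → Fin (l + 1)) => ((x.2 i : Fin _) : ℕ)) h
      exact this
    funext i
    refine Fin.cases ?_ h2 i
    rw [Fin.sum_univ_succ, Fin.sum_univ_succ, Finset.sum_congr rfl (fun i _ => h2 i)] at h1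
    exact Nat.add_right_cancel h1
  calc ∑' m : Fin (e + 1) → ℕ, g (∑ i, m i)
      = ∑' m : Fin (e + 1) → ℕ, (fun x : (Σ l : ℕ, Fin e → Fin (l + 1)) => g x.1) (φ m) := rfl
    _ ≤ ∑' x : (Σ l : ℕ, Fin e → Fin (l + 1)), g x.1 :=
        ENNReal.tsum_comp_le_tsum_of_injective hφ _
    _ = ∑' l : ℕ, ((l + 1 : ℕ) : ℝ≥0∞) ^ (e + 1 - 1) * g l := by
        rw [ENNReal.tsum_sigma']
        refine tsum_congr fun l => ?_
        simp only [tsum_fintype, Finset.sum_const, Finset.card_univ, Fintype.card_fun,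
          Fintype.card_fin, nsmul_eq_mul, Nat.cast_pow, Nat.add_sub_cancel]

theorem exists_tsum_multiindex_tail_le {d : ℕ} (hd : 1 ≤ d) {r : ℝ} (hr0 : 0 < r) (hr1 : r < 1) :
    ∃ C : ℝ, 0 < C ∧ ∀ M : ℕ,
      ∑' m : Fin d → ℕ, (if M ≤ ∑ i, m i then ENNReal.ofReal (r ^ (∑ i, m i)) else 0)
        ≤ ENNReal.ofReal (C * (r ^ M * ((M : ℝ) + 1) ^ (d - 1))) := by
  obtain ⟨C, hC, h⟩ := tsum_pow_tail_le (d - 1) hr0 hr1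
  exact ⟨C, hC, fun M => (tsum_multiindex_le hd
    (fun l => if M ≤ l then ENNReal.ofReal (r ^ l) else 0)).trans (h M)⟩

/-- The weighted tail sum of an `ℓ_θ` sequence over the multi-indices with `|m|₁ ≥ M`. -/
theorem exists_weighted_tail_le {d : ℕ} (hd : 1 ≤ d) {r : ℝ} (hr0 : 0 < r) (hr1 : r < 1)
    {θ : ℝ≥0∞} (hθ : 1 ≤ θ) :
    ∃ C : ℝ, 0 < C ∧ ∀ (M : ℕ) (a : (Fin d → ℕ) → ℝ≥0∞),
      ∑' m, a m * (if M ≤ ∑ i, m i then ENNReal.ofReal (r ^ (∑ i, m i)) else 0)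
        ≤ ellNorm θ a
          * ENNReal.ofReal (C * (r ^ M * ((M : ℝ) + 1) ^ (((d : ℝ) - 1) * (1 - (θ⁻¹).toReal)))) := by
  obtain ⟨C, hC, h⟩ := exists_tsum_multiindex_tail_le hd hr0 hr1
  have ht1 : (θ⁻¹).toReal ≤ 1 := by
    rw [← ENNReal.toReal_one]
    exact ENNReal.toReal_mono (by simp) (ENNReal.inv_le_one.2 hθ)
  set t := (θ⁻¹).toReal
  have ht0 : 0 ≤ t := ENNReal.toReal_nonneg
  refine ⟨C ^ (1 - t), by positivity, fun M a => ?_⟩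
  -- Here the power of the logarithm arises: the weight has supremum r^M and total mass about r^M (M
  -- + 1)^{d-1}. Interpolation keeps r^M and puts the power 1 - 1/θ on the polynomial factor.
  refine (tsum_mul_le_ellNorm_mul hθ a _ (A := ENNReal.ofReal (r ^ M)) (fun m => ?_) (h M)).trans ?_
  · split_ifs with hM
    · exact ENNReal.ofReal_le_ofReal (pow_le_pow_of_le_one hr0.le hr1.le hM)
    · exact zero_le
  · gcongr
    have hM1 : (0 : ℝ) < (M : ℝ) + 1 := by positivity
    rw [ENNReal.ofReal_rpow_of_pos (by positivity), ENNReal.ofReal_rpow_of_pos (by positivity),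
      ← ENNReal.ofReal_mul (by positivity)]
    refine ENNReal.ofReal_le_ofReal (le_of_eq ?_)
    have hX : (0 : ℝ) < r ^ M := by positivity
    rw [Real.mul_rpow hC.le (by positivity), Real.mul_rpow hX.le (by positivity),
      ← Real.rpow_natCast ((M : ℝ) + 1), ← Real.rpow_mul hM1.le, Nat.cast_sub hd, Nat.cast_one]
    have : (r ^ M) ^ t * (r ^ M) ^ (1 - t) = r ^ M := by
      rw [← Real.rpow_add hX]; simp
    linear_combination C ^ (1 - t) * ((M : ℝ) + 1) ^ (((d : ℝ) - 1) * (1 - t)) * this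

/-- The multi-indices of length `M`. -/
def levelSet (d M : ℕ) : Finset (Fin d → ℕ) := Finset.Nat.antidiagonalTuple d M

theorem mem_levelSet {d M : ℕ} {m : Fin d → ℕ} : m ∈ levelSet d M ↔ ∑ i, m i = M :=
  Finset.Nat.mem_antidiagonalTuple

/-- The last d - 1 coordinates may be chosen freely in {0, …, ⌊M/d⌋}; the first one absorbs the
remainder. -/
theorem card_levelSet_ge {d : ℕ} (hd : 1 ≤ d) (M : ℕ) :
    (((M : ℝ) + 1) / d) ^ (d - 1) ≤ ((levelSet d M).card : ℝ) := by
  obtain ⟨e, rfl⟩ : ∃ e, d = e + 1 := ⟨d - 1, by omega⟩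
  set D := M / (e + 1) with hD
  have hDle : (((M : ℝ) + 1) / ((e + 1 : ℕ) : ℝ)) ≤ ((D + 1 : ℕ) : ℝ) := by
    rw [div_le_iff₀ (by positivity)]
    have : M + 1 ≤ (D + 1) * (e + 1) := by
      have := Nat.lt_div_mul_add (a := M) (b := e + 1) (by omega)
      rw [← hD] at this; nlinarith
    exact_mod_cast this
  let φ : (Fin e → Fin (D + 1)) → (Fin (e + 1) → ℕ) := fun t =>
    Fin.cons (M - ∑ i, (t i : ℕ)) fun i => (t i : ℕ)
  have hφ : Function.Injective φ := by
    intro t t' h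
    funext i
    have := congrFun h i.succ
    simp only [φ, Fin.cons_succ] at this
    exact Fin.ext this
  have hmem : ∀ t, φ t ∈ levelSet (e + 1) M := by
    intro t
    rw [mem_levelSet, Fin.sum_univ_succ]
    simp only [φ, Fin.cons_zero, Fin.cons_succ]
    refine Nat.sub_add_cancel ?_
    calc ∑ i, (t i : ℕ) ≤ ∑ _i : Fin e, D := Finset.sum_le_sum fun i _ => Nat.le_of_lt_succ (t i).2
      _ = e * D := by simp
      _ ≤ (e + 1) * D := by gcongr; omega
      _ ≤ M := Nat.mul_div_le _ _
  have hcard : (D + 1) ^ e ≤ (levelSet (e + 1) M).card := by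
    calc (D + 1) ^ e = (Finset.univ : Finset (Fin e → Fin (D + 1))).card := by simp
      _ ≤ _ := Finset.card_le_card_of_injOn φ (fun t _ => hmem t) hφ.injOn
  calc _ ≤ ((D + 1 : ℕ) : ℝ) ^ (e + 1 - 1) := by gcongr
    _ ≤ _ := by rw [Nat.add_sub_cancel]; exact_mod_cast hcard

end Counting


/-! ### Poisson summation through periodization -/

section Periodization

theorem tsum_pi_prod {ι : Type*} {d : ℕ} (a : Fin d → ι → ℝ≥0∞) :
    ∑' k : Fin d → ι, ∏ i, a i (k i) = ∏ i, ∑' j, a i j := by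
  induction d with
  | zero => simp
  | succ d ih =>
    rw [← (Fin.consEquiv fun _ => ι).tsum_eq, ENNReal.tsum_prod', Fin.prod_univ_succ,
      ← ih (fun i => a i.succ), ← ENNReal.tsum_mul_right]
    refine tsum_congr fun j => ?_
    rw [← ENNReal.tsum_mul_left]
    refine tsum_congr fun k => ?_
    rw [Fin.prod_univ_succ]
    simp [Fin.consEquiv]

theorem summable_one_add_abs_inv_sq : Summable fun k : ℤ => ((1 + |(k : ℝ)|) ^ 2)⁻¹ := by
  have h := (Real.summable_one_div_int_pow (p := 2)).2 one_lt_two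
  refine Summable.of_nonneg_of_le (fun k => by positivity) (fun k => ?_)
    (h.add (summable_of_ne_finset_zero (s := {0}) (f := fun k : ℤ => if k = 0 then (1 : ℝ) else 0)
      (by intro b hb; rw [if_neg (by simpa using hb)])))
  split_ifs with hk
  · subst hk; simp
  · rw [add_zero, one_div, ← sq_abs (k : ℝ)]
    have : 0 < |(k : ℝ)| := abs_pos.2 (by exact_mod_cast hk)
    gcongr
    linarith

theorem tsum_pi_one_add_abs_inv_sq_lt_top (d : ℕ) :
    ∑' k : Fin d → ℤ, ∏ i, ENNReal.ofReal (((1 + |(k i : ℝ)|) ^ 2)⁻¹) < ⊤ := by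
  rw [tsum_pi_prod (fun _ (k : ℤ) => ENNReal.ofReal (((1 + |(k : ℝ)|) ^ 2)⁻¹))]
  refine ENNReal.prod_lt_top fun i _ => ?_
  rw [← ENNReal.ofReal_tsum_of_nonneg (fun k => by positivity) summable_one_add_abs_inv_sq]
  exact ENNReal.ofReal_lt_top

theorem summable_pi_one_add_abs_inv_sq (d : ℕ) :
    Summable fun k : Fin d → ℤ => ∏ i, ((1 + |(k i : ℝ)|) ^ 2)⁻¹ := by
  have h := ENNReal.summable_toReal (tsum_pi_one_add_abs_inv_sq_lt_top d).ne
  refine h.congr fun k => ?_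
  rw [ENNReal.toReal_prod]
  exact Finset.prod_congr rfl fun i _ => ENNReal.toReal_ofReal (by positivity)

theorem one_add_abs_add_inv_sq_le {R x k : ℝ} (hx : |x| ≤ R) :
    ((1 + |x + k|) ^ 2)⁻¹ ≤ (1 + R) ^ 2 * ((1 + |k|) ^ 2)⁻¹ := by
  have hR : 0 ≤ R := (abs_nonneg x).trans hx
  have h : 1 + |k| ≤ (1 + R) * (1 + |x + k|) := by
    have : |k| ≤ |x + k| + |x| := by
      calc |k| = |(x + k) - x| := by congr 1; ring
        _ ≤ _ := abs_sub _ _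
    nlinarith [mul_nonneg hR (abs_nonneg (x + k))]
  rw [← div_eq_mul_inv, inv_eq_one_div, div_le_div_iff₀ (by positivity) (by positivity), one_mul,
    ← mul_pow]
  gcongr

variable {d : ℕ} {H : (Fin d → ℝ) → ℂ} {C : ℝ}

theorem norm_translate_le (hC : 0 ≤ C) (hH : ∀ x, ‖H x‖ ≤ C * ∏ i, ((1 + |x i|) ^ 2)⁻¹) {R : ℝ}
    {x : Fin d → ℝ}
    (hx : ∀ i, |x i| ≤ R) (k : Fin d → ℤ) :
    ‖H (fun i => x i + k i)‖ ≤ (C * ((1 + R) ^ 2) ^ d) * ∏ i, ((1 + |(k i : ℝ)|) ^ 2)⁻¹ := by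
  refine (hH _).trans ?_
  rw [mul_assoc]
  gcongr
  calc ∏ i, ((1 + |x i + k i|) ^ 2)⁻¹
      ≤ ∏ i, ((1 + R) ^ 2 * ((1 + |(k i : ℝ)|) ^ 2)⁻¹) :=
        Finset.prod_le_prod (fun i _ => by positivity)
          (fun i _ => one_add_abs_add_inv_sq_le (hx i))
    _ = _ := by rw [Finset.prod_mul_distrib, Finset.prod_const, Finset.card_univ, Fintype.card_fin]

theorem continuous_periodization (hC : 0 ≤ C) (hc : Continuous H)
    (hH : ∀ x, ‖H x‖ ≤ C * ∏ i, ((1 + |x i|) ^ 2)⁻¹) :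
    Continuous fun x : Fin d → ℝ => ∑' k : Fin d → ℤ, H (fun i => x i + k i) := by
  rw [continuous_iff_continuousAt]
  intro x
  have hcont : ContinuousOn (fun x : Fin d → ℝ => ∑' k : Fin d → ℤ, H (fun i => x i + k i))
      (Metric.ball x 1) := by
    have hu := (summable_pi_one_add_abs_inv_sq d).mul_left (C * ((1 + (‖x‖ + 1)) ^ 2) ^ d)
    refine continuousOn_tsum (f := fun (k : Fin d → ℤ) (x : Fin d → ℝ) => H (fun i => x i + k i))
      (fun k => ?_) hu (fun k y hy => ?_)
    · have hk : Continuous fun (y : Fin d → ℝ) (i : Fin d) => y i + (k i : ℝ) :=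
        continuous_pi fun i => (continuous_apply i).add continuous_const
      exact (hc.comp hk).continuousOn
    · refine norm_translate_le hC hH (fun i => ?_) k
      have h1 : ‖y - x‖ < 1 := by rwa [mem_ball_iff_norm] at hy
      calc |y i| ≤ ‖y‖ := norm_le_pi_norm y i
        _ = ‖x + (y - x)‖ := by congr 1; abel
        _ ≤ ‖x‖ + ‖y - x‖ := norm_add_le _ _
        _ ≤ ‖x‖ + 1 := by linarith
  exact hcont.continuousAt (Metric.ball_mem_nhds x one_pos)

/-- The half-open cube that represents the torus. -/
def torusCell (d : ℕ) : Set (Fin d → ℝ) := {x | ∀ i, x i ∈ Set.Ioc (0 : ℝ) (0 + 1)}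

theorem measurableSet_torusCell : MeasurableSet (torusCell d) := by
  have : torusCell d = Set.univ.pi fun _ => Set.Ioc (0 : ℝ) (0 + 1) := by
    ext x; simp [torusCell]
  rw [this]
  exact MeasurableSet.univ_pi fun _ => measurableSet_Ioc

theorem volume_torusCell_lt_top : volume (torusCell d) < ⊤ := by
  have : torusCell d = Set.univ.pi fun _ => Set.Ioc (0 : ℝ) (0 + 1) := by
    ext x; simp [torusCell]
  rw [this, Real.volume_pi_Ioc]
  exact ENNReal.prod_lt_top fun _ _ => ENNReal.ofReal_lt_top

/-- Integration over the space as a sum over the integer translates of the cell. -/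
theorem hasSum_integral_torusCell {G : (Fin d → ℝ) → ℂ} (hG : Integrable G) :
    HasSum (fun k : Fin d → ℤ => ∫ x in torusCell d, G (fun i => x i + k i)) (∫ x, G x) := by
  set S : (Fin d → ℤ) → Set (Fin d → ℝ) := fun k => (fun x => x - fun i => (k i : ℝ)) ⁻¹' torusCell d
  have hmem : ∀ k x, x ∈ S k ↔ ∀ i, k i = ⌈x i⌉ - 1 := by
    intro k x
    simp only [S, torusCell, Set.mem_preimage, Set.mem_ofPred_eq, Pi.sub_apply, Set.mem_Ioc]
    refine forall_congr' fun i => ?_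
    rw [eq_sub_iff_add_eq, eq_comm, Int.ceil_eq_iff]
    push_cast
    constructor <;> rintro ⟨h1, h2⟩ <;> constructor <;> linarith
  have hSm : ∀ k, MeasurableSet (S k) := fun k =>
    measurableSet_torusCell.preimage (measurable_id.sub_const _)
  have hdisj : Pairwise (Function.onFun Disjoint S) := by
    intro k l hkl
    refine Set.disjoint_left.2 fun x hx hx' => hkl (funext fun i => ?_)
    rw [(hmem k x).1 hx i, (hmem l x).1 hx' i]
  have hU : ⋃ k, S k = Set.univ := by
    refine Set.eq_univ_of_forall fun x => Set.mem_iUnion.2 ⟨fun i => ⌈x i⌉ - 1, ?_⟩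
    rw [hmem]; exact fun i => rfl
  have h := hasSum_integral_iUnion hSm hdisj (f := G) (μ := volume) hG.integrableOn
  rw [hU, setIntegral_univ] at h
  convert! h using 2 with k
  have hmp : MeasurePreserving (fun x : Fin d → ℝ => x - fun i => (k i : ℝ)) volume volume :=
    measurePreserving_sub_right volume _
  have he : MeasurableEmbedding (fun x : Fin d → ℝ => x - fun i => (k i : ℝ)) :=
    (MeasurableEquiv.subRight (fun i => (k i : ℝ))).measurableEmbedding
  rw [← hmp.setIntegral_preimage_emb he]
  refine integral_congr_ae (Filter.Eventually.of_forall fun x => ?_)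
  simp

theorem integrable_of_decay (hc : Continuous H)
    (hH : ∀ x, ‖H x‖ ≤ C * ∏ i, ((1 + |x i|) ^ 2)⁻¹) : Integrable H := by
  have h1 : Integrable (fun t : ℝ => ((1 + |t|) ^ 2)⁻¹) := by
    refine Integrable.mono' (integrable_inv_one_add_sq) (Continuous.aestronglyMeasurable ?_)
      (Filter.Eventually.of_forall fun t => ?_)
    · exact Continuous.inv₀ (by fun_prop) (fun t => by positivity)
    · rw [Real.norm_of_nonneg (by positivity)]
      gcongr
      nlinarith [abs_nonneg t, sq_abs t]
  have h2 : Integrable (fun x : Fin d → ℝ => ∏ i, ((1 + |x i|) ^ 2)⁻¹) :=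
    Integrable.fintype_prod (f := fun _ t => ((1 + |t|) ^ 2)⁻¹) (fun _ => h1)
  exact Integrable.mono' (h2.const_mul C) hc.aestronglyMeasurable
    (Filter.Eventually.of_forall hH)

/-- The form of Poisson's summation formula in which the Fourier transform vanishes at all nonzero
integer frequencies. -/
theorem tsum_eq_integral_of_fourier_eq_zero (hC : 0 ≤ C) (hc : Continuous H)
    (hH : ∀ x, ‖H x‖ ≤ C * ∏ i, ((1 + |x i|) ^ 2)⁻¹)
    (h0 : ∀ l : Fin d → ℤ, l ≠ 0 →
      ∫ x, Complex.exp (-(2 * Real.pi * Complex.I * ((∑ i, l i * x i : ℝ) : ℂ))) * H x = 0) :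
    ∑' k : Fin d → ℤ, H (fun i => (k i : ℝ)) = ∫ x, H x := by
  set F : (Fin d → ℝ) → ℂ := fun x => ∑' k : Fin d → ℤ, H (fun i => x i + k i) with hF
  have hFc : Continuous F := continuous_periodization hC hc hH
  have hFper : ∀ (x : Fin d → ℝ) (l : Fin d → ℤ), F (fun i => x i + l i) = F x := by
    intro x l
    rw [hF]
    simp only
    rw [← (Equiv.addLeft l).tsum_eq (fun k : Fin d → ℤ => H (fun i => x i + k i))]
    refine tsum_congr fun k => ?_
    congr 1; funext i
    simp [add_assoc]
  let q : (Fin d → ℝ) → UnitAddTorus (Fin d) := Pi.map fun _ t => (t : UnitAddCircle)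
  have hq : IsOpenQuotientMap q := IsOpenQuotientMap.piMap fun _ =>
    QuotientAddGroup.isOpenQuotientMap_mk
  have hlift : ∀ x y, q x = q y → F x = F y := by
    intro x y hxy
    have hx : ∀ i, ∃ l : ℤ, y i = x i + l := by
      intro i
      have h1 : ((x i : ℝ) : UnitAddCircle) = (y i : UnitAddCircle) := congrFun hxy i
      have h2 : ((y i - x i : ℝ) : UnitAddCircle) = 0 := by
        rw [AddCircle.coe_sub, h1, sub_self]
      obtain ⟨l, hl⟩ := AddCircle.coe_eq_zero_iff (1 : ℝ) |>.1 h2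
      refine ⟨l, ?_⟩
      rw [zsmul_eq_mul, mul_one] at hl
      linarith
    choose l hl using hx
    rw [show y = fun i => x i + l i from funext hl, hFper]
  let Ft : UnitAddTorus (Fin d) → ℂ := fun t => F (Function.surjInv hq.surjective t)
  have hFt : ∀ x, Ft (q x) = F x := fun x => hlift _ _ (Function.surjInv_eq hq.surjective _)
  have hFtc : Continuous Ft := by
    rw [hq.isQuotientMap.continuous_iff]
    exact hFc.congr fun x => (hFt x).symm
  let Fc : C(UnitAddTorus (Fin d), ℂ) := ⟨Ft, hFtc⟩
  -- The periodization now lives on the torus as a continuous function; its Fourier coefficients are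
  -- computed by unfolding.
  have hchar : ∀ (l : Fin d → ℤ) (x : Fin d → ℝ), UnitAddTorus.mFourier (-l) (q x)
      = Complex.exp (-(2 * Real.pi * Complex.I * ((∑ i, l i * x i : ℝ) : ℂ))) := by
    intro l x
    simp only [UnitAddTorus.mFourier, ContinuousMap.coe_mk, q, Pi.map_apply, fourier_coe_apply]
    rw [← Complex.exp_sum]
    congr 1
    push_cast
    rw [Finset.mul_sum, ← Finset.sum_neg_distrib]
    refine Finset.sum_congr rfl fun i _ => ?_
    simp; ring
  have hHi := integrable_of_decay hc hH
  have hcoeff : ∀ l : Fin d → ℤ, UnitAddTorus.mFourierCoeff Fc l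
      = ∫ x, Complex.exp (-(2 * Real.pi * Complex.I * ((∑ i, l i * x i : ℝ) : ℂ))) * H x := by
    intro l
    rw [UnitAddTorus.mFourierCoeff_eq_integral _ _ (fun _ => 0)]
    set E : (Fin d → ℝ) → ℂ := fun x =>
      Complex.exp (-(2 * Real.pi * Complex.I * ((∑ i, l i * x i : ℝ) : ℂ))) with hE
    have hEc : Continuous E := by fun_prop
    have hEn : ∀ x, ‖E x‖ = 1 := by
      intro x
      simp only [hE]
      rw [show -(2 * (Real.pi : ℂ) * Complex.I * ((∑ i, l i * x i : ℝ) : ℂ))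
        = ((-(2 * Real.pi * ∑ i, l i * x i) : ℝ) : ℂ) * Complex.I by push_cast; ring,
        Complex.norm_exp_ofReal_mul_I]
    have hEper : ∀ (x : Fin d → ℝ) (k : Fin d → ℤ), E (fun i => x i + k i) = E x := by
      intro x k
      simp only [hE]
      rw [← hchar, ← hchar]
      congr 1
      funext i
      simp only [q, Pi.map_apply]
      rw [AddCircle.coe_add, add_eq_left, AddCircle.coe_eq_zero_iff]
      exact ⟨k i, by simp⟩
    have hEH : Integrable (fun x => E x * H x) := by
      refine hHi.norm.mono' (hEc.mul hc).aestronglyMeasurable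
        (Filter.Eventually.of_forall fun x => ?_)
      rw [norm_mul, hEn, one_mul]
    have hs := (hasSum_integral_torusCell hEH).tsum_eq
    rw [← hs]
    have hR : ∀ k : Fin d → ℤ, ∀ x ∈ torusCell d,
        ‖E (fun i => x i + k i) * H (fun i => x i + k i)‖
          ≤ (C * ((1 + 1) ^ 2) ^ d) * ∏ i, ((1 + |(k i : ℝ)|) ^ 2)⁻¹ := by
      intro k x hx
      rw [norm_mul, hEn, one_mul]
      refine norm_translate_le hC hH (fun i => ?_) k
      have := hx i
      rw [abs_of_pos this.1]; linarith [this.2]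
    rw [integral_tsum_of_summable_integral_norm (μ := volume.restrict (torusCell d))
      (F := fun (k : Fin d → ℤ) (x : Fin d → ℝ) => E (fun i => x i + k i) * H (fun i => x i + k i))]
    · refine setIntegral_congr_fun measurableSet_torusCell fun x _ => ?_
      change UnitAddTorus.mFourier (-l) (q x) • Ft (q x) = _
      rw [hchar, hFt, hF, smul_eq_mul]
      simp only
      rw [← tsum_mul_left]
      refine tsum_congr fun k => ?_
      rw [hEper]
    · intro k
      have : Integrable (fun x : Fin d → ℝ => E (fun i => x i + k i) * H (fun i => x i + k i)) :=
        hEH.comp_add_right (fun i => (k i : ℝ))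
      exact this.integrableOn
    · refine Summable.of_nonneg_of_le (fun k => integral_nonneg fun x => norm_nonneg _)
        (fun k => ?_) (((summable_pi_one_add_abs_inv_sq d).mul_left
          (C * ((1 + 1) ^ 2) ^ d)).mul_right (volume.real (torusCell d)))
      have hb := norm_setIntegral_le_of_norm_le_const (f := fun x : Fin d → ℝ =>
        ‖E (fun i => x i + k i) * H (fun i => x i + k i)‖) volume_torusCell_lt_top
        (fun x hx => by rw [norm_norm]; exact hR k x hx)
      exact (Real.le_norm_self _).trans hb
  have hzero : ∀ l : Fin d → ℤ, l ≠ 0 → UnitAddTorus.mFourierCoeff Fc l = 0 := fun l hl => by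
    rw [hcoeff, h0 l hl]
  -- Only the coefficient at 0 survives, so the Fourier series is trivially summable and hence
  -- equals the continuous function at every point. Evaluation at the origin gives the claim.
  have hsum : Summable (UnitAddTorus.mFourierCoeff Fc) :=
    summable_of_ne_finset_zero (s := {0}) fun l hl => hzero l (by simpa using hl)
  have h1 := UnitAddTorus.hasSum_mFourier_series_apply_of_summable hsum (q 0)
  have h2 : HasSum (fun i => UnitAddTorus.mFourierCoeff Fc i • UnitAddTorus.mFourier i (q 0))
      (UnitAddTorus.mFourierCoeff Fc 0 • UnitAddTorus.mFourier 0 (q 0)) :=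
    hasSum_single 0 fun l hl => by rw [hzero l hl, zero_smul]
  have h3 := h1.unique h2
  rw [UnitAddTorus.mFourier_zero, hcoeff] at h3
  have h4 : Fc (q 0) = F 0 := hFt 0
  rw [h4] at h3
  simpa [hF] using h3

end Periodization


/-! ### Tempered distributions commute with convolution integrals -/

section Exchange

open LineDeriv

variable {E : Type*} [NormedAddCommGroup E] [InnerProductSpace ℝ E]

/-- A finite product of spaces of bounded continuous multilinear-map valued functions. -/
def JetSpace (E : Type*) [NormedAddCommGroup E] [InnerProductSpace ℝ E]
    (s : Finset (ℕ × ℕ)) : Type _ :=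
  (p : s) → (E →ᵇ (E [×(p : ℕ × ℕ).2]→L[ℝ] ℂ))

noncomputable instance (s : Finset (ℕ × ℕ)) : NormedAddCommGroup (JetSpace E s) :=
  @Pi.normedAddCommGroup s _ _ (fun _ => inferInstance)

noncomputable instance (s : Finset (ℕ × ℕ)) : NormedSpace ℂ (JetSpace E s) :=
  @Pi.normedSpace ℂ _ s _ _ (fun _ => inferInstance) (fun _ => inferInstance)

instance (s : Finset (ℕ × ℕ)) : CompleteSpace (JetSpace E s) :=
  @Pi.complete s _ (fun _ => inferInstance) (fun _ => inferInstance)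

/-- The evaluation of an element of the product, as a linear map. -/
noncomputable def jetEvalLinear (s : Finset (ℕ × ℕ)) (p : s) (y : E) (m : Fin (p : ℕ × ℕ).2 → E) :
    JetSpace E s →ₗ[ℂ] ℂ where
  toFun x := x p y m
  map_add' _ _ := rfl
  map_smul' _ _ := rfl

theorem norm_jet_apply_le (s : Finset (ℕ × ℕ)) (x : JetSpace E s) (p : s) (y : E) :
    ‖x p y‖ ≤ ‖x‖ :=
  ((x p).norm_coe_le_norm y).trans
    (@norm_le_pi_norm s (fun p => E →ᵇ (E [×(p : ℕ × ℕ).2]→L[ℝ] ℂ)) _ (fun _ => inferInstance) x p)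

theorem norm_jetEvalLinear_le (s : Finset (ℕ × ℕ)) (p : s) (y : E) (m : Fin (p : ℕ × ℕ).2 → E)
    (x : JetSpace E s) : ‖jetEvalLinear s p y m x‖ ≤ (∏ i, ‖m i‖) * ‖x‖ := by
  rw [mul_comm]
  exact ((x p y).le_opNorm m).trans
    (mul_le_mul_of_nonneg_right (norm_jet_apply_le s x p y)
      (Finset.prod_nonneg fun _ _ => norm_nonneg _))

/-- The evaluation of an element of the product. -/
noncomputable def jetEval (s : Finset (ℕ × ℕ)) (p : s) (y : E) (m : Fin (p : ℕ × ℕ).2 → E) :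
    JetSpace E s →L[ℂ] ℂ :=
  (jetEvalLinear s p y m).mkContinuous _ (norm_jetEvalLinear_le s p y m)

/-- The embedding of the Schwartz space into a finite product of spaces of bounded continuous
functions that is attached to finitely many Schwartz seminorms. -/
noncomputable def seminormEmbedding (s : Finset (ℕ × ℕ)) :
    𝓢(E, ℂ) →ₗ[ℂ] JetSpace E s where
  toFun φ := fun p => BoundedContinuousFunction.ofNormedAddCommGroup
    (fun y => ((‖y‖ ^ (p : ℕ × ℕ).1 : ℝ) : ℂ) • iteratedFDeriv ℝ (p : ℕ × ℕ).2 φ y)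
    ((Complex.continuous_ofReal.comp (continuous_norm.pow _)).smul
      ((φ.smooth ⊤).continuous_iteratedFDeriv (mod_cast le_top)))
    (SchwartzMap.seminorm ℂ (p : ℕ × ℕ).1 (p : ℕ × ℕ).2 φ)
    (fun y => by
      rw [norm_smul, Complex.norm_real, Real.norm_of_nonneg (by positivity)]
      exact φ.le_seminorm ℂ _ _ y)
  map_add' φ ψ := by
    funext p
    ext1 y
    change ((‖y‖ ^ (p : ℕ × ℕ).1 : ℝ) : ℂ) • iteratedFDeriv ℝ (p : ℕ × ℕ).2 ((φ : E → ℂ) + (ψ : E → ℂ)) y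
      = ((‖y‖ ^ (p : ℕ × ℕ).1 : ℝ) : ℂ) • iteratedFDeriv ℝ (p : ℕ × ℕ).2 φ y
        + ((‖y‖ ^ (p : ℕ × ℕ).1 : ℝ) : ℂ) • iteratedFDeriv ℝ (p : ℕ × ℕ).2 ψ y
    rw [← smul_add]
    congr 1
    exact iteratedFDeriv_add_apply ((φ.smooth _).contDiffAt) ((ψ.smooth _).contDiffAt)
  map_smul' c φ := by
    funext p
    ext1 y
    change ((‖y‖ ^ (p : ℕ × ℕ).1 : ℝ) : ℂ) • iteratedFDeriv ℝ (p : ℕ × ℕ).2 (c • (φ : E → ℂ)) y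
      = c • (((‖y‖ ^ (p : ℕ × ℕ).1 : ℝ) : ℂ) • iteratedFDeriv ℝ (p : ℕ × ℕ).2 φ y)
    rw [smul_comm]
    congr 1
    exact iteratedFDeriv_const_smul_apply ((φ.smooth _).contDiffAt)

theorem seminormEmbedding_apply (s : Finset (ℕ × ℕ)) (φ : 𝓢(E, ℂ)) (p : s) (y : E) :
    seminormEmbedding s φ p y
      = ((‖y‖ ^ (p : ℕ × ℕ).1 : ℝ) : ℂ) • iteratedFDeriv ℝ (p : ℕ × ℕ).2 φ y := rfl

theorem norm_seminormEmbedding_apply (s : Finset (ℕ × ℕ)) (φ : 𝓢(E, ℂ)) (p : s) (y : E) :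
    ‖seminormEmbedding s φ p y‖
      = ‖y‖ ^ (p : ℕ × ℕ).1 * ‖iteratedFDeriv ℝ (p : ℕ × ℕ).2 φ y‖ := by
  rw [seminormEmbedding_apply, norm_smul, Complex.norm_real, Real.norm_of_nonneg (by positivity)]

theorem jetEval_seminormEmbedding (s : Finset (ℕ × ℕ)) (φ : 𝓢(E, ℂ)) (p : s) (y : E)
    (m : Fin (p : ℕ × ℕ).2 → E) :
    jetEval s p y m (seminormEmbedding s φ)
      = ((‖y‖ ^ (p : ℕ × ℕ).1 : ℝ) : ℂ) * iteratedFDeriv ℝ (p : ℕ × ℕ).2 φ y m := rfl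

theorem seminorm_le_norm_seminormEmbedding (s : Finset (ℕ × ℕ)) (φ : 𝓢(E, ℂ)) (p : s) :
    SchwartzMap.seminorm ℂ (p : ℕ × ℕ).1 (p : ℕ × ℕ).2 φ ≤ ‖seminormEmbedding s φ‖ := by
  refine φ.seminorm_le_bound ℂ _ _ (norm_nonneg _) fun y => ?_
  rw [← norm_seminormEmbedding_apply]
  exact norm_jet_apply_le s _ p y

theorem norm_seminormEmbedding_le (s : Finset (ℕ × ℕ)) (φ : 𝓢(E, ℂ)) {M : ℝ} (hM : 0 ≤ M)
    (h : ∀ p ∈ s, ∀ y, ‖y‖ ^ p.1 * ‖iteratedFDeriv ℝ p.2 φ y‖ ≤ M) :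
    ‖seminormEmbedding s φ‖ ≤ M := by
  refine (@pi_norm_le_iff_of_nonneg s (fun p => E →ᵇ (E [×(p : ℕ × ℕ).2]→L[ℝ] ℂ)) _
    (fun _ => inferInstance) (seminormEmbedding s φ) _
    hM).2 fun p => (BoundedContinuousFunction.norm_le hM).2 fun y => ?_
  rw [norm_seminormEmbedding_apply]
  exact h p p.2 y

/-- A tempered distribution factors through one of these embeddings. -/
theorem exists_dual_seminormEmbedding (u : 𝓢'(E, ℂ)) :
    ∃ (s : Finset (ℕ × ℕ)) (g : StrongDual ℂ (JetSpace E s)),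
      ∀ φ, u φ = g (seminormEmbedding s φ) := by
  have hcont : Continuous fun φ : 𝓢(E, ℂ) => u φ := u.continuous
  let q : Seminorm ℂ 𝓢(E, ℂ) := (normSeminorm ℂ ℂ).comp u.toLinearMap
  have hq : Continuous q := continuous_norm.comp hcont
  obtain ⟨s₀, C, -, hs₀⟩ := Seminorm.bound_of_continuous (schwartz_withSeminorms ℂ E ℂ) q hq
  -- The supremum seminorm is added to make the embedding injective. Then u lives on the range,
  -- where it is bounded for the Banach norm, and Hahn–Banach extends it to the whole space.
  set s := insert (0, 0) s₀ with hs
  have h0 : ((0, 0) : ℕ × ℕ) ∈ s := Finset.mem_insert_self _ _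
  have hinj : Function.Injective (seminormEmbedding (E := E) s) := by
    rw [injective_iff_map_eq_zero]
    intro φ hφ
    have h1 := seminorm_le_norm_seminormEmbedding s φ ⟨(0, 0), h0⟩
    rw [hφ, norm_zero] at h1
    ext y
    have h2 := φ.norm_le_seminorm ℂ y
    have : ‖φ y‖ ≤ 0 := h2.trans h1
    simpa using this
  have hbound : ∀ φ, ‖u φ‖ ≤ C * ‖seminormEmbedding s φ‖ := by
    intro φ
    have h1 := hs₀ φ
    rw [smul_apply, NNReal.smul_def, smul_eq_mul] at h1
    refine le_trans h1 (mul_le_mul_of_nonneg_left ?_ C.2)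
    refine Seminorm.finset_sup_apply_le (norm_nonneg _) fun p hp => ?_
    exact seminorm_le_norm_seminormEmbedding s φ ⟨p, Finset.mem_insert_of_mem hp⟩
  let e := LinearEquiv.ofInjective (seminormEmbedding (E := E) s) hinj
  let f : StrongDual ℂ (LinearMap.range (seminormEmbedding (E := E) s)) :=
    LinearMap.mkContinuous (u.toLinearMap ∘ₗ e.symm.toLinearMap) C (fun x => by
      have h1 := hbound (e.symm x)
      have h2 : seminormEmbedding s (e.symm x) = x := by
        have := congrArg Subtype.val (e.apply_symm_apply x)
        exact this
      rw [h2] at h1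
      exact h1)
  obtain ⟨g, hg, -⟩ := exists_extension_norm_eq _ f
  refine ⟨s, g, fun φ => ?_⟩
  have h1 := hg (e φ)
  have h2 : f (e φ) = u φ := by
    change u (e.symm (e φ)) = u φ
    rw [e.symm_apply_apply]
  rw [← h2, ← h1]
  rfl

theorem exists_one_add_pow_mul_iteratedFDeriv_le (Ψ : 𝓢(E, ℂ)) (k l : ℕ) :
    ∃ C : ℝ, 0 ≤ C ∧ ∀ x, (1 + ‖x‖) ^ k * ‖iteratedFDeriv ℝ l Ψ x‖ ≤ C :=
  ⟨_, by positivity, fun x => SchwartzMap.one_add_le_sup_seminorm_apply (𝕜 := ℂ) (m := (k, l))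
    le_rfl le_rfl Ψ x⟩

theorem iteratedFDeriv_compSubConst (Ψ : 𝓢(E, ℂ)) (a y : E) (l : ℕ) :
    iteratedFDeriv ℝ l (SchwartzMap.compSubConstCLM ℂ a Ψ) y = iteratedFDeriv ℝ l Ψ (y - a) :=
  iteratedFDeriv_comp_sub l a y

theorem pow_norm_mul_iteratedFDeriv_translate_le {Ψ : 𝓢(E, ℂ)} {k l : ℕ} {C : ℝ}
    (hC : ∀ x, (1 + ‖x‖) ^ k * ‖iteratedFDeriv ℝ l Ψ x‖ ≤ C) (a y : E) :
    ‖y‖ ^ k * ‖iteratedFDeriv ℝ l Ψ (y - a)‖ ≤ (1 + ‖a‖) ^ k * C := by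
  have h1 : ‖y‖ ≤ (1 + ‖a‖) * (1 + ‖y - a‖) := by
    have : ‖y‖ ≤ ‖a‖ + ‖y - a‖ := by
      calc ‖y‖ = ‖a + (y - a)‖ := by congr 1; abel
        _ ≤ _ := norm_add_le _ _
    nlinarith [mul_nonneg (norm_nonneg a) (norm_nonneg (y - a))]
  calc ‖y‖ ^ k * ‖iteratedFDeriv ℝ l Ψ (y - a)‖
      ≤ ((1 + ‖a‖) * (1 + ‖y - a‖)) ^ k * ‖iteratedFDeriv ℝ l Ψ (y - a)‖ := by gcongr
    _ = (1 + ‖a‖) ^ k * ((1 + ‖y - a‖) ^ k * ‖iteratedFDeriv ℝ l Ψ (y - a)‖) := by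
        rw [mul_pow]; ring
    _ ≤ _ := by gcongr; exact hC _

/-- Since ‖y‖ ≤ (1 + ‖a‖)(1 + ‖y - a‖), a translation by a costs a power of 1 + ‖a‖ in each
seminorm. Integration against a Schwartz function of a therefore converges. -/
theorem exists_norm_seminormEmbedding_translate_le (s : Finset (ℕ × ℕ)) (Ψ : 𝓢(E, ℂ)) :
    ∃ (C : ℝ) (K : ℕ), 0 ≤ C ∧
      ∀ a, ‖seminormEmbedding s (SchwartzMap.compSubConstCLM ℂ a Ψ)‖ ≤ C * (1 + ‖a‖) ^ K := by
  choose C hC0 hC using fun p : ℕ × ℕ => exists_one_add_pow_mul_iteratedFDeriv_le Ψ p.1 p.2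
  refine ⟨∑ p ∈ s, C p, s.sup Prod.fst, Finset.sum_nonneg fun p _ => hC0 p, fun a => ?_⟩
  refine norm_seminormEmbedding_le s _ (mul_nonneg (Finset.sum_nonneg fun p _ => hC0 p)
    (by positivity)) fun p hp y => ?_
  rw [iteratedFDeriv_compSubConst]
  refine (pow_norm_mul_iteratedFDeriv_translate_le (hC p) a y).trans ?_
  rw [mul_comm]
  gcongr
  · exact Finset.sum_nonneg fun p _ => hC0 p
  · exact Finset.single_le_sum (f := C) (fun p _ => hC0 p) hp
  · linarith [norm_nonneg a]
  · exact Finset.le_sup (f := Prod.fst) hp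

/-- The mean value inequality bounds the difference of two nearby translates by their distance, at
the price of one more derivative. -/
theorem continuous_seminormEmbedding_translate (s : Finset (ℕ × ℕ)) (Ψ : 𝓢(E, ℂ)) :
    Continuous fun a => seminormEmbedding s (SchwartzMap.compSubConstCLM ℂ a Ψ) := by
  choose C hC0 hC using fun p : ℕ × ℕ => exists_one_add_pow_mul_iteratedFDeriv_le Ψ p.1 (p.2 + 1)
  rw [continuous_iff_continuousAt]
  intro a
  have hloc : ∀ b ∈ Metric.ball a 1,
      ‖seminormEmbedding s (SchwartzMap.compSubConstCLM ℂ b Ψ)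
        - seminormEmbedding s (SchwartzMap.compSubConstCLM ℂ a Ψ)‖
      ≤ (∑ p ∈ s, (1 + (‖a‖ + 1)) ^ p.1 * C p) * ‖b - a‖ := by
    intro b hb
    rw [← map_sub]
    refine norm_seminormEmbedding_le s _ (mul_nonneg (Finset.sum_nonneg fun p _ =>
      mul_nonneg (by positivity) (hC0 p)) (norm_nonneg _)) fun p hp y => ?_
    have hsub : iteratedFDeriv ℝ p.2
        (SchwartzMap.compSubConstCLM ℂ b Ψ - SchwartzMap.compSubConstCLM ℂ a Ψ : 𝓢(E, ℂ)) y
        = iteratedFDeriv ℝ p.2 Ψ (y - b) - iteratedFDeriv ℝ p.2 Ψ (y - a) := by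
      rw [← iteratedFDeriv_compSubConst, ← iteratedFDeriv_compSubConst]
      exact iteratedFDeriv_sub_apply ((SchwartzMap.smooth _ _).contDiffAt)
        ((SchwartzMap.smooth _ _).contDiffAt)
    rw [hsub]
    by_cases hy0 : ‖y‖ ^ p.1 = 0
    · rw [hy0, zero_mul]
      exact mul_nonneg (Finset.sum_nonneg fun p _ => mul_nonneg (by positivity) (hC0 p))
        (norm_nonneg _)
    have hypos : 0 < ‖y‖ ^ p.1 := lt_of_le_of_ne (by positivity) (Ne.symm hy0)
    have hmv : ‖iteratedFDeriv ℝ p.2 Ψ (y - b) - iteratedFDeriv ℝ p.2 Ψ (y - a)‖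
        ≤ ((1 + (‖a‖ + 1)) ^ p.1 * C p / ‖y‖ ^ p.1) * ‖(y - b) - (y - a)‖ := by
      refine (convex_ball (y - a) 1).norm_image_sub_le_of_norm_fderiv_le (𝕜 := ℝ)
        (fun z _ => ((Ψ.smooth ⊤).differentiable_iteratedFDeriv
          (mod_cast ENat.natCast_lt_top p.2)) z) (fun z hz => ?_)
        (Metric.mem_ball_self one_pos) ?_
      · rw [norm_fderiv_iteratedFDeriv, le_div_iff₀ hypos, mul_comm]
        have h1 := pow_norm_mul_iteratedFDeriv_translate_le (hC p) (y - z) y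
        rw [sub_sub_cancel] at h1
        refine h1.trans ?_
        have h2 : ‖y - z‖ ≤ ‖a‖ + 1 := by
          rw [mem_ball_iff_norm] at hz
          calc ‖y - z‖ = ‖a - (z - (y - a))‖ := by congr 1; abel
            _ ≤ ‖a‖ + ‖z - (y - a)‖ := norm_sub_le _ _
            _ ≤ _ := by linarith
        have := hC0 p
        gcongr
      · rw [mem_ball_iff_norm] at hb ⊢
        rw [sub_sub_sub_cancel_left, norm_sub_rev]; exact hb
    rw [sub_sub_sub_cancel_left, norm_sub_rev a b, div_mul_eq_mul_div, le_div_iff₀ hypos,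
      mul_comm] at hmv
    refine hmv.trans (mul_le_mul_of_nonneg_right ?_ (norm_nonneg _))
    exact Finset.single_le_sum (f := fun p : ℕ × ℕ => (1 + (‖a‖ + 1)) ^ p.1 * C p)
      (fun p _ => mul_nonneg (by positivity) (hC0 p)) hp
  rw [ContinuousAt, tendsto_iff_norm_sub_tendsto_zero]
  refine squeeze_zero_norm' (a := fun b => (∑ p ∈ s, (1 + (‖a‖ + 1)) ^ p.1 * C p) * ‖b - a‖) ?_ ?_
  · filter_upwards [Metric.ball_mem_nhds a one_pos] with b hb
    rw [norm_norm]; exact hloc b hb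
  · have : Continuous fun b : E => (∑ p ∈ s, (1 + (‖a‖ + 1)) ^ p.1 * C p) * ‖b - a‖ := by fun_prop
    simpa using this.tendsto a

theorem continuous_apply_translate (u : 𝓢'(E, ℂ)) (Ψ : 𝓢(E, ℂ)) :
    Continuous fun a => u (SchwartzMap.compSubConstCLM ℂ a Ψ) := by
  obtain ⟨s, g, hg⟩ := exists_dual_seminormEmbedding u
  simp_rw [hg]
  exact g.continuous.comp (continuous_seminormEmbedding_translate s Ψ)

theorem exists_norm_apply_translate_le (u : 𝓢'(E, ℂ)) (Ψ : 𝓢(E, ℂ)) :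
    ∃ (C : ℝ) (K : ℕ), 0 ≤ C ∧
      ∀ a, ‖u (SchwartzMap.compSubConstCLM ℂ a Ψ)‖ ≤ C * (1 + ‖a‖) ^ K := by
  obtain ⟨s, g, hg⟩ := exists_dual_seminormEmbedding u
  obtain ⟨C, K, hC0, hC⟩ := exists_norm_seminormEmbedding_translate_le s Ψ
  refine ⟨‖g‖ * C, K, by positivity, fun a => ?_⟩
  rw [hg, mul_assoc]
  exact (g.le_opNorm _).trans (mul_le_mul_of_nonneg_left (hC a) (norm_nonneg _))

variable [FiniteDimensional ℝ E] [MeasurableSpace E] [BorelSpace E]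

/-- The convolution of two scalar Schwartz functions. -/
noncomputable abbrev sconv (G Ψ : 𝓢(E, ℂ)) : 𝓢(E, ℂ) :=
  SchwartzMap.convolution (ContinuousLinearMap.mul ℂ ℂ) G Ψ

theorem sconv_apply (G Ψ : 𝓢(E, ℂ)) (x : E) : sconv G Ψ x = ∫ t, G t * Ψ (x - t) := by
  rw [sconv, SchwartzMap.convolution_apply]
  rfl

theorem fourier_sconv_apply (G Ψ : 𝓢(E, ℂ)) (x : E) : 𝓕 (sconv G Ψ) x = 𝓕 G x * 𝓕 Ψ x := by
  rw [sconv, SchwartzMap.fourier_convolution]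
  rfl

theorem ext_fourier {f g : 𝓢(E, ℂ)} (h : ∀ x, 𝓕 f x = 𝓕 g x) : f = g := by
  have h1 : 𝓕 f = 𝓕 g := SchwartzMap.ext h
  have h2 := congrArg (fun φ : 𝓢(E, ℂ) => 𝓕⁻ φ) h1
  simpa using h2

/-- On the Fourier side both sides carry the same linear factor. -/
theorem lineDerivOp_sconv (G Ψ : 𝓢(E, ℂ)) (m : E) : ∂_{m} (sconv G Ψ) = sconv G (∂_{m} Ψ) := by
  refine ext_fourier fun x => ?_
  have hm : (inner ℝ · m : E → ℝ).HasTemperateGrowth := ((innerSL ℝ).flip m).hasTemperateGrowth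
  rw [fourier_sconv_apply, SchwartzMap.fourier_lineDerivOp_eq, SchwartzMap.fourier_lineDerivOp_eq]
  simp only [smul_apply, SchwartzMap.smulLeftCLM_apply_apply hm]
  rw [fourier_sconv_apply]
  simp only [smul_eq_mul, Complex.real_smul]
  ring

theorem iteratedLineDerivOp_sconv (G Ψ : 𝓢(E, ℂ)) {l : ℕ} (m : Fin l → E) :
    ∂^{m} (sconv G Ψ) = sconv G (∂^{m} Ψ) := by
  induction l with
  | zero => simp
  | succ l ih =>
    rw [iteratedLineDerivOp_succ_left, iteratedLineDerivOp_succ_left, ih, lineDerivOp_sconv]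

theorem integrable_one_add_norm_pow_mul (G : 𝓢(E, ℂ)) (K : ℕ) :
    Integrable fun a : E => (1 + ‖a‖) ^ K * ‖G a‖ := by
  have h1 : ∀ i ∈ Finset.range (K + 1),
      Integrable fun a : E => (‖a‖ ^ i * ‖G a‖) * (K.choose i : ℝ) := fun i _ =>
    (G.integrable_pow_mul volume i).mul_const _
  refine (integrable_finsetSum _ h1).congr (Filter.Eventually.of_forall fun a => ?_)
  simp only
  rw [add_comm 1 ‖a‖, add_pow, Finset.sum_mul]
  refine Finset.sum_congr rfl fun i _ => ?_
  rw [one_pow]; ring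

/-- Convolution commutes with a tempered distribution. -/
theorem apply_sconv (u : 𝓢'(E, ℂ)) (G Ψ : 𝓢(E, ℂ)) :
    u (sconv G Ψ) = ∫ a, G a * u (SchwartzMap.compSubConstCLM ℂ a Ψ) := by
  obtain ⟨s, g, hg⟩ := exists_dual_seminormEmbedding u
  obtain ⟨C, K, hC0, hC⟩ := exists_norm_seminormEmbedding_translate_le s Ψ
  -- The exchange takes place in a Banach space: γ is Bochner integrable, and the continuous
  -- functional g passes through its integral. That the integral is the embedded convolution is
  -- checked on evaluations of derivatives.
  set γ : E → JetSpace E s :=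
    fun a => G a • seminormEmbedding s (SchwartzMap.compSubConstCLM ℂ a Ψ) with hγ
  have hγc : Continuous γ := G.continuous.smul (continuous_seminormEmbedding_translate s Ψ)
  have hdom : Integrable fun a : E => C * ((1 + ‖a‖) ^ K * ‖G a‖) :=
    (integrable_one_add_norm_pow_mul G K).const_mul C
  have hγi : Integrable γ := by
    refine hdom.mono' hγc.aestronglyMeasurable (Filter.Eventually.of_forall fun a => ?_)
    rw [hγ]
    simp only
    rw [norm_smul]
    calc ‖G a‖ * ‖seminormEmbedding s (SchwartzMap.compSubConstCLM ℂ a Ψ)‖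
        ≤ ‖G a‖ * (C * (1 + ‖a‖) ^ K) := by gcongr; exact hC a
      _ = _ := by ring
  have hkey : seminormEmbedding s (sconv G Ψ) = ∫ a, γ a := by
    funext p
    ext y m
    change jetEval s p y m (seminormEmbedding s (sconv G Ψ)) = jetEval s p y m (∫ a, γ a)
    rw [← (jetEval s p y m).integral_comp_comm hγi, jetEval_seminormEmbedding,
      ← SchwartzMap.iteratedLineDerivOp_eq_iteratedFDeriv, iteratedLineDerivOp_sconv, sconv_apply,
      ← integral_const_mul]
    refine integral_congr_ae (Filter.Eventually.of_forall fun a => ?_)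
    simp only [hγ, map_smul, jetEval_seminormEmbedding, smul_eq_mul]
    rw [SchwartzMap.iteratedLineDerivOp_eq_iteratedFDeriv, iteratedFDeriv_compSubConst]
    ring
  rw [hg, hkey, ← g.integral_comp_comm hγi]
  refine integral_congr_ae (Filter.Eventually.of_forall fun a => ?_)
  simp only [hγ, map_smul, smul_eq_mul]
  rw [hg]

end Exchange


/-! ### Kernels that are dual to the local means -/

theorem contDiff_fourier_of_hasCompactSupport {f : ℝ → ℂ} (hf : ContDiff ℝ ∞ f)
    (hs : HasCompactSupport f) : ContDiff ℝ ∞ (𝓕 f) := by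
  have h : 𝓕 f = ⇑(𝓕 (hs.toSchwartzMap hf) : 𝓢(ℝ, ℂ)) := by
    rw [SchwartzMap.fourier_coe]
    rfl
  rw [h]
  exact (𝓕 (hs.toSchwartzMap hf) : 𝓢(ℝ, ℂ)).smooth ⊤

theorem contDiff_div_of_ne_zero {f g : ℝ → ℂ} (hf : ContDiff ℝ ∞ f) (hg : ContDiff ℝ ∞ g)
    {K : Set ℝ} (hK : IsClosed K) (h0 : ∀ x, x ∉ K → f x = 0) (hne : ∀ x ∈ K, g x ≠ 0) :
    ContDiff ℝ ∞ fun x => f x / g x := by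
  rw [contDiff_iff_contDiffAt]
  intro x
  by_cases hx : x ∈ K
  · simp_rw [div_eq_mul_inv]
    exact hf.contDiffAt.mul (hg.contDiffAt.inv (hne x hx))
  · refine (contDiffAt_const (c := (0 : ℂ))).congr_of_eventuallyEq ?_
    filter_upwards [hK.isOpen_compl.mem_nhds hx] with y hy
    rw [h0 y hy, zero_div]

/-- Fourier multipliers that invert the local means: `μ₀ 𝓕 ψ₀ = χ` and
`μ₁ 𝓕 ψ₁ = χ(·/2) - χ`, where `χ` is smooth, compactly supported and `1` at the origin. -/
structure DualMeans {L : ℕ} (Ψ : LocalMeans L) where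
  χ : ℝ → ℂ
  μ₀ : ℝ → ℂ
  μ₁ : ℝ → ℂ
  contDiff_χ : ContDiff ℝ ∞ χ
  contDiff_μ₀ : ContDiff ℝ ∞ μ₀
  contDiff_μ₁ : ContDiff ℝ ∞ μ₁
  hasCompactSupport_χ : HasCompactSupport χ
  hasCompactSupport_μ₀ : HasCompactSupport μ₀
  hasCompactSupport_μ₁ : HasCompactSupport μ₁
  χ_zero : χ 0 = 1
  μ₀_mul : ∀ ξ, μ₀ ξ * 𝓕 Ψ.ψ₀ ξ = χ ξ
  μ₁_mul : ∀ ξ, μ₁ ξ * 𝓕 Ψ.ψ₁ ξ = χ (ξ / 2) - χ ξ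

/-- Division by 𝓕 ψ₀ and 𝓕 ψ₁ is harmless when the numerators vanish outside closed sets on which
the Tauberian conditions exclude zeros. -/
theorem nonempty_dualMeans {L : ℕ} (Ψ : LocalMeans L) : Nonempty (DualMeans Ψ) := by
  obtain ⟨ε, hε, h0, h1⟩ := Ψ.tauberian
  -- With these radii χ lives in |ξ| < ε, and χ(·/2) - χ lives in 5ε/8 ≤ |ξ| ≤ 7ε/4, strictly inside
  -- the annulus ε/2 < |ξ| < 2ε.
  let b : ContDiffBump (0 : ℝ) := ⟨5 / 8 * ε, 7 / 8 * ε, by positivity, by linarith⟩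
  let χ : ℝ → ℂ := fun ξ => (b ξ : ℂ)
  have hχ : ContDiff ℝ ∞ χ := Complex.ofRealCLM.contDiff.comp b.contDiff
  have hχ0 : ∀ ξ, ξ ∉ Metric.closedBall (0 : ℝ) (7 / 8 * ε) → χ ξ = 0 := fun ξ hξ => by
    have : b ξ = 0 := b.zero_of_le_dist (by
      rw [Metric.mem_closedBall, not_le] at hξ
      exact hξ.le)
    simp [χ, this]
  have hχ1 : ∀ ξ, |ξ| ≤ 5 / 8 * ε → χ ξ = 1 := fun ξ hξ => by
    have : b ξ = 1 := b.one_of_mem_closedBall (by simpa using hξ)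
    simp [χ, this]
  have hχs : HasCompactSupport χ :=
    HasCompactSupport.intro (isCompact_closedBall (0 : ℝ) (7 / 8 * ε)) hχ0
  let D : ℝ → ℂ := fun ξ => χ (ξ / 2) - χ ξ
  have hD : ContDiff ℝ ∞ D := (hχ.comp (contDiff_id.div_const 2)).sub hχ
  have hD0 : ∀ ξ, ξ ∉ {ξ : ℝ | 5 / 8 * ε ≤ |ξ| ∧ |ξ| ≤ 7 / 4 * ε} → D ξ = 0 := fun ξ hξ => by
    rw [Set.mem_ofPred_eq, not_and_or, not_le, not_le] at hξ
    rcases hξ with hξ | hξ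
    · have h2 : |ξ / 2| ≤ 5 / 8 * ε := by
        rw [abs_div, abs_two]
        linarith [abs_nonneg ξ]
      simp only [D]
      rw [hχ1 _ h2, hχ1 _ hξ.le, sub_self]
    · have h2 : χ (ξ / 2) = 0 := hχ0 _ (by
        rw [mem_closedBall_zero_iff, Real.norm_eq_abs, abs_div, abs_two]
        linarith)
      have h3 : χ ξ = 0 := hχ0 _ (by
        rw [mem_closedBall_zero_iff, Real.norm_eq_abs]
        linarith)
      simp only [D]
      rw [h2, h3, sub_self]
  have hKc : IsClosed {ξ : ℝ | 5 / 8 * ε ≤ |ξ| ∧ |ξ| ≤ 7 / 4 * ε} :=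
    (isClosed_le continuous_const continuous_abs).inter
      (isClosed_le continuous_abs continuous_const)
  have hDs : HasCompactSupport D :=
    HasCompactSupport.intro (isCompact_closedBall (0 : ℝ) (7 / 4 * ε)) fun ξ hξ => hD0 ξ fun h =>
      hξ (by simpa using h.2)
  have hn0 : ∀ ξ ∈ Metric.closedBall (0 : ℝ) (7 / 8 * ε), 𝓕 Ψ.ψ₀ ξ ≠ 0 := fun ξ hξ => by
    rw [mem_closedBall_zero_iff, Real.norm_eq_abs] at hξ
    exact h0 ξ (by linarith)
  have hn1 : ∀ ξ ∈ {ξ : ℝ | 5 / 8 * ε ≤ |ξ| ∧ |ξ| ≤ 7 / 4 * ε}, 𝓕 Ψ.ψ₁ ξ ≠ 0 := fun ξ hξ =>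
    h1 ξ (by linarith [hξ.1]) (by linarith [hξ.2])
  refine ⟨⟨χ, fun ξ => χ ξ / 𝓕 Ψ.ψ₀ ξ, fun ξ => D ξ / 𝓕 Ψ.ψ₁ ξ, hχ,
    contDiff_div_of_ne_zero hχ (contDiff_fourier_of_hasCompactSupport Ψ.contDiff_ψ₀
      Ψ.hasCompactSupport_ψ₀) Metric.isClosed_closedBall hχ0 hn0,
    contDiff_div_of_ne_zero hD (contDiff_fourier_of_hasCompactSupport Ψ.contDiff_ψ₁
      Ψ.hasCompactSupport_ψ₁) hKc hD0 hn1, hχs, ?_, ?_, hχ1 0 (by simp; positivity), ?_, ?_⟩⟩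
  · exact hχs.mono fun ξ hξ h => hξ (by simp [h])
  · exact hDs.mono fun ξ hξ h => hξ (by simp [h])
  · intro ξ
    by_cases hξ : ξ ∈ Metric.closedBall (0 : ℝ) (7 / 8 * ε)
    · exact div_mul_cancel₀ _ (hn0 ξ hξ)
    · rw [hχ0 ξ hξ, zero_div, zero_mul]
  · intro ξ
    by_cases hξ : ξ ∈ {ξ : ℝ | 5 / 8 * ε ≤ |ξ| ∧ |ξ| ≤ 7 / 4 * ε}
    · exact div_mul_cancel₀ _ (hn1 ξ hξ)
    · change D ξ / _ * _ = D ξ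
      rw [hD0 ξ hξ, zero_div, zero_mul]

/-! ### Fourier transforms of tensor products -/

theorem integral_euclideanSpace {d : ℕ} (f : EuclideanSpace ℝ (Fin d) → ℂ) :
    ∫ x, f x = ∫ y : Fin d → ℝ, f (WithLp.toLp 2 y) :=
  ((PiLp.volume_preserving_toLp (Fin d)).integral_comp
    (MeasurableEquiv.toLp 2 (Fin d → ℝ)).measurableEmbedding f).symm

theorem lintegral_euclideanSpace {d : ℕ} (f : EuclideanSpace ℝ (Fin d) → ℝ≥0∞) :
    ∫⁻ x, f x = ∫⁻ y : Fin d → ℝ, f (WithLp.toLp 2 y) :=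
  ((PiLp.volume_preserving_toLp (Fin d)).lintegral_comp_emb
    (MeasurableEquiv.toLp 2 (Fin d → ℝ)).measurableEmbedding f).symm

theorem integral_tensor {d : ℕ} (f : Fin d → ℝ → ℂ) :
    ∫ x : EuclideanSpace ℝ (Fin d), ∏ i, f i (x i) = ∏ i, ∫ t, f i t := by
  rw [integral_euclideanSpace]
  exact integral_fintype_prod_volume_eq_prod f

theorem fourier_tensor {d : ℕ} (f : Fin d → ℝ → ℂ) (ξ : EuclideanSpace ℝ (Fin d)) :
    𝓕 (fun x : EuclideanSpace ℝ (Fin d) => ∏ i, f i (x i)) ξ = ∏ i, 𝓕 (f i) (ξ i) := by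
  simp_rw [Real.fourier_real_eq_integral_exp_smul]
  rw [← integral_tensor, Real.fourier_eq']
  congr 1
  ext x
  simp only [smul_eq_mul]
  rw [Finset.prod_mul_distrib, ← Complex.exp_sum]
  congr 2
  rw [← Finset.sum_mul]
  congr 1
  rw [PiLp.inner_apply]
  push_cast
  rw [Finset.mul_sum]
  refine Finset.sum_congr rfl fun i _ => ?_
  simp
  ring

theorem fourier_comp_mul (f : ℝ → ℂ) {a : ℝ} (ha : 0 < a) (t : ℝ) :
    𝓕 (fun ξ => f (a⁻¹ * ξ)) t = (a : ℂ) * 𝓕 f (a * t) := by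
  rw [Real.fourier_real_eq_integral_exp_smul, Real.fourier_real_eq_integral_exp_smul]
  have h := Measure.integral_comp_mul_left
    (fun v : ℝ => Complex.exp (↑(-2 * Real.pi * v * (a * t)) * Complex.I) • f v) a⁻¹
  rw [inv_inv, abs_of_pos ha, Complex.real_smul] at h
  rw [← h]
  congr 1
  ext v
  congr 3
  push_cast
  have : (a : ℂ) ≠ 0 := by exact_mod_cast ha.ne'
  field_simp

theorem fourier_fourier_apply {d : ℕ} (f : 𝓢(EuclideanSpace ℝ (Fin d), ℂ))
    (ξ : EuclideanSpace ℝ (Fin d)) : 𝓕 (𝓕 f) ξ = f (-ξ) := by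
  have h : 𝓕⁻ (𝓕 f) (-ξ) = f (-ξ) := by rw [FourierTransform.fourierInv_fourier_eq]
  rw [← h, SchwartzMap.fourierInv_coe, Real.fourierInv_eq_fourier_neg, neg_neg,
    SchwartzMap.fourier_coe]

/-- The tensor product of compactly supported smooth functions, as a Schwartz function. -/
noncomputable def tensorSchwartz {d : ℕ} (f : Fin d → ℝ → ℂ) (hf : ∀ i, ContDiff ℝ ∞ (f i))
    (hs : ∀ i, HasCompactSupport (f i)) : 𝓢(EuclideanSpace ℝ (Fin d), ℂ) :=
  HasCompactSupport.toSchwartzMap (f := fun x => ∏ i, f i (x i))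
    (by
      have hK : IsCompact (Set.univ.pi fun i => tsupport (f i)) := isCompact_univ_pi hs
      refine HasCompactSupport.intro (hK.image (PiLp.continuous_toLp 2 (fun _ : Fin d => ℝ)))
        fun x hx => ?_
      by_contra h
      exact hx ⟨WithLp.ofLp x, fun i _ =>
        subset_tsupport _ (fun h0 => h (Finset.prod_eq_zero (Finset.mem_univ i) h0)), rfl⟩)
    (contDiff_prod fun i _ => (hf i).comp (by fun_prop))

theorem fourier_tensorSchwartz_apply {d : ℕ} (f : Fin d → ℝ → ℂ) (hf : ∀ i, ContDiff ℝ ∞ (f i))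
    (hs : ∀ i, HasCompactSupport (f i)) (ξ : EuclideanSpace ℝ (Fin d)) :
    𝓕 (tensorSchwartz f hf hs) ξ = ∏ i, 𝓕 (f i) (ξ i) := by
  rw [← fourier_tensor, SchwartzMap.fourier_coe]
  rfl


/-! ### Local means of a distribution as functions -/

theorem LocalMeans.shifted_apply {L d : ℕ} (Ψ : LocalMeans L) (m : Fin d → ℕ)
    (x y : EuclideanSpace ℝ (Fin d)) : Ψ.shifted m x y = Ψ.tensor m (x - y) := rfl

theorem LocalMeans.shifted_eq_compSubConst {L d : ℕ} (Ψ : LocalMeans L) (m : Fin d → ℕ)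
    (x : EuclideanSpace ℝ (Fin d)) :
    Ψ.shifted m x = SchwartzMap.compSubConstCLM ℂ x (Ψ.shifted m 0) := by
  ext y
  rw [SchwartzMap.compSubConstCLM_apply, Ψ.shifted_apply, Ψ.shifted_apply]
  congr 1
  abel

theorem LocalMeans.continuous_conv {L d : ℕ} (Ψ : LocalMeans L) (m : Fin d → ℕ)
    (u : 𝓢'(EuclideanSpace ℝ (Fin d), ℂ)) : Continuous (Ψ.conv m u) := by
  unfold LocalMeans.conv
  have h : (fun x => u (Ψ.shifted m x))
      = fun x => u (SchwartzMap.compSubConstCLM ℂ x (Ψ.shifted m 0)) :=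
    funext fun x => by rw [← Ψ.shifted_eq_compSubConst m]
  rw [h]
  exact continuous_apply_translate u _

theorem fourier_comp_neg_real (f : ℝ → ℂ) (t : ℝ) : 𝓕 (fun y => f (-y)) t = 𝓕 f (-t) := by
  rw [Real.fourier_real_eq_integral_exp_smul, Real.fourier_real_eq_integral_exp_smul,
    ← integral_neg_eq_self]
  congr 1
  ext v
  simp

theorem LocalMeans.fourier_dilated_succ {L : ℕ} (Ψ : LocalMeans L) (j : ℕ) (ξ : ℝ) :
    𝓕 (Ψ.dilated (j + 1)) ξ = 𝓕 Ψ.ψ₁ (((2 : ℝ) ^ j)⁻¹ * ξ) := by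
  have h1 : Ψ.dilated (j + 1)
      = (2 : ℂ) ^ j • fun t => Ψ.ψ₁ ((((2 : ℝ) ^ j)⁻¹)⁻¹ * t) := by
    ext t
    simp [LocalMeans.dilated]
  have h2 := fourier_comp_mul Ψ.ψ₁ (a := ((2 : ℝ) ^ j)⁻¹) (by positivity) ξ
  rw [h1]
  have h3 : 𝓕 ((2 : ℂ) ^ j • fun t => Ψ.ψ₁ ((((2 : ℝ) ^ j)⁻¹)⁻¹ * t)) ξ
      = (2 : ℂ) ^ j * 𝓕 (fun t => Ψ.ψ₁ ((((2 : ℝ) ^ j)⁻¹)⁻¹ * t)) ξ :=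
    congrFun (VectorFourier.fourierIntegral_const_smul _ _ _ _ _) ξ
  rw [h3, h2, ← mul_assoc]
  push_cast
  rw [mul_inv_cancel₀ (pow_ne_zero _ two_ne_zero), one_mul]

/-- The sign appears because the test function at x = 0 is the reflected kernel y ↦ Ψ_m(-y). -/
theorem LocalMeans.fourier_shifted_zero {L d : ℕ} (Ψ : LocalMeans L) (m : Fin d → ℕ)
    (ξ : EuclideanSpace ℝ (Fin d)) :
    𝓕 (Ψ.shifted m 0) ξ = ∏ i, 𝓕 (Ψ.dilated (m i)) (-ξ i) := by
  simp_rw [← fourier_comp_neg_real]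
  rw [← fourier_tensor, SchwartzMap.fourier_coe]
  have h : ⇑(Ψ.shifted m 0) = fun x => ∏ i, Ψ.dilated (m i) (-x i) := by
    ext x
    rw [Ψ.shifted_apply, LocalMeans.tensor]
    simp
  rw [h]

/-! ### The reproducing formula -/

namespace DualMeans

variable {L : ℕ} {Ψ : LocalMeans L} (D : DualMeans Ψ)

/-- The dilated multipliers. -/
noncomputable def mult : ℕ → ℝ → ℂ
  | 0 => D.μ₀
  | j + 1 => fun ξ => D.μ₁ (((2 : ℝ) ^ j)⁻¹ * ξ)

theorem contDiff_mult (j : ℕ) : ContDiff ℝ ∞ (D.mult j) := by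
  cases j with
  | zero => exact D.contDiff_μ₀
  | succ j => exact D.contDiff_μ₁.comp (contDiff_const.mul contDiff_id)

theorem hasCompactSupport_comp_inv_mul {f : ℝ → ℂ} (hf : HasCompactSupport f) (j : ℕ) :
    HasCompactSupport fun ξ => f (((2 : ℝ) ^ j)⁻¹ * ξ) :=
  hf.comp_homeomorph (Homeomorph.mulLeft₀ (((2 : ℝ) ^ j)⁻¹) (by positivity))

theorem hasCompactSupport_mult (j : ℕ) : HasCompactSupport (D.mult j) := by
  cases j with
  | zero => exact D.hasCompactSupport_μ₀
  | succ j => exact hasCompactSupport_comp_inv_mul D.hasCompactSupport_μ₁ j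

theorem exists_mult_eq_zero : ∃ R : ℝ, 0 < R ∧ ∀ j ξ, R * 2 ^ j < |ξ| → D.mult j ξ = 0 := by
  obtain ⟨R₀, h₀⟩ := D.hasCompactSupport_μ₀.isCompact.isBounded.subset_closedBall 0
  obtain ⟨R₁, h₁⟩ := D.hasCompactSupport_μ₁.isCompact.isBounded.subset_closedBall 0
  refine ⟨max 1 (max R₀ R₁), by positivity, fun j ξ hξ => ?_⟩
  by_contra hne
  cases j with
  | zero =>
    have := h₀ (subset_tsupport _ hne)
    rw [mem_closedBall_zero_iff, Real.norm_eq_abs] at this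
    have h2 := (le_max_left R₀ R₁).trans (le_max_right 1 _)
    rw [pow_zero, mul_one] at hξ
    linarith
  | succ j =>
    have := h₁ (subset_tsupport _ hne)
    rw [mem_closedBall_zero_iff, Real.norm_eq_abs, abs_mul, abs_of_pos (by positivity),
      inv_mul_le_iff₀ (by positivity)] at this
    have h2 := (le_max_right R₀ R₁).trans (le_max_right 1 _)
    have h3 : (2 : ℝ) ^ j ≤ 2 ^ (j + 1) := pow_le_pow_right₀ one_le_two (Nat.le_succ j)
    have h4 : (2 : ℝ) ^ j * R₁ ≤ max 1 (max R₀ R₁) * 2 ^ (j + 1) := by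
      rw [mul_comm]
      exact mul_le_mul h2 h3 (by positivity) (by positivity)
    linarith

/-- The sum telescopes: level j + 1 contributes χ(2^{-j-1}ξ) - χ(2^{-j}ξ). -/
theorem mult_mul_fourier_dilated_sum (N : ℕ) (ξ : ℝ) :
    ∑ j ∈ Finset.range (N + 1), D.mult j ξ * 𝓕 (Ψ.dilated j) ξ = D.χ (((2 : ℝ) ^ N)⁻¹ * ξ) := by
  induction N with
  | zero =>
    rw [zero_add, Finset.sum_range_one, pow_zero, inv_one, one_mul]
    exact D.μ₀_mul ξ
  | succ N ih =>
    rw [Finset.sum_range_succ, ih, Ψ.fourier_dilated_succ, mult, D.μ₁_mul]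
    rw [add_sub_cancel, pow_succ, mul_inv]
    congr 1
    ring

/-- The kernels whose convolution with the local means of a distribution recovers it. -/
noncomputable def kernel {d : ℕ} (m : Fin d → ℕ) : 𝓢(EuclideanSpace ℝ (Fin d), ℂ) :=
  𝓕 (tensorSchwartz (fun i => D.mult (m i)) (fun _ => D.contDiff_mult _)
    fun _ => D.hasCompactSupport_mult _)

theorem kernel_apply {d : ℕ} (m : Fin d → ℕ) (x : EuclideanSpace ℝ (Fin d)) :
    D.kernel m x = ∏ i, 𝓕 (D.mult (m i)) (x i) :=
  fourier_tensorSchwartz_apply _ _ _ _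

/-- The kernel is the Fourier transform of the multiplier, not the inverse one, so a second
transform reflects. This matches the reflection in `LocalMeans.fourier_shifted_zero`. -/
theorem fourier_kernel_apply {d : ℕ} (m : Fin d → ℕ) (ξ : EuclideanSpace ℝ (Fin d)) :
    𝓕 (D.kernel m) ξ = ∏ i, D.mult (m i) (-ξ i) := by
  rw [kernel, fourier_fourier_apply]
  rfl

/-- The low-pass kernels. -/
noncomputable def lowPass (d N : ℕ) : 𝓢(EuclideanSpace ℝ (Fin d), ℂ) :=
  𝓕 (tensorSchwartz (fun _ ξ => D.χ (((2 : ℝ) ^ N)⁻¹ * ξ))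
    (fun _ => D.contDiff_χ.comp (contDiff_const.mul contDiff_id))
    fun _ => hasCompactSupport_comp_inv_mul D.hasCompactSupport_χ N)

theorem fourier_lowPass_apply (d N : ℕ) (ξ : EuclideanSpace ℝ (Fin d)) :
    𝓕 (D.lowPass d N) ξ = ∏ i, D.χ (((2 : ℝ) ^ N)⁻¹ * -ξ i) := by
  rw [lowPass, fourier_fourier_apply]
  rfl

theorem lowPass_apply (d N : ℕ) (x : EuclideanSpace ℝ (Fin d)) :
    D.lowPass d N x = (((2 : ℝ) ^ N) ^ d : ℝ) * D.lowPass d 0 ((2 : ℝ) ^ N • x) := by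
  rw [lowPass, lowPass, fourier_tensorSchwartz_apply, fourier_tensorSchwartz_apply]
  have h : ∀ t, 𝓕 (fun ξ => D.χ (((2 : ℝ) ^ N)⁻¹ * ξ)) t
      = ((2 : ℝ) ^ N : ℝ) * 𝓕 D.χ ((2 : ℝ) ^ N * t) := fun t => fourier_comp_mul D.χ (by positivity) t
  simp_rw [h, pow_zero, inv_one, one_mul]
  rw [Finset.prod_mul_distrib]
  simp

theorem integral_lowPass (d : ℕ) : ∫ x, D.lowPass d 0 x = 1 := by
  have h : 𝓕 (D.lowPass d 0) 0 = 1 := by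
    rw [fourier_lowPass_apply]
    simp [D.χ_zero]
  rw [← h, SchwartzMap.fourier_coe, Real.fourier_eq']
  simp

/-- By `apply_sconv` the left side integrates an approximate identity against a ↦ u(φ(· - a)). That
function is continuous and of polynomial growth, so dominated convergence applies after rescaling.
-/
theorem tendsto_apply_sconv_lowPass {d : ℕ} (u : 𝓢'(EuclideanSpace ℝ (Fin d), ℂ))
    (φ : 𝓢(EuclideanSpace ℝ (Fin d), ℂ)) :
    Filter.Tendsto (fun N => u (sconv (D.lowPass d N) φ)) Filter.atTop (nhds (u φ)) := by
  set w : EuclideanSpace ℝ (Fin d) → ℂ := fun a => u (SchwartzMap.compSubConstCLM ℂ a φ) with hw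
  have hwc : Continuous w := continuous_apply_translate u φ
  obtain ⟨C, K, hC0, hC⟩ := exists_norm_apply_translate_le u φ
  have h1 : ∀ N, u (sconv (D.lowPass d N) φ)
      = ∫ t, D.lowPass d 0 t * w (((2 : ℝ) ^ N)⁻¹ • t) := fun N => by
    rw [apply_sconv]
    have h := Measure.integral_comp_smul volume
      (fun t : EuclideanSpace ℝ (Fin d) => D.lowPass d 0 t * w (((2 : ℝ) ^ N)⁻¹ • t)) ((2 : ℝ) ^ N)
    rw [finrank_euclideanSpace, Fintype.card_fin, abs_of_pos (by positivity),
      eq_inv_smul_iff₀ (by positivity), ← integral_smul] at h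
    rw [← h]
    congr 1
    ext a
    rw [D.lowPass_apply d N, smul_smul, inv_mul_cancel₀ (by positivity), one_smul,
      Complex.real_smul]
    simp only [hw]
    ring
  have hw0 : w 0 = u φ := by
    simp only [hw]
    congr 1
    ext y
    simp
  simp_rw [h1]
  have hlim : u φ = ∫ t, D.lowPass d 0 t * w 0 := by
    rw [integral_mul_const, D.integral_lowPass, one_mul, hw0]
  rw [hlim]
  refine tendsto_integral_of_dominated_convergence
    (fun t => C * ((1 + ‖t‖) ^ K * ‖D.lowPass d 0 t‖)) (fun N => ?_)
    ((integrable_one_add_norm_pow_mul _ K).const_mul C)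
    (fun N => Filter.Eventually.of_forall fun t => ?_) (Filter.Eventually.of_forall fun t => ?_)
  · exact ((D.lowPass d 0).continuous.mul
      (hwc.comp (continuous_const_smul _))).aestronglyMeasurable
  · rw [norm_mul]
    have h2 : ‖((2 : ℝ) ^ N)⁻¹ • t‖ ≤ ‖t‖ := by
      rw [norm_smul, Real.norm_of_nonneg (by positivity)]
      exact mul_le_of_le_one_left (norm_nonneg _) (inv_le_one_of_one_le₀ (one_le_pow₀ one_le_two))
    calc ‖D.lowPass d 0 t‖ * ‖w (((2 : ℝ) ^ N)⁻¹ • t)‖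
        ≤ ‖D.lowPass d 0 t‖ * (C * (1 + ‖t‖) ^ K) := by
          gcongr
          exact (hC _).trans (by gcongr)
      _ = _ := by ring
  · refine Filter.Tendsto.const_mul _ ?_
    have h3 : Filter.Tendsto (fun N : ℕ => ((2 : ℝ) ^ N)⁻¹ • t) Filter.atTop (nhds 0) := by
      have : Filter.Tendsto (fun N : ℕ => ((2 : ℝ) ^ N)⁻¹) Filter.atTop (nhds 0) :=
        (tendsto_pow_atTop_atTop_of_one_lt one_lt_two).inv_tendsto_atTop
      simpa using this.smul_const t
    exact (hwc.tendsto 0).comp h3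

/-- On the Fourier side, the sum over the cube of multi-indices is a product of d telescoping sums
in one variable. -/
theorem sum_sconv_kernel {d : ℕ} (φ : 𝓢(EuclideanSpace ℝ (Fin d), ℂ)) (N : ℕ) :
    ∑ m ∈ Fintype.piFinset fun _ : Fin d => Finset.range (N + 1),
      sconv (sconv φ (D.kernel m)) (Ψ.shifted m 0) = sconv (D.lowPass d N) φ := by
  refine ext_fourier fun ξ => ?_
  rw [fourier_sconv_apply, fourier_lowPass_apply]
  have h : 𝓕 (∑ m ∈ Fintype.piFinset fun _ : Fin d => Finset.range (N + 1),
      sconv (sconv φ (D.kernel m)) (Ψ.shifted m 0))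
      = ∑ m ∈ Fintype.piFinset fun _ : Fin d => Finset.range (N + 1),
        𝓕 (sconv (sconv φ (D.kernel m)) (Ψ.shifted m 0)) :=
    map_sum (FourierTransform.fourierCLM ℂ 𝓢(EuclideanSpace ℝ (Fin d), ℂ)) _ _
  rw [h, sum_apply]
  simp_rw [fourier_sconv_apply, fourier_kernel_apply, Ψ.fourier_shifted_zero,
    ← D.mult_mul_fourier_dilated_sum N]
  rw [Finset.prod_univ_sum, Finset.sum_mul]
  refine Finset.sum_congr rfl fun m _ => ?_
  rw [Finset.prod_mul_distrib]
  ring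

/-- The reproducing formula. -/
theorem tendsto_sum_integral_conv {d : ℕ} (u : 𝓢'(EuclideanSpace ℝ (Fin d), ℂ))
    (φ : 𝓢(EuclideanSpace ℝ (Fin d), ℂ)) :
    Filter.Tendsto (fun N => ∑ m ∈ Fintype.piFinset fun _ : Fin d => Finset.range (N + 1),
      ∫ a, sconv φ (D.kernel m) a * Ψ.conv m u a) Filter.atTop (nhds (u φ)) := by
  have h : ∀ N, ∑ m ∈ Fintype.piFinset fun _ : Fin d => Finset.range (N + 1),
      ∫ a, sconv φ (D.kernel m) a * Ψ.conv m u a = u (sconv (D.lowPass d N) φ) := fun N => by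
    rw [← D.sum_sconv_kernel, map_sum]
    refine Finset.sum_congr rfl fun m _ => ?_
    rw [apply_sconv]
    refine integral_congr_ae (Filter.Eventually.of_forall fun a => ?_)
    simp only
    rw [LocalMeans.conv, Ψ.shifted_eq_compSubConst m a]
  simp_rw [h]
  exact D.tendsto_apply_sconv_lowPass u φ

/-- The exponent is 4 = 2 + 2: one half of the decay will pay for summation over distant lattice
points, the other half for integrability. -/
theorem exists_norm_fourier_mult_le :
    ∃ C : ℝ, 0 < C ∧ ∀ j t, ‖𝓕 (D.mult j) t‖ ≤ C * (2 ^ j * ((1 + 2 ^ j * |t|) ^ 4)⁻¹) := by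
  have hdecay : ∀ f : ℝ → ℂ, ContDiff ℝ ∞ f → HasCompactSupport f →
      ∃ C : ℝ, 0 ≤ C ∧ ∀ t, (1 + |t|) ^ 4 * ‖𝓕 f t‖ ≤ C := fun f hf hs => by
    obtain ⟨C, hC0, hC⟩ := exists_one_add_pow_mul_iteratedFDeriv_le
      (𝓕 (hs.toSchwartzMap hf) : 𝓢(ℝ, ℂ)) 4 0
    refine ⟨C, hC0, fun t => ?_⟩
    have := hC t
    rw [norm_iteratedFDeriv_zero, SchwartzMap.fourier_coe] at this
    exact this
  obtain ⟨C₀, hC₀, h₀⟩ := hdecay _ D.contDiff_μ₀ D.hasCompactSupport_μ₀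
  obtain ⟨C₁, hC₁, h₁⟩ := hdecay _ D.contDiff_μ₁ D.hasCompactSupport_μ₁
  refine ⟨1 + C₀ + 16 * C₁, by positivity, fun j t => ?_⟩
  have ht := abs_nonneg t
  cases j with
  | zero =>
    rw [pow_zero, one_mul, one_mul, ← div_eq_mul_inv, le_div_iff₀ (by positivity), mul_comm]
    exact (h₀ t).trans (by linarith)
  | succ j =>
    have h2 : 𝓕 (D.mult (j + 1)) t = ((2 : ℝ) ^ j : ℝ) * 𝓕 D.μ₁ ((2 : ℝ) ^ j * t) :=
      fourier_comp_mul D.μ₁ (by positivity) t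
    have h3 := h₁ ((2 : ℝ) ^ j * t)
    rw [abs_mul, abs_of_pos (by positivity : (0 : ℝ) < 2 ^ j)] at h3
    rw [h2, norm_mul, Complex.norm_real, Real.norm_of_nonneg (by positivity), ← div_eq_mul_inv,
      ← mul_div_assoc, le_div_iff₀ (by positivity)]
    have h4 : (1 + 2 ^ (j + 1) * |t|) ^ 4 ≤ 16 * (1 + 2 ^ j * |t|) ^ 4 := by
      have : 1 + 2 ^ (j + 1) * |t| ≤ 2 * (1 + 2 ^ j * |t|) := by
        rw [pow_succ]
        linarith
      calc (1 + 2 ^ (j + 1) * |t|) ^ 4 ≤ (2 * (1 + 2 ^ j * |t|)) ^ 4 := by gcongr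
        _ = _ := by ring
    calc 2 ^ j * ‖𝓕 D.μ₁ (2 ^ j * t)‖ * (1 + 2 ^ (j + 1) * |t|) ^ 4
        ≤ 2 ^ j * ‖𝓕 D.μ₁ (2 ^ j * t)‖ * (16 * (1 + 2 ^ j * |t|) ^ 4) := by gcongr
      _ = 16 * 2 ^ j * ((1 + 2 ^ j * |t|) ^ 4 * ‖𝓕 D.μ₁ (2 ^ j * t)‖) := by ring
      _ ≤ 16 * 2 ^ j * C₁ := by gcongr
      _ ≤ (1 + C₀ + 16 * C₁) * 2 ^ (j + 1) := by
        rw [pow_succ]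
        have : (0 : ℝ) < 2 ^ j := by positivity
        nlinarith [mul_nonneg hC₀ this.le, mul_nonneg hC₁ this.le]

end DualMeans


/-! ### Bounds for sums over the lattice -/

theorem lintegral_pi_prod {d : ℕ} (f : Fin d → ℝ → ℝ≥0∞) (hf : ∀ i, Measurable (f i)) :
    ∫⁻ y : Fin d → ℝ, ∏ i, f i (y i) = ∏ i, ∫⁻ t, f i t := by
  induction d with
  | zero => simp [volume_pi]
  | succ d ih =>
    have h := (volume_preserving_piFinSuccAbove (fun _ : Fin (d + 1) => ℝ) 0).symm.lintegral_comp_emb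
      (MeasurableEquiv.measurableEmbedding _) (fun y => ∏ i, f i (y i))
    rw [← h, Fin.prod_univ_succ, ← ih (fun i => f i.succ) (fun i => hf i.succ),
      ← lintegral_prod_mul (hf 0).aemeasurable
        (Finset.measurable_fun_prod _ fun i _ =>
          (hf i.succ).comp (measurable_pi_apply i)).aemeasurable]
    refine lintegral_congr fun y => ?_
    rw [Fin.prod_univ_succ]
    rfl

theorem lintegral_tensor {d : ℕ} (f : Fin d → ℝ → ℝ≥0∞) (hf : ∀ i, Measurable (f i)) :
    ∫⁻ x : EuclideanSpace ℝ (Fin d), ∏ i, f i (x i) = ∏ i, ∫⁻ t, f i t := by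
  rw [lintegral_euclideanSpace]
  exact lintegral_pi_prod f hf

theorem measurable_tensor {d : ℕ} (f : Fin d → ℝ → ℝ≥0∞) (hf : ∀ i, Measurable (f i)) :
    Measurable fun x : EuclideanSpace ℝ (Fin d) => ∏ i, f i (x i) :=
  Finset.measurable_fun_prod _ fun i _ => (hf i).comp (by fun_prop)

/-- The profile that dominates the dual kernels in one dimension. -/
noncomputable def decayProfile (j : ℕ) (t : ℝ) : ℝ := 2 ^ j * ((1 + 2 ^ j * |t|) ^ 4)⁻¹

@[fun_prop]
theorem continuous_decayProfile (j : ℕ) : Continuous (decayProfile j) := by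
  unfold decayProfile
  refine continuous_const.mul (Continuous.inv₀ (by fun_prop) fun t => by positivity)

theorem decayProfile_nonneg (j : ℕ) (t : ℝ) : 0 ≤ decayProfile j t := by
  unfold decayProfile
  positivity

theorem decayProfile_le (j : ℕ) (t : ℝ) : decayProfile j t ≤ 2 ^ j :=
  mul_le_of_le_one_right (by positivity)
    (inv_le_one_of_one_le₀ (one_le_pow₀ (le_add_of_nonneg_right (by positivity))))

theorem one_add_abs_int_le {b : ℤ} {t : ℝ} (h1 : (b : ℝ) ≤ t) (h2 : t < b + 1) :
    1 + |(b : ℝ)| ≤ 2 * (1 + |t|) := by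
  have : |(b : ℝ)| ≤ |t| + 1 := by
    rw [abs_le]
    constructor
    · linarith [neg_abs_le t]
    · linarith [le_abs_self t]
  linarith [abs_nonneg t]

theorem decayProfile_bucket_le (j : ℕ) {b : ℤ} {t : ℝ} (h1 : (b : ℝ) ≤ 2 ^ j * t)
    (h2 : 2 ^ j * t < b + 1) : decayProfile j t ≤ 2 ^ j * (4 * ((1 + |(b : ℝ)|) ^ 2)⁻¹) := by
  unfold decayProfile
  have h := one_add_abs_int_le h1 h2
  rw [abs_mul, abs_of_pos (by positivity : (0 : ℝ) < 2 ^ j)] at h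
  refine mul_le_mul_of_nonneg_left ?_ (by positivity)
  rw [← div_eq_mul_inv, inv_eq_one_div, div_le_div_iff₀ (by positivity) (by positivity)]
  have h3 : (1 + |(b : ℝ)|) ^ 2 ≤ (2 * (1 + 2 ^ j * |t|)) ^ 2 := by gcongr
  have h4 : (1 + 2 ^ j * |t|) ^ 2 ≤ (1 + 2 ^ j * |t|) ^ 4 :=
    pow_le_pow_right₀ (le_add_of_nonneg_right (by positivity)) (by norm_num)
  linarith [h3, h4]

theorem decayProfile_le_inv_one_add_sq (j : ℕ) (t : ℝ) :
    decayProfile j t ≤ 2 ^ j * (1 + (2 ^ j * t) ^ 2)⁻¹ := by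
  unfold decayProfile
  refine mul_le_mul_of_nonneg_left (inv_anti₀ (by positivity) ?_) (by positivity)
  have h0 : (0 : ℝ) ≤ 2 ^ j * |t| := by positivity
  have h1 : (2 ^ j * t) ^ 2 = (2 ^ j * |t|) ^ 2 := by rw [mul_pow, mul_pow, sq_abs]
  rw [h1]
  calc 1 + (2 ^ j * |t|) ^ 2 ≤ (1 + 2 ^ j * |t|) ^ 2 := by nlinarith
    _ ≤ (1 + 2 ^ j * |t|) ^ 4 :=
      pow_le_pow_right₀ (le_add_of_nonneg_right h0) (by norm_num)

theorem lintegral_scaled_inv_one_add_sq (j : ℕ) (x : ℝ) :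
    ∫⁻ z : ℝ, ENNReal.ofReal (2 ^ j * (1 + (2 ^ j * (z - x)) ^ 2)⁻¹) = ENNReal.ofReal Real.pi := by
  rw [lintegral_sub_right_eq_self (fun z : ℝ => ENNReal.ofReal (2 ^ j * (1 + (2 ^ j * z) ^ 2)⁻¹)) x]
  have hi : Integrable fun z : ℝ => 2 ^ j * (1 + (2 ^ j * z) ^ 2)⁻¹ :=
    (integrable_inv_one_add_sq.comp_mul_left' (by positivity)).const_mul _
  rw [← ofReal_integral_eq_lintegral_ofReal hi (Filter.Eventually.of_forall fun z => by positivity),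
    integral_const_mul, Measure.integral_comp_mul_left (fun z : ℝ => (1 + z ^ 2)⁻¹),
    integral_univ_inv_one_add_sq, abs_of_pos (by positivity), smul_eq_mul, ← mul_assoc,
    mul_inv_cancel₀ (by positivity), one_mul]

theorem lintegral_decayProfile_le (j : ℕ) (x : ℝ) :
    ∫⁻ z : ℝ, ENNReal.ofReal (decayProfile j (z - x)) ≤ ENNReal.ofReal Real.pi := by
  rw [← lintegral_scaled_inv_one_add_sq j x]
  exact lintegral_mono fun z => ENNReal.ofReal_le_ofReal (decayProfile_le_inv_one_add_sq j _)

/-- For z in a bounded interval 1 + |x| ≤ (1 + B)(1 + 2^j|z - x|). Two of the four powers of decay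
are spent on this, and the remaining two form a profile whose integral does not depend on j. -/
theorem decayProfile_sub_le (j : ℕ) {B z x : ℝ} (hz : |z| ≤ B) :
    decayProfile j (z - x)
      ≤ (1 + B) ^ 2 * ((1 + |x|) ^ 2)⁻¹ * (2 ^ j * (1 + (2 ^ j * (z - x)) ^ 2)⁻¹) := by
  have hB : 0 ≤ B := (abs_nonneg z).trans hz
  have h0 : (0 : ℝ) ≤ 2 ^ j * |z - x| := by positivity
  have h1 : (2 ^ j * (z - x)) ^ 2 = (2 ^ j * |z - x|) ^ 2 := by rw [mul_pow, mul_pow, sq_abs]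
  have h2 : |z - x| ≤ 2 ^ j * |z - x| :=
    le_mul_of_one_le_left (abs_nonneg _) (one_le_pow₀ one_le_two)
  have h3 : 1 + |x| ≤ (1 + B) * (1 + 2 ^ j * |z - x|) := by
    have h4 : |x| ≤ |z| + |z - x| := by
      calc |x| = |z - (z - x)| := by congr 1; ring
        _ ≤ _ := abs_sub _ _
    nlinarith
  unfold decayProfile
  rw [h1]
  have h5 : (1 + |x|) ^ 2 ≤ (1 + B) ^ 2 * (1 + 2 ^ j * |z - x|) ^ 2 := by
    rw [← mul_pow]
    gcongr
  have h6 : 1 + (2 ^ j * |z - x|) ^ 2 ≤ (1 + 2 ^ j * |z - x|) ^ 2 := by nlinarith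
  have h7 : (1 + |x|) ^ 2 * (1 + (2 ^ j * |z - x|) ^ 2)
      ≤ (1 + B) ^ 2 * (1 + 2 ^ j * |z - x|) ^ 4 := by
    calc _ ≤ ((1 + B) ^ 2 * (1 + 2 ^ j * |z - x|) ^ 2) * (1 + 2 ^ j * |z - x|) ^ 2 := by gcongr
      _ = _ := by ring
  have h8 : ((1 + 2 ^ j * |z - x|) ^ 4)⁻¹
      ≤ (1 + B) ^ 2 * ((1 + |x|) ^ 2)⁻¹ * (1 + (2 ^ j * |z - x|) ^ 2)⁻¹ := by
    rw [mul_assoc, ← mul_inv, ← div_eq_mul_inv, inv_eq_one_div,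
      div_le_div_iff₀ (by positivity) (by positivity), one_mul]
    exact h7
  calc _ ≤ 2 ^ j * ((1 + B) ^ 2 * ((1 + |x|) ^ 2)⁻¹ * (1 + (2 ^ j * |z - x|) ^ 2)⁻¹) := by gcongr
    _ = _ := by ring

theorem setLIntegral_decayProfile_le (j : ℕ) (B x : ℝ) :
    ∫⁻ z : ℝ, (Set.Icc (-B) B).indicator (fun z => ENNReal.ofReal (decayProfile j (z - x))) z
      ≤ ENNReal.ofReal (Real.pi * (1 + B) ^ 2) * ENNReal.ofReal (((1 + |x|) ^ 2)⁻¹) := by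
  have h : ∀ z, (Set.Icc (-B) B).indicator (fun z => ENNReal.ofReal (decayProfile j (z - x))) z
      ≤ ENNReal.ofReal ((1 + B) ^ 2 * ((1 + |x|) ^ 2)⁻¹)
        * ENNReal.ofReal (2 ^ j * (1 + (2 ^ j * (z - x)) ^ 2)⁻¹) := fun z => by
    by_cases hz : z ∈ Set.Icc (-B) B
    · rw [Set.indicator_of_mem hz, ← ENNReal.ofReal_mul (by positivity)]
      exact ENNReal.ofReal_le_ofReal (decayProfile_sub_le j (abs_le.2 hz))
    · rw [Set.indicator_of_notMem hz]
      exact zero_le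
  refine (lintegral_mono h).trans ?_
  rw [lintegral_const_mul _ (by fun_prop), lintegral_scaled_inv_one_add_sq,
    ← ENNReal.ofReal_mul (by positivity), ← ENNReal.ofReal_mul (by positivity)]
  exact ENNReal.ofReal_le_ofReal (le_of_eq (by ring))

/-- The lattice point `T_n k` as a point of Euclidean space. -/
noncomputable def latticePoint (d n : ℕ) (k : Fin d → ℤ) : EuclideanSpace ℝ (Fin d) :=
  WithLp.toLp 2 ((frolovGenerator d n).mulVec fun i => (k i : ℝ))

/-- The lattice points are grouped by the cells of the grid with side lengths δ_i based at z. Each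
cell holds at most 1 + Cn∏δ_i points by `exists_card_box_le`, and the weights of the cells are
summable over ℤ^d. -/
theorem exists_tsum_lattice_bucket_le {d : ℕ} (hd : 1 ≤ d) :
    ∃ C : ℝ, 0 < C ∧ ∀ n : ℕ, 1 ≤ n → ∀ (z δ : Fin d → ℝ), (∀ i, 0 < δ i) →
      ∑' k : Fin d → ℤ,
        ∏ i, ENNReal.ofReal (((1 + |((⌊(latticePoint d n k i - z i) / δ i⌋ : ℤ) : ℝ)|) ^ 2)⁻¹)
        ≤ ENNReal.ofReal (C * (1 + n * ∏ i, δ i)) := by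
  obtain ⟨C, hC, h⟩ := exists_card_box_le hd
  set F : (Fin d → ℤ) → ℝ≥0∞ := fun b => ∏ i, ENNReal.ofReal (((1 + |(b i : ℝ)|) ^ 2)⁻¹) with hF
  have hFtop : ∑' b, F b < ⊤ := tsum_pi_one_add_abs_inv_sq_lt_top d
  refine ⟨((∑' b, F b).toReal + 1) * (1 + C), by positivity, fun n hn z δ hδ => ?_⟩
  set b : (Fin d → ℤ) → (Fin d → ℤ) := fun k i => ⌊(latticePoint d n k i - z i) / δ i⌋ with hb
  set P := ∏ i, δ i with hP
  have hP0 : 0 ≤ P := Finset.prod_nonneg fun i _ => (hδ i).le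
  have hfib : ∀ c, ∑' k : b ⁻¹' {c}, F (b k) ≤ ENNReal.ofReal (1 + C * n * P) * F c := fun c => by
    rw [ENNReal.tsum_eq_iSup_sum]
    refine iSup_le fun S => ?_
    have h1 : ∑ k ∈ S, F (b k) = S.card * F c := by
      rw [Finset.sum_congr rfl (g := fun _ => F c) fun k _ => by rw [k.2], Finset.sum_const,
        nsmul_eq_mul]
    rw [h1]
    gcongr
    have h2 := h n hn (fun i => z i + c i * δ i) δ hδ (S.map (Function.Embedding.subtype _))
      (fun k hk i => by
        obtain ⟨⟨k', hk'⟩, -, rfl⟩ := Finset.mem_map.1 hk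
        have h3 : ⌊(latticePoint d n k' i - z i) / δ i⌋ = c i := congrFun hk' i
        rw [Int.floor_eq_iff, le_div_iff₀ (hδ i), div_lt_iff₀ (hδ i)] at h3
        change _ ≤ latticePoint d n k' i ∧ latticePoint d n k' i < _
        constructor <;> linarith [h3.1, h3.2])
    rw [Finset.card_map] at h2
    rw [← ENNReal.ofReal_natCast]
    exact ENNReal.ofReal_le_ofReal h2
  calc ∑' k, F (b k) = ∑' c, ∑' k : b ⁻¹' {c}, F (b k) := (ENNReal.tsum_fiberwise _ b).symm
    _ ≤ ∑' c, ENNReal.ofReal (1 + C * n * P) * F c := ENNReal.tsum_le_tsum hfib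
    _ = ENNReal.ofReal (1 + C * n * P) * ENNReal.ofReal (∑' c, F c).toReal := by
      rw [ENNReal.tsum_mul_left, ENNReal.ofReal_toReal hFtop.ne]
    _ ≤ _ := by
      rw [← ENNReal.ofReal_mul (by positivity)]
      refine ENNReal.ofReal_le_ofReal ?_
      have h4 : 1 + C * n * P ≤ (1 + C) * (1 + n * P) := by
        have : 0 ≤ n * P := by positivity
        nlinarith
      have h5 : 0 ≤ (∑' b, F b).toReal := ENNReal.toReal_nonneg
      calc (1 + C * n * P) * (∑' c, F c).toReal
          ≤ ((1 + C) * (1 + n * P)) * ((∑' c, F c).toReal + 1) := by gcongr; linarith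
        _ = _ := by ring

namespace DualMeans

variable {L : ℕ} {Ψ : LocalMeans L} (D : DualMeans Ψ)

theorem exists_enorm_kernel_le (d : ℕ) :
    ∃ C : ℝ, 0 < C ∧ ∀ (m : Fin d → ℕ) (x : EuclideanSpace ℝ (Fin d)),
      ‖D.kernel m x‖ₑ ≤ ENNReal.ofReal C * ∏ i, ENNReal.ofReal (decayProfile (m i) (x i)) := by
  obtain ⟨C, hC, h⟩ := D.exists_norm_fourier_mult_le
  refine ⟨C ^ d, by positivity, fun m x => ?_⟩
  rw [← ENNReal.ofReal_prod_of_nonneg fun i _ => decayProfile_nonneg _ _,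
    ← ENNReal.ofReal_mul (by positivity), ← ofReal_norm]
  refine ENNReal.ofReal_le_ofReal ?_
  rw [kernel_apply, norm_prod]
  calc ∏ i, ‖𝓕 (D.mult (m i)) (x i)‖ ≤ ∏ i, (C * decayProfile (m i) (x i)) :=
        Finset.prod_le_prod (fun _ _ => norm_nonneg _) fun i _ => h _ _
    _ = _ := by rw [Finset.prod_mul_distrib, Finset.prod_const, Finset.card_univ, Fintype.card_fin]

/-- The sum of the absolute values of a translated kernel over the lattice. -/
noncomputable def latticeSum {d : ℕ} (n : ℕ) (m : Fin d → ℕ) (z : EuclideanSpace ℝ (Fin d)) :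
    ℝ≥0∞ :=
  ∑' k : Fin d → ℤ, ‖D.kernel m (z - latticePoint d n k)‖ₑ

theorem ofReal_two_pow_prod {d : ℕ} (m : Fin d → ℕ) :
    ∏ i, ENNReal.ofReal ((2 : ℝ) ^ m i) = ENNReal.ofReal ((2 : ℝ) ^ ∑ i, m i) := by
  rw [← ENNReal.ofReal_prod_of_nonneg fun i _ => by positivity, Finset.prod_pow_eq_pow_sum]

/-- With cells of side lengths 2^{-m_i} the kernel has height about 2^{|m|₁} and a cell holds O(1 +
n2^{-|m|₁}) points. This is the L_∞ half of the estimate for the lattice sum. -/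
theorem exists_latticeSum_le {d : ℕ} (hd : 1 ≤ d) :
    ∃ C : ℝ, 0 < C ∧ ∀ n : ℕ, 1 ≤ n → ∀ (m : Fin d → ℕ) (z : EuclideanSpace ℝ (Fin d)),
      D.latticeSum n m z ≤ ENNReal.ofReal (C * (2 ^ (∑ i, m i) + n)) := by
  obtain ⟨C₁, hC₁, h₁⟩ := D.exists_enorm_kernel_le d
  obtain ⟨C₂, hC₂, h₂⟩ := exists_tsum_lattice_bucket_le hd
  refine ⟨C₁ * 4 ^ d * C₂, by positivity, fun n hn m z => ?_⟩
  have h3 := h₂ n hn z (fun i => ((2 : ℝ) ^ m i)⁻¹) (fun i => by positivity)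
  have h4 : ∀ k, ‖D.kernel m (z - latticePoint d n k)‖ₑ
      ≤ ENNReal.ofReal (C₁ * 4 ^ d * 2 ^ ∑ i, m i) * ∏ i, ENNReal.ofReal (((1 +
        |((⌊(latticePoint d n k i - z i) / ((2 : ℝ) ^ m i)⁻¹⌋ : ℤ) : ℝ)|) ^ 2)⁻¹) := fun k => by
    refine (h₁ m _).trans ?_
    rw [← ENNReal.ofReal_prod_of_nonneg fun i _ => decayProfile_nonneg _ _,
      ← ENNReal.ofReal_prod_of_nonneg fun i _ => by positivity,
      ← ENNReal.ofReal_mul hC₁.le, ← ENNReal.ofReal_mul (by positivity)]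
    refine ENNReal.ofReal_le_ofReal ?_
    calc C₁ * ∏ i, decayProfile (m i) ((z - latticePoint d n k) i)
        ≤ C₁ * ∏ i, (2 ^ m i * (4 * ((1 +
          |((⌊(latticePoint d n k i - z i) / ((2 : ℝ) ^ m i)⁻¹⌋ : ℤ) : ℝ)|) ^ 2)⁻¹)) := by
          refine mul_le_mul_of_nonneg_left (Finset.prod_le_prod
            (fun i _ => decayProfile_nonneg _ _) fun i _ => ?_) hC₁.le
          have h5 : decayProfile (m i) ((z - latticePoint d n k) i)
              = decayProfile (m i) (latticePoint d n k i - z i) := by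
            unfold decayProfile
            rw [PiLp.sub_apply, abs_sub_comm]
          rw [h5, div_inv_eq_mul, mul_comm (latticePoint d n k i - z i)]
          exact decayProfile_bucket_le _ (Int.floor_le _) (Int.lt_floor_add_one _)
      _ = _ := by
          rw [Finset.prod_mul_distrib, Finset.prod_mul_distrib, Finset.prod_pow_eq_pow_sum,
            Finset.prod_const, Finset.card_univ, Fintype.card_fin]
          ring
  refine (ENNReal.tsum_le_tsum h4).trans ?_
  rw [ENNReal.tsum_mul_left]
  refine (mul_le_mul_right h3 _).trans ?_
  rw [← ENNReal.ofReal_mul (by positivity)]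
  refine ENNReal.ofReal_le_ofReal (le_of_eq ?_)
  rw [Finset.prod_inv_distrib, Finset.prod_pow_eq_pow_sum]
  field_simp

/-- The box `[-B, B]^d`. -/
def centeredBox (d : ℕ) (B : ℝ) : Set (EuclideanSpace ℝ (Fin d)) :=
  {x | ∀ i, x i ∈ Set.Icc (-B) B}

theorem measurable_enorm_kernel_sub {d : ℕ} (m : Fin d → ℕ) (x : EuclideanSpace ℝ (Fin d)) :
    Measurable fun z => ‖D.kernel m (z - x)‖ₑ :=
  ((D.kernel m).continuous.comp (continuous_id.sub continuous_const)).enorm.measurable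

theorem measurable_latticeSum {d : ℕ} (n : ℕ) (m : Fin d → ℕ) :
    Measurable (D.latticeSum n m) :=
  Measurable.tsum fun _ => D.measurable_enorm_kernel_sub m _

theorem prod_indicator_eq {d : ℕ} (B : ℝ) (f : Fin d → ℝ → ℝ≥0∞)
    (z : EuclideanSpace ℝ (Fin d)) :
    ∏ i, (Set.Icc (-B) B).indicator (f i) (z i)
      = (centeredBox d B).indicator (fun z => ∏ i, f i (z i)) z := by
  by_cases hz : z ∈ centeredBox d B
  · rw [Set.indicator_of_mem hz]
    exact Finset.prod_congr rfl fun i _ => Set.indicator_of_mem (hz i) _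
  · rw [Set.indicator_of_notMem hz]
    obtain ⟨i, hi⟩ := not_forall.1 hz
    exact Finset.prod_eq_zero (Finset.mem_univ i) (Set.indicator_of_notMem hi _)

/-- This is the L_1 half. After integration over the box, a lattice point x contributes O(∏(1 +
|x_i|)^{-2}) whatever m is, so the count is made in unit cells, each with O(n) points. -/
theorem exists_lintegral_latticeSum_le {d : ℕ} (hd : 1 ≤ d) (B : ℝ) :
    ∃ C : ℝ, 0 < C ∧ ∀ n : ℕ, 1 ≤ n → ∀ m : Fin d → ℕ,
      ∫⁻ z, (centeredBox d B).indicator (D.latticeSum n m) z ≤ ENNReal.ofReal (C * n) := by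
  obtain ⟨C₁, hC₁, h₁⟩ := D.exists_enorm_kernel_le d
  obtain ⟨C₂, hC₂, h₂⟩ := exists_tsum_lattice_bucket_le hd
  -- The summand 1 keeps the constant positive, since B is an arbitrary real number and 1 + B may
  -- vanish.
  refine ⟨C₁ * (Real.pi * (1 + B) ^ 2 * 4) ^ d * C₂ * 2 + 1, by positivity, fun n hn m => ?_⟩
  have h3 := h₂ n hn (fun _ => 0) (fun _ => 1) (fun i => one_pos)
  have h4 : ∀ k, ∫⁻ z, (centeredBox d B).indicator
      (fun z => ‖D.kernel m (z - latticePoint d n k)‖ₑ) z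
      ≤ ENNReal.ofReal (C₁ * (Real.pi * (1 + B) ^ 2 * 4) ^ d) * ∏ i, ENNReal.ofReal (((1 +
        |((⌊(latticePoint d n k i - 0) / 1⌋ : ℤ) : ℝ)|) ^ 2)⁻¹) := fun k => by
    have h5 : ∀ z, (centeredBox d B).indicator
        (fun z => ‖D.kernel m (z - latticePoint d n k)‖ₑ) z
        ≤ ENNReal.ofReal C₁ * ∏ i, (Set.Icc (-B) B).indicator
          (fun t => ENNReal.ofReal (decayProfile (m i) (t - latticePoint d n k i))) (z i) :=
      fun z => by
        rw [prod_indicator_eq]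
        by_cases hz : z ∈ centeredBox d B
        · rw [Set.indicator_of_mem hz, Set.indicator_of_mem hz]
          exact h₁ m _
        · rw [Set.indicator_of_notMem hz]
          exact zero_le
    have hmeas : ∀ i, Measurable ((Set.Icc (-B) B).indicator
        (fun t => ENNReal.ofReal (decayProfile (m i) (t - latticePoint d n k i)))) := fun i =>
      (by fun_prop : Measurable fun t => ENNReal.ofReal
        (decayProfile (m i) (t - latticePoint d n k i))).indicator measurableSet_Icc
    refine (lintegral_mono h5).trans ?_
    rw [lintegral_const_mul _ (measurable_tensor _ hmeas),
      lintegral_tensor _ hmeas]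
    calc ENNReal.ofReal C₁ * ∏ i, ∫⁻ t, (Set.Icc (-B) B).indicator
          (fun t => ENNReal.ofReal (decayProfile (m i) (t - latticePoint d n k i))) t
        ≤ ENNReal.ofReal C₁ * ∏ i, (ENNReal.ofReal (Real.pi * (1 + B) ^ 2 * 4)
          * ENNReal.ofReal (((1 + |((⌊(latticePoint d n k i - 0) / 1⌋ : ℤ) : ℝ)|) ^ 2)⁻¹)) := by
          gcongr with i
          refine (setLIntegral_decayProfile_le _ _ _).trans ?_
          rw [← ENNReal.ofReal_mul (by positivity), ← ENNReal.ofReal_mul (by positivity)]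
          refine ENNReal.ofReal_le_ofReal ?_
          rw [mul_assoc _ (4 : ℝ), sub_zero, div_one]
          refine mul_le_mul_of_nonneg_left ?_ (by positivity)
          have h6 := one_add_abs_int_le (Int.floor_le (latticePoint d n k i))
            (Int.lt_floor_add_one _)
          rw [← div_eq_mul_inv, inv_eq_one_div, div_le_div_iff₀ (by positivity) (by positivity),
            one_mul]
          calc _ ≤ (2 * (1 + |latticePoint d n k i|)) ^ 2 := by gcongr
            _ = _ := by ring
      _ = _ := by
          rw [Finset.prod_mul_distrib, Finset.prod_const, Finset.card_univ, Fintype.card_fin,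
            ← ENNReal.ofReal_pow (by positivity), ← mul_assoc, ← ENNReal.ofReal_mul hC₁.le]
  have h7 : ∀ z, (centeredBox d B).indicator (D.latticeSum n m) z
      = ∑' k, (centeredBox d B).indicator
        (fun z => ‖D.kernel m (z - latticePoint d n k)‖ₑ) z := fun z => by
    by_cases hz : z ∈ centeredBox d B
    · simp only [Set.indicator_of_mem hz]
      rfl
    · simp only [Set.indicator_of_notMem hz, tsum_zero]
  have hbox : MeasurableSet (centeredBox d B) := by
    have : centeredBox d B = ⋂ i, (fun x : EuclideanSpace ℝ (Fin d) => x i) ⁻¹' Set.Icc (-B) B := by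
      ext x
      simp [centeredBox]
    rw [this]
    exact MeasurableSet.iInter fun i => measurableSet_Icc.preimage (by fun_prop)
  simp_rw [h7]
  rw [lintegral_tsum fun k =>
    ((D.measurable_enorm_kernel_sub m _).indicator hbox).aemeasurable]
  refine (ENNReal.tsum_le_tsum h4).trans ?_
  rw [ENNReal.tsum_mul_left]
  refine (mul_le_mul_right h3 _).trans ?_
  rw [← ENNReal.ofReal_mul (by positivity)]
  refine ENNReal.ofReal_le_ofReal ?_
  rw [Finset.prod_const_one, mul_one]
  have hn' : (1 : ℝ) ≤ n := by exact_mod_cast hn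
  have h8 : 0 ≤ C₁ * (Real.pi * (1 + B) ^ 2 * 4) ^ d * C₂ := by positivity
  calc _ = C₁ * (Real.pi * (1 + B) ^ 2 * 4) ^ d * C₂ * (1 + n) := by ring
    _ ≤ C₁ * (Real.pi * (1 + B) ^ 2 * 4) ^ d * C₂ * (2 * n) := by gcongr; linarith
    _ ≤ _ := by nlinarith

end DualMeans


/-! ### Synthesis with the dual kernels -/

theorem isCompact_centeredBox (d : ℕ) (B : ℝ) : IsCompact (DualMeans.centeredBox d B) := by
  have h : IsCompact (Set.univ.pi fun _ : Fin d => Set.Icc (-B) B) :=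
    isCompact_univ_pi fun _ => isCompact_Icc
  have h' : DualMeans.centeredBox d B = WithLp.toLp 2 '' Set.univ.pi fun _ : Fin d => Set.Icc (-B) B := by
    ext x
    constructor
    · exact fun hx => ⟨WithLp.ofLp x, fun i _ => hx i, rfl⟩
    · rintro ⟨y, hy, rfl⟩ i
      exact hy i trivial
  rw [h']
  exact h.image (PiLp.continuous_toLp 2 _)

theorem ofReal_rpow_mul_ofReal_rpow {a b q : ℝ} (ha : 0 < a) (hb : 0 < b) :
    ENNReal.ofReal a ^ q * ENNReal.ofReal b ^ (1 - q) = ENNReal.ofReal (b * (a / b) ^ q) := by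
  rw [ENNReal.ofReal_rpow_of_pos ha, ENNReal.ofReal_rpow_of_pos hb,
    ← ENNReal.ofReal_mul (by positivity), Real.rpow_sub hb, Real.rpow_one, Real.div_rpow ha.le hb.le]
  congr 1
  ring

namespace DualMeans

variable {L : ℕ} {Ψ : LocalMeans L} (D : DualMeans Ψ)

/-- The convolution of a function with the reflection of a dual kernel. -/
noncomputable def synth {d : ℕ} (m : Fin d → ℕ) (g : EuclideanSpace ℝ (Fin d) → ℂ)
    (x : EuclideanSpace ℝ (Fin d)) : ℂ :=
  ∫ z, D.kernel m (z - x) * g z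

variable {d : ℕ} {g : EuclideanSpace ℝ (Fin d) → ℂ} {B : ℝ}

theorem integrable_of_eq_zero_off_box (hg : Continuous g) (hB : ∀ z, z ∉ centeredBox d B → g z = 0) :
    Integrable g :=
  hg.integrable_of_hasCompactSupport (HasCompactSupport.intro (isCompact_centeredBox d B) hB)

theorem norm_kernel_le (m : Fin d → ℕ) (x : EuclideanSpace ℝ (Fin d)) :
    ‖D.kernel m x‖ ≤ SchwartzMap.seminorm ℂ 0 0 (D.kernel m) :=
  SchwartzMap.norm_le_seminorm ℂ _ x

theorem continuous_synth (hg : Continuous g) (hB : ∀ z, z ∉ centeredBox d B → g z = 0)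
    (m : Fin d → ℕ) : Continuous (D.synth m g) := by
  refine continuous_of_dominated (bound := fun z =>
    SchwartzMap.seminorm ℂ 0 0 (D.kernel m) * ‖g z‖) (fun x => ?_)
    (fun x => Filter.Eventually.of_forall fun z => ?_)
    ((integrable_of_eq_zero_off_box hg hB).norm.const_mul _)
    (Filter.Eventually.of_forall fun z => ?_)
  · exact (((D.kernel m).continuous.comp (continuous_id.sub continuous_const)).mul
      hg).aestronglyMeasurable
  · rw [norm_mul]
    gcongr
    exact D.norm_kernel_le m _
  · exact ((D.kernel m).continuous.comp (continuous_const.sub continuous_id)).mul continuous_const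

theorem integral_sconv_kernel (hg : Continuous g) (hB : ∀ z, z ∉ centeredBox d B → g z = 0)
    (m : Fin d → ℕ) (φ : 𝓢(EuclideanSpace ℝ (Fin d), ℂ)) :
    ∫ a, sconv φ (D.kernel m) a * g a = ∫ x, φ x * D.synth m g x := by
  have hi : Integrable (Function.uncurry fun a x : EuclideanSpace ℝ (Fin d) =>
      φ x * (D.kernel m (a - x) * g a)) (volume.prod volume) := by
    have hdom := ((integrable_of_eq_zero_off_box hg hB).norm.const_mul
      (SchwartzMap.seminorm ℂ 0 0 (D.kernel m))).mul_prod (φ.integrable (μ := volume)).norm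
    refine hdom.mono' ?_ (Filter.Eventually.of_forall fun z => ?_)
    · have h1 : Continuous fun z : EuclideanSpace ℝ (Fin d) × EuclideanSpace ℝ (Fin d) =>
          φ z.2 * (D.kernel m (z.1 - z.2) * g z.1) :=
        (φ.continuous.comp continuous_snd).mul
          (((D.kernel m).continuous.comp (continuous_fst.sub continuous_snd)).mul
            (hg.comp continuous_fst))
      exact h1.aestronglyMeasurable
    · simp only [Function.uncurry]
      rw [norm_mul, norm_mul, mul_comm]
      gcongr
      exact D.norm_kernel_le m _
  have h := integral_integral_swap hi
  simp_rw [integral_const_mul] at h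
  change _ = ∫ x, φ x * ∫ z, D.kernel m (z - x) * g z
  rw [← h]
  refine integral_congr_ae (Filter.Eventually.of_forall fun a => ?_)
  simp only
  rw [sconv_apply, ← integral_mul_const]
  refine integral_congr_ae (Filter.Eventually.of_forall fun t => ?_)
  simp only
  ring

theorem enorm_synth_le (m : Fin d → ℕ) (x : EuclideanSpace ℝ (Fin d)) :
    ‖D.synth m g x‖ₑ ≤ ∫⁻ z, ‖g z‖ₑ * ‖D.kernel m (z - x)‖ₑ := by
  refine (enorm_integral_le_lintegral_enorm _).trans (le_of_eq ?_)
  refine lintegral_congr fun z => ?_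
  rw [enorm_mul, mul_comm]

theorem exists_lintegral_enorm_kernel_le (d : ℕ) :
    ∃ C : ℝ, 0 < C ∧ ∀ m : Fin d → ℕ, ∫⁻ x, ‖D.kernel m x‖ₑ ≤ ENNReal.ofReal C := by
  obtain ⟨C₁, hC₁, h₁⟩ := D.exists_enorm_kernel_le d
  refine ⟨C₁ * Real.pi ^ d, by positivity, fun m => ?_⟩
  have hmeas : ∀ i, Measurable fun t => ENNReal.ofReal (decayProfile (m i) t) := fun i => by fun_prop
  refine (lintegral_mono (h₁ m)).trans ?_
  rw [lintegral_const_mul _ (measurable_tensor _ hmeas), lintegral_tensor _ hmeas,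
    ENNReal.ofReal_mul hC₁.le, ENNReal.ofReal_pow (by positivity)]
  gcongr
  refine (Finset.prod_le_prod' fun i _ => ?_).trans
    (le_of_eq (by rw [Finset.prod_const, Finset.card_univ, Fintype.card_fin]))
  simpa using lintegral_decayProfile_le (m i) 0

/-- An inequality of Nikol'skii type: the kernel has supremum O(2^{|m|₁}) and bounded L_1 norm, and
Hölder's inequality interpolates to 2^{|m|₁/p}. -/
theorem exists_enorm_synth_le {p : ℝ≥0∞} (hp : 1 ≤ p) :
    ∃ C : ℝ, 0 < C ∧ ∀ (m : Fin d → ℕ) (g : EuclideanSpace ℝ (Fin d) → ℂ), Continuous g → ∀ x,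
      ‖D.synth m g x‖ₑ
        ≤ eLpNorm g p volume * ENNReal.ofReal (C * (2 ^ ∑ i, m i) ^ (p⁻¹).toReal) := by
  obtain ⟨C₁, hC₁, h₁⟩ := D.exists_enorm_kernel_le d
  obtain ⟨C₂, hC₂, h₂⟩ := D.exists_lintegral_enorm_kernel_le d
  refine ⟨C₂ * (C₁ / C₂) ^ (p⁻¹).toReal, by positivity, fun m g hg x => ?_⟩
  have hA : ∀ z, ‖D.kernel m (z - x)‖ₑ ≤ ENNReal.ofReal (C₁ * 2 ^ ∑ i, m i) := fun z => by
    refine (h₁ m _).trans ?_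
    rw [ENNReal.ofReal_mul hC₁.le, ← ofReal_two_pow_prod]
    gcongr
    exact decayProfile_le _ _
  have hI : ∫⁻ z, ‖D.kernel m (z - x)‖ₑ ≤ ENNReal.ofReal C₂ := by
    rw [lintegral_sub_right_eq_self (fun z => ‖D.kernel m z‖ₑ) x]
    exact h₂ m
  refine (D.enorm_synth_le m x).trans ((lintegral_mul_le_eLpNorm_mul volume hp
    hg.enorm.measurable.aemeasurable (D.measurable_enorm_kernel_sub m x).aemeasurable hA hI).trans ?_)
  rw [eLpNorm_enorm, ofReal_rpow_mul_ofReal_rpow (by positivity) hC₂]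
  refine mul_le_mul_right (ENNReal.ofReal_le_ofReal (le_of_eq ?_)) _
  rw [mul_assoc, ← Real.mul_rpow (by positivity) (by positivity)]
  congr 2
  ring

/-- The left side is the integral of |g| against the lattice sum of the kernel. As g vanishes off
the box, the lattice sum may be restricted to it, where both of its bounds are available for
Hölder's inequality. -/
theorem exists_tsum_lattice_le (hd : 1 ≤ d) {p : ℝ≥0∞} (hp : 1 ≤ p) (B : ℝ) :
    ∃ C : ℝ, 0 < C ∧ ∀ n : ℕ, 1 ≤ n → ∀ (m : Fin d → ℕ) (g : EuclideanSpace ℝ (Fin d) → ℂ),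
      Continuous g → (∀ z, z ∉ centeredBox d B → g z = 0) →
      ∑' k : Fin d → ℤ, ∫⁻ z, ‖g z‖ₑ * ‖D.kernel m (z - latticePoint d n k)‖ₑ
        ≤ eLpNorm g p volume
          * ENNReal.ofReal (C * n * ((2 ^ (∑ i, m i) + n) / n) ^ (p⁻¹).toReal) := by
  obtain ⟨C₁, hC₁, h₁⟩ := D.exists_latticeSum_le hd
  obtain ⟨C₂, hC₂, h₂⟩ := D.exists_lintegral_latticeSum_le hd B
  refine ⟨C₂ * (C₁ / C₂) ^ (p⁻¹).toReal, by positivity, fun n hn m g hg hB => ?_⟩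
  have hn' : (0 : ℝ) < n := by exact_mod_cast hn
  set W := (centeredBox d B).indicator (D.latticeSum n m) with hW
  have hWm : Measurable W := (D.measurable_latticeSum n m).indicator
    (isCompact_centeredBox d B).isClosed.measurableSet
  have hA : ∀ z, W z ≤ ENNReal.ofReal (C₁ * (2 ^ (∑ i, m i) + n)) := fun z =>
    (Set.indicator_le_self _ _ z).trans (h₁ n hn m z)
  have heq : ∑' k : Fin d → ℤ, ∫⁻ z, ‖g z‖ₑ * ‖D.kernel m (z - latticePoint d n k)‖ₑ
      = ∫⁻ z, ‖g z‖ₑ * W z := by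
    have hmeas : ∀ k, AEMeasurable (fun z => ‖g z‖ₑ * ‖D.kernel m (z - latticePoint d n k)‖ₑ)
        volume := fun k => (hg.enorm.measurable.mul (D.measurable_enorm_kernel_sub m _)).aemeasurable
    rw [← lintegral_tsum hmeas]
    refine lintegral_congr fun z => ?_
    rw [ENNReal.tsum_mul_left]
    by_cases hz : z ∈ centeredBox d B
    · rw [hW, Set.indicator_of_mem hz]
      rfl
    · rw [hB z hz, enorm_zero, zero_mul, zero_mul]
  rw [heq]
  refine (lintegral_mul_le_eLpNorm_mul volume hp
    hg.enorm.measurable.aemeasurable hWm.aemeasurable hA (h₂ n hn m)).trans ?_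
  rw [eLpNorm_enorm, ofReal_rpow_mul_ofReal_rpow (by positivity) (by positivity)]
  refine mul_le_mul_right (ENNReal.ofReal_le_ofReal (le_of_eq ?_)) _
  have h3 : C₁ * (2 ^ (∑ i, m i) + n) / (C₂ * n) = (C₁ / C₂) * ((2 ^ (∑ i, m i) + n) / n) := by
    field_simp
  rw [h3, Real.mul_rpow (by positivity) (by positivity)]
  ring

theorem exists_lintegral_synth_le {p : ℝ≥0∞} (hp : 1 ≤ p) (d : ℕ) (B : ℝ) :
    ∃ C : ℝ, 0 < C ∧ ∀ (m : Fin d → ℕ) (g : EuclideanSpace ℝ (Fin d) → ℂ),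
      Continuous g → (∀ z, z ∉ centeredBox d B → g z = 0) →
      ∫⁻ x, ∫⁻ z, ‖g z‖ₑ * ‖D.kernel m (z - x)‖ₑ ≤ eLpNorm g p volume * ENNReal.ofReal C := by
  obtain ⟨C₂, hC₂, h₂⟩ := D.exists_lintegral_enorm_kernel_le d
  have hvol : volume (centeredBox d B) < ⊤ := (isCompact_centeredBox d B).measure_lt_top
  set V := (volume (centeredBox d B)).toReal + 1 with hV
  have hV0 : 0 < V := by positivity
  refine ⟨V * (1 / V) ^ (p⁻¹).toReal * C₂, by positivity, fun m g hg hB => ?_⟩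
  set W : EuclideanSpace ℝ (Fin d) → ℝ≥0∞ := (centeredBox d B).indicator fun _ => 1 with hW
  have hK : MeasurableSet (centeredBox d B) := (isCompact_centeredBox d B).isClosed.measurableSet
  have hWm : Measurable W := measurable_const.indicator hK
  have hgW : ∀ z, ‖g z‖ₑ * W z = ‖g z‖ₑ := fun z => by
    by_cases hz : z ∈ centeredBox d B
    · rw [hW, Set.indicator_of_mem hz, mul_one]
    · rw [hB z hz, enorm_zero, zero_mul]
  have h1 : ∫⁻ z, ‖g z‖ₑ ≤ eLpNorm g p volume * ENNReal.ofReal (V * (1 / V) ^ (p⁻¹).toReal) := by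
    have h := lintegral_mul_le_eLpNorm_mul volume hp hg.enorm.measurable.aemeasurable
      hWm.aemeasurable (A := ENNReal.ofReal 1) (B := ENNReal.ofReal V)
      (fun z => by
        rw [ENNReal.ofReal_one]
        exact Set.indicator_le_self _ _ z)
      (by
        rw [hW, lintegral_indicator hK, setLIntegral_one]
        refine ENNReal.le_ofReal_iff_toReal_le hvol.ne hV0.le |>.2 ?_
        rw [hV]
        linarith)
    simp_rw [hgW] at h
    rwa [eLpNorm_enorm, ofReal_rpow_mul_ofReal_rpow one_pos hV0] at h
  rw [lintegral_lintegral_swap]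
  · have h3 : ∀ z, ∫⁻ x, ‖g z‖ₑ * ‖D.kernel m (z - x)‖ₑ ≤ ‖g z‖ₑ * ENNReal.ofReal C₂ := fun z => by
      have hmeas : Measurable fun x => ‖D.kernel m (z - x)‖ₑ :=
        ((D.kernel m).continuous.comp (continuous_const.sub continuous_id)).enorm.measurable
      rw [lintegral_const_mul _ hmeas, lintegral_sub_left_eq_self (fun x => ‖D.kernel m x‖ₑ) z]
      gcongr
      exact h₂ m
    refine (lintegral_mono h3).trans ?_
    rw [lintegral_mul_const _ hg.enorm.measurable, ENNReal.ofReal_mul (by positivity), ← mul_assoc]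
    gcongr
  · have h4 : Continuous fun z : EuclideanSpace ℝ (Fin d) × EuclideanSpace ℝ (Fin d) =>
        D.kernel m (z.2 - z.1) := (D.kernel m).continuous.comp (continuous_snd.sub continuous_fst)
    exact ((hg.comp continuous_snd).enorm.measurable.mul h4.enorm.measurable).aemeasurable

/-! ### Exactness of the cubature rule for the low frequency part -/

theorem integral_comp_generator (hd : 1 ≤ d) {n : ℕ} (hn : 1 ≤ n) (F : (Fin d → ℝ) → ℂ)
    (hF : Continuous F) :
    ∫ y : Fin d → ℝ, F ((frolovGenerator d n).mulVec y) = (n : ℂ) * ∫ w, F w := by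
  have hdet := det_frolovGenerator hd hn
  have hn' : (0 : ℝ) < n := by exact_mod_cast hn
  have hne : (frolovGenerator d n).det ≠ 0 := by rw [hdet]; positivity
  have h := Real.map_matrix_volume_pi_eq_smul_volume_pi hne
  rw [hdet, inv_inv, abs_of_pos hn'] at h
  have hm : AEMeasurable (Matrix.toLin' (frolovGenerator d n)) volume :=
    (LinearMap.continuous_of_finiteDimensional
      (Matrix.toLin' (frolovGenerator d n))).aemeasurable
  have h2 := integral_map (μ := volume) hm (f := F) hF.aestronglyMeasurable
  rw [h, integral_smul_measure, ENNReal.toReal_ofReal hn'.le] at h2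
  rw [← Complex.ofReal_natCast, ← Complex.real_smul, h2]
  rfl

/-- Poisson summation for y ↦ kernel(z - T y). Its Fourier transform at an integer vector l ≠ 0 is n
times a phase times the tensor multiplier at the dual lattice point T⁻ᵀl, which lies outside the
band of the kernel. -/
theorem tsum_kernel_lattice (hd : 1 ≤ d) {R c : ℝ}
    (hsupp : ∀ j ξ, R * 2 ^ j < |ξ| → D.mult j ξ = 0)
    (hdual : ∀ n : ℕ, 1 ≤ n → ∀ k : Fin d → ℤ, k ≠ 0 →
      c * n ≤ ∏ i, |((frolovGenerator d n)⁻¹.transpose).mulVec (fun j => (k j : ℝ)) i|)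
    {n : ℕ} (hn : 1 ≤ n) {m : Fin d → ℕ} (hm : R ^ d * 2 ^ (∑ i, m i) < c * n)
    (z : EuclideanSpace ℝ (Fin d)) :
    ∑' k : Fin d → ℤ, D.kernel m (z - latticePoint d n k) = n * ∫ x, D.kernel m x := by
  set T := frolovGenerator d n with hT
  have hn' : (0 : ℝ) < n := by exact_mod_cast hn
  have hunit : IsUnit T.det := by
    rw [hT, det_frolovGenerator hd hn]
    exact (inv_ne_zero hn'.ne').isUnit
  have hTm : Continuous fun y : Fin d → ℝ => T.mulVec y := Continuous.matrix_mulVec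
    continuous_const continuous_id
  have hTi : Continuous fun y : Fin d → ℝ => T⁻¹.mulVec y := Continuous.matrix_mulVec
    continuous_const continuous_id
  set H : (Fin d → ℝ) → ℂ := fun y => D.kernel m (z - WithLp.toLp 2 (T.mulVec y)) with hH
  have hHc : Continuous H := (D.kernel m).continuous.comp
    (continuous_const.sub ((PiLp.continuous_toLp 2 _).comp hTm))
  obtain ⟨C₀, hC₀, hdec⟩ := exists_one_add_pow_mul_iteratedFDeriv_le (D.kernel m) (2 * d) 0
  simp_rw [norm_iteratedFDeriv_zero] at hdec
  let A : EuclideanSpace ℝ (Fin d) →L[ℝ] (Fin d → ℝ) := LinearMap.toContinuousLinearMap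
    ((Matrix.toLin' T⁻¹).comp (WithLp.linearEquiv 2 ℝ (Fin d → ℝ)).toLinearMap)
  have hA : ∀ y : Fin d → ℝ, A (WithLp.toLp 2 (T.mulVec y)) = y := fun y => by
    change T⁻¹.mulVec (T.mulVec y) = y
    rw [Matrix.mulVec_mulVec, Matrix.nonsing_inv_mul _ hunit, Matrix.one_mulVec]
  -- Since y is a fixed linear image of z - w, the size of y is controlled by that of w. The decay
  -- of the Schwartz kernel in w thus gives the product decay in y that Poisson summation needs; K
  -- may depend on n and z.
  set K : ℝ := 1 + ‖A‖ * (1 + ‖z‖) with hK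
  have hK1 : 1 ≤ K := le_add_of_nonneg_right (by positivity)
  have hy : ∀ (y : Fin d → ℝ) i, 1 + |y i| ≤ K * (1 + ‖z - WithLp.toLp 2 (T.mulVec y)‖) :=
    fun y i => by
      set w := z - WithLp.toLp 2 (T.mulVec y) with hw
      have h1 : ‖y‖ ≤ ‖A‖ * (‖z‖ + ‖w‖) := by
        calc ‖y‖ = ‖A (z - w)‖ := by rw [hw, sub_sub_cancel, hA]
          _ ≤ ‖A‖ * ‖z - w‖ := A.le_opNorm _
          _ ≤ _ := by gcongr; exact norm_sub_le _ _
      have h2 : |y i| ≤ ‖y‖ := norm_le_pi_norm y i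
      have h3 : 0 ≤ ‖A‖ := norm_nonneg _
      have h4 : 0 ≤ ‖w‖ := norm_nonneg _
      have h5 : 0 ≤ ‖z‖ := norm_nonneg _
      have h6 : 0 ≤ ‖A‖ * (‖z‖ * ‖w‖) := by positivity
      rw [hK]
      nlinarith
  have hHd : ∀ y, ‖H y‖ ≤ C₀ * K ^ (2 * d) * ∏ i, ((1 + |y i|) ^ 2)⁻¹ := fun y => by
    set w := z - WithLp.toLp 2 (T.mulVec y) with hw
    have h1 : ∏ i, (1 + |y i|) ^ 2 ≤ (K * (1 + ‖w‖)) ^ (2 * d) := by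
      calc ∏ i, (1 + |y i|) ^ 2 ≤ ∏ _i : Fin d, (K * (1 + ‖w‖)) ^ 2 :=
            Finset.prod_le_prod (fun i _ => by positivity) fun i _ => by
              gcongr
              exact hy y i
        _ = _ := by rw [Finset.prod_const, Finset.card_univ, Fintype.card_fin, pow_mul]
    have h2 : 0 < ∏ i, (1 + |y i|) ^ 2 := Finset.prod_pos fun i _ => by positivity
    rw [Finset.prod_inv_distrib, ← div_eq_mul_inv, le_div_iff₀ h2]
    calc ‖H y‖ * ∏ i, (1 + |y i|) ^ 2 ≤ ‖H y‖ * (K * (1 + ‖w‖)) ^ (2 * d) := by gcongr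
      _ = ((1 + ‖w‖) ^ (2 * d) * ‖D.kernel m w‖) * K ^ (2 * d) := by
        rw [mul_pow]
        simp only [hH, hw]
        ring
      _ ≤ _ := by gcongr; exact hdec w
  have hchange : ∀ F : (Fin d → ℝ) → ℂ, Continuous F →
      ∫ y, F y * H y = n * ∫ w : EuclideanSpace ℝ (Fin d),
        F (T⁻¹.mulVec (WithLp.ofLp (z - w))) * D.kernel m w := fun F hF => by
    have h1 := integral_comp_generator hd hn
      (fun w => F (T⁻¹.mulVec w) * D.kernel m (z - WithLp.toLp 2 w))
      ((hF.comp hTi).mul ((D.kernel m).continuous.comp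
        (continuous_const.sub (PiLp.continuous_toLp 2 _))))
    have h2 : ∀ y, T⁻¹.mulVec (T.mulVec y) = y := hA
    rw [← hT] at h1
    simp_rw [h2] at h1
    rw [h1]
    congr 1
    rw [← integral_euclideanSpace
      (fun w => F (T⁻¹.mulVec (WithLp.ofLp w)) * D.kernel m (z - w)),
      ← integral_sub_left_eq_self (fun w : EuclideanSpace ℝ (Fin d) =>
        F (T⁻¹.mulVec (WithLp.ofLp w)) * D.kernel m (z - w)) volume z]
    simp_rw [sub_sub_cancel]
  have h0 : ∀ l : Fin d → ℤ, l ≠ 0 → ∫ y, Complex.exp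
      (-(2 * Real.pi * Complex.I * ((∑ i, l i * y i : ℝ) : ℂ))) * H y = 0 := fun l hl => by
    rw [hchange (fun y => Complex.exp (-(2 * Real.pi * Complex.I * ((∑ i, l i * y i : ℝ) : ℂ))))
      (by fun_prop)]
    set ξ : Fin d → ℝ := (T⁻¹.transpose).mulVec (fun j => (l j : ℝ)) with hξ
    have h1 : ∀ w : Fin d → ℝ, ∑ i, (l i : ℝ) * T⁻¹.mulVec w i = ∑ i, ξ i * w i := fun w => by
      change (fun i => (l i : ℝ)) ⬝ᵥ T⁻¹.mulVec w = ξ ⬝ᵥ w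
      rw [hξ, Matrix.dotProduct_mulVec, Matrix.mulVec_transpose]
    simp_rw [h1]
    have h2 : ∀ w : EuclideanSpace ℝ (Fin d),
        Complex.exp (-(2 * Real.pi * Complex.I * ((∑ i, ξ i * (z - w) i : ℝ) : ℂ))) * D.kernel m w
        = Complex.exp (-(2 * Real.pi * Complex.I * ((∑ i, ξ i * z i : ℝ) : ℂ)))
          * (Complex.exp (((-2 * Real.pi * inner ℝ w (-WithLp.toLp 2 ξ) : ℝ) : ℂ) * Complex.I)
            • D.kernel m w) := fun w => by
      rw [smul_eq_mul, ← mul_assoc, ← Complex.exp_add]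
      congr 2
      have h3 : inner ℝ w (-WithLp.toLp 2 ξ : EuclideanSpace ℝ (Fin d)) = -∑ i, ξ i * w i := by
        rw [inner_neg_right, PiLp.inner_apply]
        rfl
      rw [h3]
      simp only [PiLp.sub_apply, mul_sub, Finset.sum_sub_distrib]
      push_cast
      ring
    simp_rw [h2]
    rw [integral_const_mul]
    have h4 : ∫ w : EuclideanSpace ℝ (Fin d),
        Complex.exp (((-2 * Real.pi * inner ℝ w (-WithLp.toLp 2 ξ) : ℝ) : ℂ) * Complex.I)
          • D.kernel m w = 𝓕 (D.kernel m) (-WithLp.toLp 2 ξ) := by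
      rw [SchwartzMap.fourier_coe, Real.fourier_eq']
    rw [h4, fourier_kernel_apply]
    -- If ξ lay in the box |ξ_i| ≤ R 2^{m_i}, then ∏|ξ_i| ≤ R^d 2^{|m|₁} < cn, against the bound for
    -- the dual lattice.
    have h5 : ∃ i, D.mult (m i) (ξ i) = 0 := by
      by_contra hne
      push Not at hne
      have h6 : ∀ i, |ξ i| ≤ R * 2 ^ m i := fun i => by
        by_contra hlt
        exact hne i (hsupp _ _ (not_le.1 hlt))
      have h7 : ∏ i, |ξ i| ≤ R ^ d * 2 ^ ∑ i, m i := by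
        calc ∏ i, |ξ i| ≤ ∏ i, (R * 2 ^ m i) :=
              Finset.prod_le_prod (fun i _ => abs_nonneg _) fun i _ => h6 i
          _ = _ := by
            rw [Finset.prod_mul_distrib, Finset.prod_const, Finset.card_univ, Fintype.card_fin,
              Finset.prod_pow_eq_pow_sum]
      linarith [hdual n hn l hl]
    obtain ⟨i, hi⟩ := h5
    rw [Finset.prod_eq_zero (Finset.mem_univ i) (by simpa using hi), mul_zero, mul_zero]
  have hP := tsum_eq_integral_of_fourier_eq_zero (by positivity) hHc hHd h0
  have h8 := hchange (fun _ => 1) continuous_const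
  simp only [one_mul] at h8
  rw [h8] at hP
  exact hP

/-- Exactness for the translates of the kernel is integrated against g; both sides become n · ∫
kernel · ∫ g. -/
theorem tsum_synth_lattice (hd : 1 ≤ d) {R c : ℝ}
    (hsupp : ∀ j ξ, R * 2 ^ j < |ξ| → D.mult j ξ = 0)
    (hdual : ∀ n : ℕ, 1 ≤ n → ∀ k : Fin d → ℤ, k ≠ 0 →
      c * n ≤ ∏ i, |((frolovGenerator d n)⁻¹.transpose).mulVec (fun j => (k j : ℝ)) i|)
    {n : ℕ} (hn : 1 ≤ n) {m : Fin d → ℕ} (hm : R ^ d * 2 ^ (∑ i, m i) < c * n)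
    (hg : Continuous g) (hB : ∀ z, z ∉ centeredBox d B → g z = 0) :
    ∑' k : Fin d → ℤ, D.synth m g (latticePoint d n k) = n * ∫ x, D.synth m g x := by
  have hgi := integrable_of_eq_zero_off_box hg hB
  have hmeas : ∀ x, AEStronglyMeasurable fun z => D.kernel m (z - x) * g z := fun x =>
    (((D.kernel m).continuous.comp (continuous_id.sub continuous_const)).mul
      hg).aestronglyMeasurable
  have h1 : ∑' k : Fin d → ℤ, D.synth m g (latticePoint d n k)
      = n * ((∫ x, D.kernel m x) * ∫ z, g z) := by
    unfold synth
    rw [← integral_tsum (fun k => hmeas _)]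
    · simp_rw [tsum_mul_right, D.tsum_kernel_lattice hd hsupp hdual hn hm]
      rw [integral_const_mul, mul_assoc]
    -- The lattice estimate with p = 1 supplies the absolute convergence for exchanging sum and
    -- integral.
    · obtain ⟨C, hC, h⟩ := D.exists_tsum_lattice_le hd le_rfl B
      have h2 := h n hn m g hg hB
      refine (lt_of_le_of_lt ?_ (lt_of_le_of_lt h2 (ENNReal.mul_lt_top
        (memLp_one_iff_integrable.2 hgi).2 ENNReal.ofReal_lt_top))).ne
      refine ENNReal.tsum_le_tsum fun k => le_of_eq (lintegral_congr fun z => ?_)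
      rw [enorm_mul, mul_comm]
  have hi : Integrable (Function.uncurry fun x z : EuclideanSpace ℝ (Fin d) =>
      D.kernel m (z - x) * g z) (volume.prod volume) := by
    refine ⟨?_, ?_⟩
    · have h4 : Continuous fun z : EuclideanSpace ℝ (Fin d) × EuclideanSpace ℝ (Fin d) =>
          D.kernel m (z.2 - z.1) * g z.2 :=
        ((D.kernel m).continuous.comp (continuous_snd.sub continuous_fst)).mul
          (hg.comp continuous_snd)
      exact h4.aestronglyMeasurable
    · obtain ⟨C, hC, h⟩ := D.exists_lintegral_synth_le (p := 1) le_rfl d B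
      have h4 : Continuous fun z : EuclideanSpace ℝ (Fin d) × EuclideanSpace ℝ (Fin d) =>
          D.kernel m (z.2 - z.1) * g z.2 :=
        ((D.kernel m).continuous.comp (continuous_snd.sub continuous_fst)).mul
          (hg.comp continuous_snd)
      rw [hasFiniteIntegral_iff_enorm]
      refine lt_of_le_of_lt (le_of_eq (lintegral_prod _ h4.enorm.measurable.aemeasurable)) ?_
      refine lt_of_le_of_lt ?_ (lt_of_le_of_lt (h m g hg hB) (ENNReal.mul_lt_top
        (memLp_one_iff_integrable.2 hgi).2 ENNReal.ofReal_lt_top))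
      refine lintegral_mono fun x => le_of_eq (lintegral_congr fun z => ?_)
      rw [Function.uncurry_apply_pair, enorm_mul, mul_comm]
  rw [h1]
  congr 1
  unfold synth
  rw [integral_integral_swap hi]
  simp_rw [integral_mul_const, integral_sub_left_eq_self (fun x => D.kernel m x) volume]
  rw [integral_const_mul]

end DualMeans


/-! ### Supports -/

open scoped Manifold in
/-- A distribution vanishes on the test functions with compact support off its support. -/
theorem apply_eq_zero_of_tsupport_subset {E : Type*} [NormedAddCommGroup E] [NormedSpace ℝ E]
    [FiniteDimensional ℝ E] (u : 𝓢'(E, ℂ)) (φ : 𝓢(E, ℂ)) (hφ : HasCompactSupport φ)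
    (hsub : tsupport φ ⊆ (Distribution.dsupport u)ᶜ) : u φ = 0 := by
  have hloc : ∀ x ∈ tsupport φ, ∃ s : Set E, Distribution.IsVanishingOn u s ∧ IsOpen s ∧ x ∈ s :=
    fun x hx => (Distribution.notMem_dsupport_iff x).1 (hsub hx)
  choose! U hU hUo hxU using hloc
  obtain ⟨t, ht, hcov⟩ := hφ.elim_nhds_subcover U
    fun x hx => (hUo x hx).mem_nhds (hxU x hx)
  -- A partition of unity splits φ into finitely many test functions, each supported in one of the
  -- open sets on which u vanishes.
  obtain ⟨f, hf⟩ := SmoothPartitionOfUnity.exists_isSubordinate 𝓘(ℝ, E)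
    (isClosed_tsupport φ) (fun i : t => U i) (fun i => hUo i (ht i i.2))
    (fun x hx => by
      obtain ⟨i, hi, hxi⟩ := Set.mem_iUnion₂.1 (hcov hx)
      exact Set.mem_iUnion.2 ⟨⟨i, hi⟩, hxi⟩)
  let φs : t → 𝓢(E, ℂ) := fun i =>
    HasCompactSupport.toSchwartzMap (f := fun x => ((f i x : ℝ) : ℂ) * φ x) hφ.mul_left
      ((Complex.ofRealCLM.contDiff.comp (f i).contMDiff.contDiff).mul (φ.smooth ⊤))
  have hφs : ∀ i x, φs i x = ((f i x : ℝ) : ℂ) * φ x := fun i x => rfl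
  have hsum : φ = ∑ i, φs i := by
    ext x
    rw [sum_apply]
    simp_rw [hφs]
    rw [← Finset.sum_mul]
    by_cases hx : x ∈ tsupport φ
    · have h := f.sum_eq_one hx
      rw [finsum_eq_sum_of_fintype] at h
      rw [← Complex.ofReal_sum, h, Complex.ofReal_one, one_mul]
    · rw [image_eq_zero_of_notMem_tsupport hx, mul_zero]
  rw [hsum, map_sum]
  refine Finset.sum_eq_zero fun i _ => hU i (ht i i.2) _ ?_
  refine subset_trans ?_ (hf i)
  refine closure_mono fun x hx h0 => hx ?_
  change ((f i x : ℝ) : ℂ) * φ x = 0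
  rw [h0, Complex.ofReal_zero, zero_mul]

theorem LocalMeans.exists_dilated_eq_zero {L : ℕ} (Ψ : LocalMeans L) :
    ∃ R : ℝ, 0 < R ∧ ∀ j t, R < |t| → Ψ.dilated j t = 0 := by
  obtain ⟨R₀, h₀⟩ := Ψ.hasCompactSupport_ψ₀.isCompact.isBounded.subset_closedBall 0
  obtain ⟨R₁, h₁⟩ := Ψ.hasCompactSupport_ψ₁.isCompact.isBounded.subset_closedBall 0
  refine ⟨max 1 (max R₀ R₁), by positivity, fun j t ht => ?_⟩
  have ht0 := (le_max_left R₀ R₁).trans (le_max_right 1 _)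
  have ht1 := (le_max_right R₀ R₁).trans (le_max_right 1 _)
  cases j with
  | zero =>
    refine image_eq_zero_of_notMem_tsupport fun hm => ?_
    have := h₀ hm
    rw [mem_closedBall_zero_iff, Real.norm_eq_abs] at this
    linarith
  | succ j =>
    change (2 : ℂ) ^ j * Ψ.ψ₁ ((2 : ℝ) ^ j * t) = 0
    rw [image_eq_zero_of_notMem_tsupport (f := Ψ.ψ₁), mul_zero]
    intro hm
    have := h₁ hm
    rw [mem_closedBall_zero_iff, Real.norm_eq_abs, abs_mul, abs_of_pos (by positivity)] at this
    have h2 : |t| ≤ 2 ^ j * |t| := le_mul_of_one_le_left (abs_nonneg t) (one_le_pow₀ one_le_two)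
    linarith

/-- The dilations by 2^j only shrink the supports of the kernels, so a single box contains the
supports of all the local means of u. -/
theorem LocalMeans.exists_conv_eq_zero {L : ℕ} (Ψ : LocalMeans L) (d : ℕ) :
    ∃ B : ℝ, ∀ (m : Fin d → ℕ) (u : 𝓢'(EuclideanSpace ℝ (Fin d), ℂ)),
      Distribution.dsupport u ⊆ unitCube d →
        ∀ x, x ∉ DualMeans.centeredBox d B → Ψ.conv m u x = 0 := by
  obtain ⟨R, hR, h⟩ := Ψ.exists_dilated_eq_zero
  refine ⟨R + 2, fun m u hu x hx => ?_⟩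
  obtain ⟨i, hi⟩ := not_forall.1 hx
  have hi' : R + 2 < |x i| := by
    by_contra hle
    exact hi (abs_le.1 (not_lt.1 hle))
  refine apply_eq_zero_of_tsupport_subset u _ ?_ fun y hy hyu => ?_
  · exact (Ψ.hasCompactSupport_tensor m).comp_homeomorph (Homeomorph.subLeft x)
  · have hcl : IsClosed {y : EuclideanSpace ℝ (Fin d) | |x i - y i| ≤ R} :=
      isClosed_le (by fun_prop) continuous_const
    have hsub : tsupport (Ψ.shifted m x) ⊆ {y : EuclideanSpace ℝ (Fin d) | |x i - y i| ≤ R} := by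
      refine closure_minimal (fun y hy => ?_) hcl
      by_contra hlt
      rw [Set.mem_ofPred_eq, not_le] at hlt
      refine hy ?_
      rw [Ψ.shifted_apply]
      exact Finset.prod_eq_zero (Finset.mem_univ i) (h _ _ hlt)
    have h1 : |x i - y i| ≤ R := hsub hy
    have h2 := hu hyu i
    have h3 : |x i| ≤ |x i - y i| + |y i| := by
      calc |x i| = |(x i - y i) + y i| := by congr 1; ring
        _ ≤ _ := abs_add_le _ _
    have h4 : |y i| ≤ 1 := abs_le.2 ⟨by linarith [h2.1], h2.2⟩
    linarith

/-- A continuous function that represents a distribution with support in the unit cube vanishes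
off the half-open cube. -/
theorem isClosed_unitCube (d : ℕ) : IsClosed (unitCube d) := by
  have : unitCube d = ⋂ i, (fun x : EuclideanSpace ℝ (Fin d) => x i) ⁻¹' Set.Icc (0 : ℝ) 1 := by
    ext x
    simp [unitCube]
  rw [this]
  exact isClosed_iInter fun i => isClosed_Icc.preimage (by fun_prop)

/-- On the open complement of the closed cube f vanishes because u does. The faces x_i = 1 are
reached from outside by continuity. Hence the half-open cube in the cubature rule loses nothing
against the full lattice. -/
theorem IsRepresentedBy.eq_zero {d : ℕ} {u : 𝓢'(EuclideanSpace ℝ (Fin d), ℂ)}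
    {f : EuclideanSpace ℝ (Fin d) →ᵇ ℂ} (hf : IsRepresentedBy u f)
    (hu : Distribution.dsupport u ⊆ unitCube d) {x : EuclideanSpace ℝ (Fin d)}
    (hx : x ∉ unitCubeHalfOpen d) : f x = 0 := by
  have hcl := isClosed_unitCube d
  have hae : ∀ᵐ x, x ∈ (unitCube d)ᶜ → f x = 0 := by
    refine hcl.isOpen_compl.ae_eq_zero_of_integral_contDiff_smul_eq_zero
      (f.continuous.locallyIntegrable.locallyIntegrableOn _) fun g hg hgs hgsub => ?_
    have hgc : HasCompactSupport fun x => (g x : ℂ) := hgs.comp_left Complex.ofReal_zero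
    let φ : 𝓢(EuclideanSpace ℝ (Fin d), ℂ) :=
      hgc.toSchwartzMap (Complex.ofRealCLM.contDiff.comp hg)
    have h1 : u φ = 0 := by
      refine apply_eq_zero_of_tsupport_subset u φ hgc ?_
      have hsub : tsupport φ ⊆ tsupport g := closure_mono fun y hy h0 => hy (by
        change ((g y : ℝ) : ℂ) = 0
        rw [h0, Complex.ofReal_zero])
      exact hsub.trans (hgsub.trans (Set.compl_subset_compl.2 hu))
    rw [hf φ] at h1
    rw [← h1]
    rfl
  have hopen : Set.EqOn f (fun _ => 0) (unitCube d)ᶜ := by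
    refine Measure.eqOn_open_of_ae_eq (μ := volume) ?_ hcl.isOpen_compl f.continuous.continuousOn
      continuousOn_const
    exact (ae_restrict_iff' hcl.isOpen_compl.measurableSet).2 hae
  obtain ⟨i, hi⟩ := not_forall.1 hx
  by_cases hlt : x i < 0
  · exact hopen fun h => absurd (h i).1 (not_le.2 hlt)
  · have hge : 1 ≤ x i := by
      by_contra h
      exact hi ⟨not_lt.1 hlt, not_le.1 h⟩
    have hlim : Filter.Tendsto (fun t : ℝ => f (x + t • EuclideanSpace.single i (1 : ℝ)))
        (nhdsWithin 0 (Set.Ioi 0)) (nhds (f x)) := by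
      have hc : Continuous fun t : ℝ => f (x + t • EuclideanSpace.single i (1 : ℝ)) :=
        f.continuous.comp (by fun_prop)
      simpa using (hc.tendsto 0).mono_left nhdsWithin_le_nhds
    refine tendsto_nhds_unique hlim (tendsto_const_nhds.congr' ?_)
    filter_upwards [self_mem_nhdsWithin] with t ht
    refine (hopen fun h => ?_).symm
    have h2 := (h i).2
    have h3 : (x + t • EuclideanSpace.single i (1 : ℝ)) i = x i + t := by simp
    rw [h3] at h2
    have : 0 < t := ht
    linarith

/-! ### Representation by a continuous function -/

namespace DualMeans

variable {L : ℕ} {Ψ : LocalMeans L} (D : DualMeans Ψ) {d : ℕ}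

theorem besovNorm_eq_ellNorm (p θ : ℝ≥0∞) (s : ℝ) (u : 𝓢'(EuclideanSpace ℝ (Fin d), ℂ)) :
    Ψ.besovNorm p θ s u = ellNorm θ (Ψ.besovTerm p s u) := rfl

theorem eLpNorm_conv_mul (p : ℝ≥0∞) (s q : ℝ) (u : 𝓢'(EuclideanSpace ℝ (Fin d), ℂ))
    (m : Fin d → ℕ) :
    eLpNorm (Ψ.conv m u) p volume * ENNReal.ofReal ((2 ^ ∑ i, m i) ^ q)
      = Ψ.besovTerm p s u m * ENNReal.ofReal (((2 : ℝ) ^ (-(s - q))) ^ ∑ i, m i) := by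
  rw [LocalMeans.besovTerm, mul_comm (ENNReal.ofReal _) (eLpNorm _ _ _), mul_assoc,
    ← ENNReal.ofReal_mul (by positivity)]
  congr 2
  rw [← Real.rpow_natCast, ← Real.rpow_natCast, ← Real.rpow_mul two_pos.le,
    ← Real.rpow_mul two_pos.le, ← Real.rpow_add two_pos]
  congr 1
  push_cast
  ring

theorem tsum_besovTerm_lt_top (hd : 1 ≤ d) {p θ : ℝ≥0∞} (hθ : 1 ≤ θ) {s : ℝ}
    (hs : (p⁻¹).toReal < s) {u : 𝓢'(EuclideanSpace ℝ (Fin d), ℂ)}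
    (hu : Ψ.besovNorm p θ s u < ⊤) :
    ∑' m, Ψ.besovTerm p s u m
      * ENNReal.ofReal (((2 : ℝ) ^ (-(s - (p⁻¹).toReal))) ^ ∑ i, m i) < ⊤ := by
  obtain ⟨C, hC, h⟩ := exists_weighted_tail_le hd (r := (2 : ℝ) ^ (-(s - (p⁻¹).toReal)))
    (by positivity) (Real.rpow_lt_one_of_one_lt_of_neg one_lt_two (by linarith)) hθ
  have h0 := h 0 (Ψ.besovTerm p s u)
  simp only [zero_le, if_true] at h0
  exact lt_of_le_of_lt h0 (ENNReal.mul_lt_top hu ENNReal.ofReal_lt_top)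

/-- The piece with index m has supremum O(2^{|m|₁/p} ‖Ψ_m * u‖_p), which is summable because s >
1/p. So the series converges uniformly to a bounded continuous function, and the reproducing formula
identifies it with u. -/
theorem exists_hasSum_synth (hd : 1 ≤ d) {p θ : ℝ≥0∞} (hp : 1 ≤ p) (hθ : 1 ≤ θ) {s : ℝ}
    (hs : (p⁻¹).toReal < s) {u : 𝓢'(EuclideanSpace ℝ (Fin d), ℂ)}
    (hu : u ∈ Ψ.besovCube d p θ s) :
    ∃ f : EuclideanSpace ℝ (Fin d) →ᵇ ℂ, IsRepresentedBy u f ∧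
      ∀ x, f x = ∑' m, D.synth m (Ψ.conv m u) x := by
  obtain ⟨B, hB⟩ := Ψ.exists_conv_eq_zero d
  obtain ⟨C, hC, hsup⟩ := D.exists_enorm_synth_le (d := d) hp
  have hg : ∀ m, Continuous (Ψ.conv m u) := fun m => Ψ.continuous_conv m u
  have hgB : ∀ m z, z ∉ centeredBox d B → Ψ.conv m u z = 0 := fun m => hB m u hu.2
  set b : (Fin d → ℕ) → ℝ≥0∞ := fun m => ENNReal.ofReal C * (Ψ.besovTerm p s u m
    * ENNReal.ofReal (((2 : ℝ) ^ (-(s - (p⁻¹).toReal))) ^ ∑ i, m i)) with hb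
  have hbtop : ∑' m, b m ≠ ⊤ := by
    rw [hb, ENNReal.tsum_mul_left]
    exact (ENNReal.mul_lt_top ENNReal.ofReal_lt_top (tsum_besovTerm_lt_top hd hθ hs hu.1)).ne
  have hbs : Summable fun m => (b m).toReal := ENNReal.summable_toReal hbtop
  have hle : ∀ m x, ‖D.synth m (Ψ.conv m u) x‖ ≤ (b m).toReal := fun m x => by
    have h1 := hsup m (Ψ.conv m u) (hg m) x
    rw [ENNReal.ofReal_mul hC.le, mul_left_comm, eLpNorm_conv_mul p s] at h1
    rw [← toReal_enorm]
    exact ENNReal.toReal_mono (ENNReal.ne_top_of_tsum_ne_top hbtop m) h1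
  have hc : ∀ m, Continuous (D.synth m (Ψ.conv m u)) := fun m => D.continuous_synth (hg m) (hgB m) m
  refine ⟨BoundedContinuousFunction.ofNormedAddCommGroup
    (fun x => ∑' m, D.synth m (Ψ.conv m u) x) (continuous_tsum hc hbs hle) (∑' m, (b m).toReal)
    (fun x => tsum_of_norm_bounded hbs.hasSum fun m => hle m x), fun φ => ?_, fun x => rfl⟩
  -- The reproducing formula is a limit along cubes of multi-indices. These exhaust all finite sets,
  -- so the limit is the unconditional sum.
  have hbox : Filter.Tendsto (fun N : ℕ => Fintype.piFinset fun _ : Fin d => Finset.range (N + 1))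
      Filter.atTop Filter.atTop := by
    refine Filter.tendsto_atTop_finset_of_monotone (fun N N' hN => ?_) fun m => ?_
    · exact Fintype.piFinset_subset _ _ fun _ => Finset.range_mono (by omega)
    · refine ⟨∑ i, m i, Fintype.mem_piFinset.2 fun i => Finset.mem_range.2 (Nat.lt_succ_of_le ?_)⟩
      exact Finset.single_le_sum (f := m) (fun _ _ => Nat.zero_le _) (Finset.mem_univ i)
  have hint : ∀ m, Integrable fun x => φ x * D.synth m (Ψ.conv m u) x := fun m =>
    ((φ.integrable (μ := volume)).norm.mul_const (b m).toReal).mono'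
      (φ.continuous.mul (hc m)).aestronglyMeasurable
      (Filter.Eventually.of_forall fun x => by
        rw [norm_mul]
        exact mul_le_mul_of_nonneg_left (hle m x) (norm_nonneg _))
  have hsum := hasSum_integral_of_summable_integral_norm hint (by
    refine Summable.of_nonneg_of_le (fun m => integral_nonneg fun x => norm_nonneg _) (fun m => ?_)
      (hbs.mul_left (∫ x, ‖φ x‖))
    rw [← integral_mul_const]
    refine integral_mono (hint m).norm ((φ.integrable (μ := volume)).norm.mul_const _) fun x => ?_
    simp only
    rw [norm_mul]
    exact mul_le_mul_of_nonneg_left (hle m x) (norm_nonneg _))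
  have h1 := hsum.comp hbox
  have h2 := D.tendsto_sum_integral_conv u φ
  simp_rw [fun m => D.integral_sconv_kernel (hg m) (hgB m) m φ] at h2
  have h3 := tendsto_nhds_unique h2 h1
  rw [h3]
  refine integral_congr_ae (Filter.Eventually.of_forall fun x => ?_)
  simp only [tsum_mul_left]
  rfl

end DualMeans


/-! ### The cubature rule as a sum over the whole lattice -/

theorem latticePoint_injective {d n : ℕ} (hd : 1 ≤ d) (hn : 1 ≤ n) :
    Function.Injective (latticePoint d n) := by
  intro k k' h
  have hunit : IsUnit (frolovGenerator d n).det := by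
    rw [det_frolovGenerator hd hn]
    have hn' : (0 : ℝ) < n := by exact_mod_cast hn
    exact (inv_ne_zero hn'.ne').isUnit
  have h1 : (frolovGenerator d n).mulVec (fun i => (k i : ℝ))
      = (frolovGenerator d n).mulVec fun i => (k' i : ℝ) := congrArg WithLp.ofLp h
  have h2 := Matrix.mulVec_injective_iff_isUnit.2
    ((Matrix.isUnit_iff_isUnit_det _).2 hunit) h1
  funext i
  exact_mod_cast congrFun h2 i

theorem finite_latticePoint_mem_cube {d n : ℕ} (hd : 1 ≤ d) (hn : 1 ≤ n) :
    {k : Fin d → ℤ | latticePoint d n k ∈ unitCubeHalfOpen d}.Finite := by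
  obtain ⟨C, hC, h⟩ := exists_card_box_le hd
  by_contra hinf
  obtain ⟨N, hN⟩ := exists_nat_gt (1 + C * n * ∏ _i : Fin d, (1 : ℝ))
  obtain ⟨S, hS, hcard⟩ := Set.Infinite.exists_subset_card_eq hinf N
  have := h n hn (fun _ => 0) (fun _ => 1) (fun _ => one_pos) S fun k hk i => by
    rw [zero_add]
    exact hS hk i
  rw [hcard] at this
  linarith

theorem frolovRule_eq_tsum {d n : ℕ} (hd : 1 ≤ d) (hn : 1 ≤ n)
    {f : EuclideanSpace ℝ (Fin d) → ℂ} (hf : ∀ x, x ∉ unitCubeHalfOpen d → f x = 0) :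
    frolovRule d n f = (1 / (n : ℂ)) * ∑' k, f (latticePoint d n k) := by
  rw [frolovRule]
  congr 1
  have h1 : (frolovLattice d n ∩ unitCubeHalfOpen d) ∩ Function.support f
      = frolovLattice d n ∩ Function.support f := by
    ext x
    constructor
    · exact fun hx => ⟨hx.1.1, hx.2⟩
    · exact fun hx => ⟨⟨hx.1, by_contra fun h => hx.2 (hf x h)⟩, hx.2⟩
  rw [← finsum_mem_inter_support, h1, finsum_mem_inter_support, tsum_eq_finsum]
  · exact finsum_mem_range (latticePoint_injective hd hn)
  · refine (finite_latticePoint_mem_cube hd hn).subset fun k hk => ?_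
    by_contra h
    exact hk (hf _ h)

theorem integral_unitCube_eq {d : ℕ} {f : EuclideanSpace ℝ (Fin d) → ℂ}
    (hf : ∀ x, x ∉ unitCubeHalfOpen d → f x = 0) : ∫ x in unitCube d, f x = ∫ x, f x :=
  setIntegral_eq_integral_of_forall_compl_eq_zero fun x hx =>
    hf x fun h => hx fun i => ⟨(h i).1, (h i).2.le⟩

/-- M is the least exponent with 2^M ≥ an. Minimality gives exactness below M in the upper bound and
2^M ≤ 2an in the lower bound. -/
theorem exists_level {a : ℝ} (ha : 0 < a) :
    ∃ C : ℝ, 0 < C ∧ ∀ n : ℕ, 2 ≤ n → ∃ M : ℕ, (∀ l < M, (2 : ℝ) ^ l < a * n) ∧ a * n ≤ 2 ^ M ∧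
      (M : ℝ) + 1 ≤ C * Real.log n := by
  have hl2 : 0 < Real.log 2 := Real.log_pos one_lt_two
  refine ⟨(2 + |Real.log a| / Real.log 2) / Real.log 2 + 1 / Real.log 2, by positivity,
    fun n hn => ?_⟩
  have hn' : (2 : ℝ) ≤ n := by exact_mod_cast hn
  have hlog : Real.log 2 ≤ Real.log n := Real.log_le_log two_pos hn'
  have hex : ∃ M : ℕ, a * n ≤ 2 ^ M := by
    obtain ⟨M, hM⟩ := pow_unbounded_of_one_lt (a * n) one_lt_two
    exact ⟨M, hM.le⟩
  classical
  refine ⟨Nat.find hex, fun l hl => not_le.1 (Nat.find_min hex hl), Nat.find_spec hex, ?_⟩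
  have h1 : (2 + |Real.log a| / Real.log 2) ≤
      (2 + |Real.log a| / Real.log 2) / Real.log 2 * Real.log n := by
    rw [div_mul_eq_mul_div, le_div_iff₀ hl2]
    gcongr
  rcases Nat.eq_zero_or_pos (Nat.find hex) with h0 | h0
  · rw [h0, add_mul]
    have : 0 ≤ |Real.log a| / Real.log 2 := by positivity
    have h2 : 0 ≤ 1 / Real.log 2 * Real.log n := by positivity
    push_cast
    linarith
  · obtain ⟨k, hk⟩ := Nat.exists_eq_succ_of_ne_zero h0.ne'
    have h2 : (2 : ℝ) ^ k < a * n := not_le.1 (Nat.find_min hex (by omega))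
    have h3 : (k : ℝ) * Real.log 2 ≤ Real.log a + Real.log n := by
      rw [← Real.log_pow, ← Real.log_mul ha.ne' (by positivity)]
      exact Real.log_le_log (by positivity) h2.le
    have h4 : (k : ℝ) ≤ |Real.log a| / Real.log 2 + 1 / Real.log 2 * Real.log n := by
      rw [div_mul_eq_mul_div, one_mul, ← add_div, le_div_iff₀ hl2]
      linarith [le_abs_self (Real.log a)]
    rw [hk, add_mul]
    push_cast
    linarith

/-! ### The upper bound -/

namespace DualMeans

variable {L : ℕ} {Ψ : LocalMeans L} (D : DualMeans Ψ) {d : ℕ}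

/-- The condition n ≤ κ2^{|m|₁} turns (2^{|m|₁} + n)/n into a multiple of 2^{|m|₁}/n. As this
multiple is at least 1, the integral obeys the same bound as the lattice sum. The parameter κ stays
free because the upper bound uses two values of it. -/
theorem exists_synth_error_le (hd : 1 ≤ d) {p : ℝ≥0∞} (hp : 1 ≤ p) (B : ℝ) :
    ∃ C : ℝ, 0 < C ∧ ∀ n : ℕ, 1 ≤ n → ∀ κ : ℝ, 0 ≤ κ → ∀ (m : Fin d → ℕ)
      (g : EuclideanSpace ℝ (Fin d) → ℂ), Continuous g →
      (∀ z, z ∉ centeredBox d B → g z = 0) → (n : ℝ) ≤ κ * 2 ^ (∑ i, m i) →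
      (∫⁻ x, ‖D.synth m g x‖ₑ)
          + ENNReal.ofReal (n : ℝ)⁻¹ * ∑' k, ‖D.synth m g (latticePoint d n k)‖ₑ
        ≤ ENNReal.ofReal (C * ((1 + κ) / n) ^ (p⁻¹).toReal)
          * (eLpNorm g p volume * ENNReal.ofReal ((2 ^ ∑ i, m i) ^ (p⁻¹).toReal)) := by
  obtain ⟨C₁, hC₁, h₁⟩ := D.exists_lintegral_synth_le hp d B
  obtain ⟨C₂, hC₂, h₂⟩ := D.exists_tsum_lattice_le hd hp B
  refine ⟨C₁ + C₂, by positivity, fun n hn κ hκ m g hg hB hκn => ?_⟩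
  set q := (p⁻¹).toReal with hq
  have hq0 : 0 ≤ q := ENNReal.toReal_nonneg
  have hn' : (0 : ℝ) < n := by exact_mod_cast hn
  set t : ℝ := 2 ^ ∑ i, m i with ht
  have ht0 : 0 < t := by positivity
  have hkey : (t + n) / n ≤ (1 + κ) / n * t := by
    rw [div_mul_eq_mul_div]
    gcongr
    linarith
  have h3 : ((t + n) / n) ^ q ≤ ((1 + κ) / n) ^ q * t ^ q := by
    rw [← Real.mul_rpow (by positivity) ht0.le]
    exact Real.rpow_le_rpow (by positivity) hkey hq0
  have h4 : 1 ≤ ((1 + κ) / n) ^ q * t ^ q := by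
    refine le_trans (Real.one_le_rpow ?_ hq0) h3
    rw [le_div_iff₀ hn']
    linarith
  have hA : ∫⁻ x, ‖D.synth m g x‖ₑ ≤ eLpNorm g p volume
      * ENNReal.ofReal (C₁ * (((1 + κ) / n) ^ q * t ^ q)) := by
    refine (lintegral_mono fun x => D.enorm_synth_le m x).trans ((h₁ m g hg hB).trans ?_)
    gcongr
    exact le_mul_of_one_le_right hC₁.le h4
  have hS : ENNReal.ofReal (n : ℝ)⁻¹ * ∑' k, ‖D.synth m g (latticePoint d n k)‖ₑ
      ≤ eLpNorm g p volume * ENNReal.ofReal (C₂ * (((1 + κ) / n) ^ q * t ^ q)) := by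
    calc _ ≤ ENNReal.ofReal (n : ℝ)⁻¹ * (eLpNorm g p volume
          * ENNReal.ofReal (C₂ * n * ((t + n) / n) ^ q)) := by
          gcongr
          exact (ENNReal.tsum_le_tsum fun k => D.enorm_synth_le m _).trans (h₂ n hn m g hg hB)
      _ = eLpNorm g p volume * ENNReal.ofReal (C₂ * ((t + n) / n) ^ q) := by
          rw [mul_left_comm, ← ENNReal.ofReal_mul (by positivity)]
          congr 2
          field_simp
      _ ≤ _ := by gcongr
  refine (add_le_add hA hS).trans (le_of_eq ?_)
  rw [← mul_add, ← ENNReal.ofReal_add (by positivity) (by positivity),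
    mul_left_comm (ENNReal.ofReal _) (eLpNorm _ _ _), ← ENNReal.ofReal_mul (by positivity)]
  congr 2
  ring

end DualMeans

theorem exists_worstCaseError_le {d : ℕ} (hd : 1 ≤ d) {p θ : ℝ≥0∞} (hp : 1 ≤ p) (hθ : 1 ≤ θ)
    {s : ℝ} (hs : (p⁻¹).toReal < s) {L : ℕ} (Ψ : LocalMeans L) :
    ∃ C : ℝ, 0 < C ∧ ∀ n : ℕ, 2 ≤ n → worstCaseError Ψ d p θ s n ≤ ENNReal.ofReal
      (C * ((n : ℝ) ^ (-s) * Real.log n ^ (((d : ℝ) - 1) * (1 - (θ⁻¹).toReal)))) := by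
  obtain ⟨D⟩ := nonempty_dualMeans Ψ
  obtain ⟨B, hB⟩ := Ψ.exists_conv_eq_zero d
  obtain ⟨R, hR, hsupp⟩ := D.exists_mult_eq_zero
  obtain ⟨c, hc, hdual⟩ := exists_prod_dual_lower hd
  obtain ⟨C₁, hC₁, hterm⟩ := D.exists_synth_error_le hd hp B
  have hr1 : (2 : ℝ) ^ (-(s - (p⁻¹).toReal)) < 1 :=
    Real.rpow_lt_one_of_one_lt_of_neg one_lt_two (by linarith)
  obtain ⟨C₂, hC₂, htail⟩ := exists_weighted_tail_le hd
    (r := (2 : ℝ) ^ (-(s - (p⁻¹).toReal))) (by positivity) hr1 hθ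
  obtain ⟨C₃, hC₃, hlevel⟩ := exists_level (a := c / R ^ d) (by positivity)
  set q := (p⁻¹).toReal with hq
  have hq0 : 0 ≤ q := ENNReal.toReal_nonneg
  set e := ((d : ℝ) - 1) * (1 - (θ⁻¹).toReal) with he
  have he0 : 0 ≤ e := by
    refine mul_nonneg ?_ ?_
    · have : (1 : ℝ) ≤ d := by exact_mod_cast hd
      linarith
    · have : (θ⁻¹).toReal ≤ 1 := by
        rw [← ENNReal.toReal_one]
        exact ENNReal.toReal_mono (by simp) (ENNReal.inv_le_one.2 hθ)
      linarith
  set κ : ℝ := R ^ d / c with hκ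
  refine ⟨C₁ * (1 + κ) ^ q * (C₂ * ((c / R ^ d) ^ (-(s - q)) * C₃ ^ e)), by positivity,
    fun n hn => ?_⟩
  have hn1 : 1 ≤ n := by omega
  have hn' : (0 : ℝ) < n := by exact_mod_cast hn1
  have hlog : 0 < Real.log n := Real.log_pos (by exact_mod_cast hn)
  obtain ⟨M, hMlt, hMge, hMlog⟩ := hlevel n hn
  refine iSup₂_le fun u hu => ?_
  obtain ⟨hu, hnorm⟩ := hu
  obtain ⟨f, hf, hfsum⟩ := D.exists_hasSum_synth hd hp hθ hs hu
  refine (iInf₂_le f hf).trans ?_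
  have hf0 : ∀ x, x ∉ unitCubeHalfOpen d → f x = 0 := fun x hx => hf.eq_zero hu.2 hx
  rw [integral_unitCube_eq hf0, frolovRule_eq_tsum hd hn1 hf0, ofReal_norm]
  have hg : ∀ m, Continuous (Ψ.conv m u) := fun m => Ψ.continuous_conv m u
  have hgB : ∀ m z, z ∉ DualMeans.centeredBox d B → Ψ.conv m u z = 0 := fun m => hB m u hu.2
  set h : (Fin d → ℕ) → EuclideanSpace ℝ (Fin d) → ℂ := fun m => D.synth m (Ψ.conv m u) with hh
  have hhc : ∀ m, Continuous (h m) := fun m => D.continuous_synth (hg m) (hgB m) m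
  set a : (Fin d → ℕ) → ℝ≥0∞ := fun m => Ψ.besovTerm p s u m
    * ENNReal.ofReal (((2 : ℝ) ^ (-(s - q))) ^ ∑ i, m i) with ha
  set err : (Fin d → ℕ) → ℝ≥0∞ := fun m => (∫⁻ x, ‖h m x‖ₑ)
    + ENNReal.ofReal (n : ℝ)⁻¹ * ∑' k, ‖h m (latticePoint d n k)‖ₑ with herr
  have herr_le : ∀ κ' : ℝ, 0 ≤ κ' → ∀ m, (n : ℝ) ≤ κ' * 2 ^ (∑ i, m i) →
      err m ≤ ENNReal.ofReal (C₁ * ((1 + κ') / n) ^ q) * a m := fun κ' hκ' m hm => by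
    have := hterm n hn1 κ' hκ' m (Ψ.conv m u) (hg m) (hgB m) hm
    rwa [DualMeans.eLpNorm_conv_mul p s q u m] at this
  -- Only finiteness matters here, for the exchange of the sums over m and over the lattice with the
  -- integral. The crude choice κ = n covers every m.
  have htot : ∑' m, err m ≠ ⊤ := by
    refine (lt_of_le_of_lt (ENNReal.tsum_le_tsum fun m => herr_le n hn'.le m
      (le_mul_of_one_le_right hn'.le (one_le_pow₀ one_le_two))) ?_).ne
    rw [ENNReal.tsum_mul_left]
    exact ENNReal.mul_lt_top ENNReal.ofReal_lt_top
      (DualMeans.tsum_besovTerm_lt_top hd hθ hs hu.1)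
  have htotI : ∑' m, ∫⁻ x, ‖h m x‖ₑ ≠ ⊤ :=
    ne_top_of_le_ne_top htot (ENNReal.tsum_le_tsum fun m => le_self_add)
  have htotS : ∑' m, ∑' k, ‖h m (latticePoint d n k)‖ₑ ≠ ⊤ := by
    have h1 : ENNReal.ofReal (n : ℝ)⁻¹ * ∑' m, ∑' k, ‖h m (latticePoint d n k)‖ₑ ≠ ⊤ := by
      rw [← ENNReal.tsum_mul_left]
      exact ne_top_of_le_ne_top htot (ENNReal.tsum_le_tsum fun m => le_add_self)
    intro h2
    rw [h2, ENNReal.mul_top (by simp; omega)] at h1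
    exact h1 rfl
  have hhi : ∀ m, Integrable (h m) := fun m =>
    ⟨(hhc m).aestronglyMeasurable,
      (ENNReal.ne_top_of_tsum_ne_top htotI m).lt_top⟩
  have hI : HasSum (fun m => ∫ x, h m x) (∫ x, f x) := by
    have h1 := hasSum_integral_of_summable_integral_norm hhi (by
      refine (ENNReal.summable_toReal htotI).congr fun m => ?_
      rw [integral_norm_eq_lintegral_enorm (hhc m).aestronglyMeasurable])
    rwa [← integral_congr_ae (Filter.Eventually.of_forall hfsum)] at h1
  have hsumm : Summable (Function.uncurry fun (m : Fin d → ℕ) (k : Fin d → ℤ) =>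
      h m (latticePoint d n k)) := by
    refine Summable.of_norm ?_
    have h1 : ∑' mk : (Fin d → ℕ) × (Fin d → ℤ), ‖h mk.1 (latticePoint d n mk.2)‖ₑ ≠ ⊤ := by
      rw [ENNReal.tsum_prod (f := fun m k => ‖h m (latticePoint d n k)‖ₑ)]
      exact htotS
    refine (ENNReal.summable_toReal h1).congr fun mk => ?_
    rw [toReal_enorm]
    rfl
  have hS : ∑' k, f (latticePoint d n k) = ∑' m, ∑' k, h m (latticePoint d n k) := by
    rw [← hsumm.tsum_comm]
    exact tsum_congr fun k => hfsum _
  have hSs : Summable fun m => ∑' k, h m (latticePoint d n k) := hsumm.prod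
  rw [hS, ← hI.tsum_eq, ← tsum_mul_left, ← hI.summable.tsum_sub (hSs.mul_left _)]
  refine enorm_tsum_le_tsum_enorm.trans ?_
  -- For |m|₁ ≥ M the integral and the lattice sum are bounded separately, with κ = R^d/c
  -- independent of n. For |m|₁ < M the rule is exact.
  have hpt : ∀ m, ‖(∫ x, h m x) - 1 / (n : ℂ) * ∑' k, h m (latticePoint d n k)‖ₑ
      ≤ ENNReal.ofReal (C₁ * ((1 + κ) / n) ^ q) * (Ψ.besovTerm p s u m
        * (if M ≤ ∑ i, m i then ENNReal.ofReal (((2 : ℝ) ^ (-(s - q))) ^ ∑ i, m i) else 0)) :=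
    fun m => by
      split_ifs with hm
      · refine le_trans ?_ (herr_le κ (by positivity) m ?_)
        · refine (enorm_sub_le).trans (add_le_add (enorm_integral_le_lintegral_enorm _) ?_)
          rw [enorm_mul]
          refine mul_le_mul' (le_of_eq ?_) enorm_tsum_le_tsum_enorm
          rw [← ofReal_norm, norm_div, norm_one, Complex.norm_natCast, one_div]
        · have h1 : (2 : ℝ) ^ M ≤ 2 ^ ∑ i, m i := pow_le_pow_right₀ one_le_two hm
          have h2 := hMge.trans h1
          rw [hκ, div_mul_eq_mul_div, le_div_iff₀ hc]
          rw [div_mul_eq_mul_div, div_le_iff₀ (by positivity)] at h2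
          linarith
      · have h1 : R ^ d * 2 ^ (∑ i, m i) < c * n := by
          have h2 := hMlt _ (not_le.1 hm)
          rw [div_mul_eq_mul_div, lt_div_iff₀ (by positivity)] at h2
          linarith
        have h2 := D.tsum_synth_lattice hd hsupp hdual hn1 h1 (hg m) (hgB m)
        have h3 : (n : ℂ) ≠ 0 := by exact_mod_cast hn'.ne'
        simp only [hh]
        rw [h2, ← mul_assoc, one_div, inv_mul_cancel₀ h3, one_mul, sub_self, enorm_zero]
        exact zero_le
  refine (ENNReal.tsum_le_tsum hpt).trans ?_
  rw [ENNReal.tsum_mul_left]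
  calc _ ≤ ENNReal.ofReal (C₁ * ((1 + κ) / n) ^ q) * (1
        * ENNReal.ofReal (C₂ * (((2 : ℝ) ^ (-(s - q))) ^ M * ((M : ℝ) + 1) ^ e))) := by
        gcongr
        exact (htail M _).trans (mul_le_mul_left hnorm _)
    _ ≤ _ := by
        rw [one_mul, ← ENNReal.ofReal_mul (by positivity)]
        refine ENNReal.ofReal_le_ofReal ?_
        have h1 : ((2 : ℝ) ^ (-(s - q))) ^ M ≤ (c / R ^ d) ^ (-(s - q)) * (n : ℝ) ^ (-(s - q)) := by
          rw [← Real.rpow_natCast, ← Real.rpow_mul two_pos.le, mul_comm, Real.rpow_mul two_pos.le,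
            Real.rpow_natCast, ← Real.mul_rpow (by positivity) hn'.le]
          exact Real.rpow_le_rpow_of_nonpos (by positivity) hMge (by linarith)
        have h2 : ((M : ℝ) + 1) ^ e ≤ C₃ ^ e * Real.log n ^ e := by
          rw [← Real.mul_rpow hC₃.le hlog.le]
          exact Real.rpow_le_rpow (by positivity) hMlog he0
        have h3 : ((1 + κ) / n) ^ q = (1 + κ) ^ q * (n : ℝ) ^ (-q) := by
          rw [Real.div_rpow (by positivity) hn'.le, Real.rpow_neg hn'.le, div_eq_mul_inv]
        have h4 : (n : ℝ) ^ (-s) = (n : ℝ) ^ (-q) * (n : ℝ) ^ (-(s - q)) := by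
          rw [← Real.rpow_add hn']
          congr 1
          ring
        rw [h3, h4]
        calc _ ≤ C₁ * ((1 + κ) ^ q * (n : ℝ) ^ (-q)) * (C₂ * (((c / R ^ d) ^ (-(s - q))
              * (n : ℝ) ^ (-(s - q))) * (C₃ ^ e * Real.log n ^ e))) := by gcongr
          _ = _ := by ring


/-! ### Local means of sums of dilated bumps in one dimension -/

/-- A smooth bump that is supported in `[1/4, 3/4]`. -/
noncomputable def unitBump : ContDiffBump (1 / 2 : ℝ) := ⟨1 / 8, 1 / 4, by norm_num, by norm_num⟩

/-- The complex-valued version of the bump. -/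
noncomputable def bump (t : ℝ) : ℂ := (unitBump t : ℂ)

theorem contDiff_bump : ContDiff ℝ ∞ bump := Complex.ofRealCLM.contDiff.comp unitBump.contDiff

theorem tsupport_bump_subset : tsupport bump ⊆ Set.Icc (1 / 4) (3 / 4) := by
  have h : tsupport bump ⊆ tsupport unitBump := closure_mono fun t ht h0 => ht (by
    rw [bump, h0, Complex.ofReal_zero])
  refine h.trans ?_
  rw [unitBump.tsupport_eq, Real.closedBall_eq_Icc]
  exact Set.Icc_subset_Icc (by norm_num [unitBump]) (by norm_num [unitBump])

theorem hasCompactSupport_bump : HasCompactSupport bump :=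
  isCompact_Icc.of_isClosed_subset isClosed_closure tsupport_bump_subset

theorem bump_eq_zero {t : ℝ} (ht : t ∉ Set.Icc (1 / 4 : ℝ) (3 / 4)) : bump t = 0 :=
  image_eq_zero_of_notMem_tsupport fun h => ht (tsupport_bump_subset h)

theorem iteratedDeriv_bump_eq_zero (N : ℕ) {t : ℝ} (ht : t ∉ Set.Icc (1 / 4 : ℝ) (3 / 4)) :
    iteratedDeriv N bump t = 0 := by
  have h : iteratedFDeriv ℝ N bump t = 0 := by
    by_contra hne
    exact ht (tsupport_bump_subset (support_iteratedFDeriv_subset N hne))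
  rw [iteratedDeriv, h]
  rfl

theorem exists_norm_iteratedDeriv_bump_le (N : ℕ) :
    ∃ S : ℝ, 0 ≤ S ∧ ∀ t, ‖iteratedDeriv N bump t‖ ≤ S := by
  obtain ⟨C, hC0, hC⟩ := exists_one_add_pow_mul_iteratedFDeriv_le
    (hasCompactSupport_bump.toSchwartzMap contDiff_bump) 0 N
  refine ⟨C, hC0, fun t => ?_⟩
  have := hC t
  rw [pow_zero, one_mul, norm_iteratedFDeriv_eq_norm_iteratedDeriv] at this
  exact this

/-- A sum of translates of the bump. -/
noncomputable def bumpSum (c : ℕ → ℂ) (K : ℕ) (x : ℝ) : ℂ :=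
  ∑ k ∈ Finset.range K, c k * bump (x - k)

theorem contDiff_bumpSum (c : ℕ → ℂ) (K : ℕ) : ContDiff ℝ ∞ (bumpSum c K) :=
  ContDiff.sum fun _ _ => contDiff_const.mul (contDiff_bump.comp (contDiff_id.sub contDiff_const))

theorem iteratedDeriv_bumpSum (c : ℕ → ℂ) (K N : ℕ) (x : ℝ) :
    iteratedDeriv N (bumpSum c K) x
      = ∑ k ∈ Finset.range K, c k * iteratedDeriv N bump (x - k) := by
  have hs : ∀ k : ℕ, ContDiff ℝ ∞ fun x : ℝ => bump (x - k) := fun k =>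
    contDiff_bump.comp (contDiff_id.sub contDiff_const)
  have h : bumpSum c K = fun x => ∑ k ∈ Finset.range K, c k * bump (x - k) := rfl
  rw [h, iteratedDeriv_fun_sum fun k _ =>
    ((contDiff_const.mul (hs k)).of_le (mod_cast le_top)).contDiffAt]
  refine Finset.sum_congr rfl fun k _ => ?_
  rw [iteratedDeriv_const_mul _ ((hs k).of_le (mod_cast le_top)).contDiffAt,
    iteratedDeriv_comp_sub_const]

/-- The integer translates of the bump have disjoint supports: at x only k = ⌊x⌋ can contribute. So
the bound depends neither on K nor on the coefficients. -/
theorem norm_iteratedDeriv_bumpSum_le {N : ℕ} {S : ℝ} (hS0 : 0 ≤ S)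
    (hS : ∀ t, ‖iteratedDeriv N bump t‖ ≤ S) {c : ℕ → ℂ} (hc : ∀ k, ‖c k‖ ≤ 1) (K : ℕ) (x : ℝ) :
    ‖iteratedDeriv N (bumpSum c K) x‖ ≤ S := by
  rw [iteratedDeriv_bumpSum]
  have hterm : ∀ k ∈ Finset.range K, ‖c k * iteratedDeriv N bump (x - k)‖
      ≤ if k = ⌊x⌋₊ then S else 0 := fun k _ => by
    split_ifs with hk
    · rw [norm_mul]
      exact (mul_le_of_le_one_left (norm_nonneg _) (hc k)).trans (hS _)
    · rw [iteratedDeriv_bump_eq_zero N, mul_zero, norm_zero]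
      intro hx
      refine hk ?_
      have hx0 : 0 ≤ x := by
        have := hx.1
        have : (0 : ℝ) ≤ k := Nat.cast_nonneg k
        linarith
      exact ((Nat.floor_eq_iff hx0).2 ⟨by linarith [hx.1], by linarith [hx.2]⟩).symm
  refine (norm_sum_le _ _).trans ((Finset.sum_le_sum hterm).trans ?_)
  rw [Finset.sum_ite_eq']
  split_ifs
  · exact le_rfl
  · exact hS0

/-- Taylor approximation at a point. -/
theorem exists_taylor_approx (N : ℕ) {S : ℝ} (G : ℝ → ℂ) (hG : ContDiff ℝ ∞ G)
    (hS : ∀ z, ‖iteratedDeriv N G z‖ ≤ S) (a : ℝ) :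
    ∃ c : ℕ → ℂ, ∀ w : ℝ, ‖G (a + w) - ∑ α ∈ Finset.range N, c α * (w : ℂ) ^ α‖ ≤ S * |w| ^ N := by
  induction N generalizing G with
  | zero => exact ⟨0, fun w => by simpa using hS (a + w)⟩
  | succ N ih =>
    have hdiff : Differentiable ℝ G := hG.differentiable (by simp)
    obtain ⟨c, hc⟩ := ih (deriv G) (contDiff_infty_iff_deriv.1 hG).2
      fun z => by rw [← iteratedDeriv_succ']; exact hS z
    have hS0 : 0 ≤ S := (norm_nonneg _).trans (hS 0)
    -- This is the antiderivative of the approximating polynomial of G′, with constant term G(a).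
    -- The mean value inequality then raises the order by one, without need for the factor 1/N!.
    refine ⟨fun α => if α = 0 then G a else c (α - 1) / α, fun w => ?_⟩
    set F : ℝ → ℂ := fun v => G (a + v)
      - ∑ α ∈ Finset.range N, c α / ((α + 1 : ℕ) : ℂ) * (v : ℂ) ^ (α + 1) with hF
    have hder : ∀ v, HasDerivAt F
        (deriv G (a + v) - ∑ α ∈ Finset.range N, c α * (v : ℂ) ^ α) v := fun v => by
      refine HasDerivAt.sub ?_ (HasDerivAt.fun_sum fun α _ => ?_)
      · exact (hdiff (a + v)).hasDerivAt.comp_const_add a v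
      · have h1 : HasDerivAt (fun v : ℝ => (v : ℂ) ^ (α + 1)) (((α + 1 : ℕ) : ℂ) * (v : ℂ) ^ α) v := by
          simpa using (Complex.ofRealCLM.hasDerivAt (x := v)).fun_pow (α + 1)
        have h2 := h1.const_mul (c α / ((α + 1 : ℕ) : ℂ))
        have h3 : ((α + 1 : ℕ) : ℂ) ≠ 0 := by exact_mod_cast Nat.succ_ne_zero α
        rwa [← mul_assoc, div_mul_cancel₀ _ h3] at h2
    have hmvt := (convex_uIcc (0 : ℝ) w).norm_image_sub_le_of_norm_hasDerivWithin_le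
      (C := S * |w| ^ N) (fun v _ => (hder v).hasDerivWithinAt) (fun v hv => by
        refine (hc v).trans ?_
        have : |v| ≤ |w| := by
          simpa using Set.abs_sub_left_of_mem_uIcc hv
        gcongr) Set.left_mem_uIcc Set.right_mem_uIcc
    have hF0 : F 0 = G a := by simp [hF]
    rw [hF0, sub_zero, Real.norm_eq_abs, mul_assoc, ← pow_succ] at hmvt
    refine le_trans (le_of_eq ?_) hmvt
    congr 1
    rw [Finset.sum_range_succ', hF]
    simp
    ring

namespace LocalMeans

variable {L : ℕ} (Ψ : LocalMeans L)

theorem integrable_pow_mul_ψ₁ (α : ℕ) : Integrable fun z : ℝ => (z : ℂ) ^ α * Ψ.ψ₁ z :=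
  ((Complex.continuous_ofReal.pow α).mul Ψ.contDiff_ψ₁.continuous).integrable_of_hasCompactSupport
    Ψ.hasCompactSupport_ψ₁.mul_left

/-- Up to a nonzero factor, the derivatives of 𝓕 ψ₁ at the origin are the moments of ψ₁. -/
theorem integral_pow_mul_ψ₁ {α : ℕ} (hα : α ≤ L) : ∫ z : ℝ, (z : ℂ) ^ α * Ψ.ψ₁ z = 0 := by
  have h := Ψ.moments α hα
  rw [Real.iteratedDeriv_fourier (N := ⊤) (fun n _ => by
    refine (Ψ.integrable_pow_mul_ψ₁ n).congr (Filter.Eventually.of_forall fun z => ?_)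
    simp) le_top, Real.fourier_real_eq_integral_exp_smul] at h
  simp only [mul_zero, Complex.ofReal_zero, zero_mul, Complex.exp_zero, smul_eq_mul,
    mul_pow, mul_assoc] at h
  simp_rw [integral_const_mul] at h
  have h1 : ((-2 : ℂ)) ^ α ≠ 0 := pow_ne_zero _ (by norm_num)
  have h2 : (Real.pi : ℂ) ^ α ≠ 0 := pow_ne_zero _ (by exact_mod_cast Real.pi_ne_zero)
  have h3 : Complex.I ^ α ≠ 0 := pow_ne_zero _ Complex.I_ne_zero
  simpa [h1, h2, h3] using h

/-- The decay of the local means of a bump of size `2⁻ʲ`. -/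
noncomputable def decay (L ℓ j : ℕ) : ℝ := min 1 (((2 : ℝ) ^ j / 2 ^ ℓ) ^ (L + 1))

theorem continuous_dilated (ℓ : ℕ) : Continuous (Ψ.dilated ℓ) := (Ψ.contDiff_dilated ℓ).continuous

theorem integral_dilated_succ_mul (ℓ : ℕ) (t : ℝ) (G : ℝ → ℂ) :
    ∫ y, Ψ.dilated (ℓ + 1) (t - y) * G y
      = ∫ z, Ψ.ψ₁ z * G (t - ((2 : ℝ) ^ ℓ)⁻¹ * z) := by
  rw [← integral_sub_left_eq_self (fun y => Ψ.dilated (ℓ + 1) (t - y) * G y) volume t]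
  simp_rw [sub_sub_cancel]
  have h := Measure.integral_comp_mul_left
    (fun z : ℝ => Ψ.ψ₁ z * G (t - ((2 : ℝ) ^ ℓ)⁻¹ * z)) ((2 : ℝ) ^ ℓ)
  rw [abs_of_pos (by positivity), eq_inv_smul_iff₀ (by positivity), ← integral_smul] at h
  rw [← h]
  refine integral_congr_ae (Filter.Eventually.of_forall fun w => ?_)
  simp only
  rw [inv_mul_cancel_left₀ (by positivity), Complex.real_smul, dilated]
  push_cast
  ring

/-- Boundedness of the bump sum gives the constant bound. For ℓ ≥ 1 the kernel annihilates the
Taylor polynomial of degree L, and the remainder of order L + 1 yields the power of 2^j/2^ℓ. The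
factor 2^{L+1} in the constant comes from Ψ_ℓ living at scale 2^{-(ℓ-1)}. -/
theorem exists_norm_integral_dilated_bumpSum_le :
    ∃ C : ℝ, 0 < C ∧ ∀ (c : ℕ → ℂ), (∀ k, ‖c k‖ ≤ 1) → ∀ (K ℓ j : ℕ) (t : ℝ),
      ‖∫ y, Ψ.dilated ℓ (t - y) * bumpSum c K ((2 : ℝ) ^ j * y)‖ ≤ C * decay L ℓ j := by
  obtain ⟨S₀, hS₀, h₀⟩ := exists_norm_iteratedDeriv_bump_le 0
  obtain ⟨S₁, hS₁, h₁⟩ := exists_norm_iteratedDeriv_bump_le (L + 1)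
  have hi0 : Integrable Ψ.ψ₀ :=
    Ψ.contDiff_ψ₀.continuous.integrable_of_hasCompactSupport Ψ.hasCompactSupport_ψ₀
  have hi1 : Integrable Ψ.ψ₁ :=
    Ψ.contDiff_ψ₁.continuous.integrable_of_hasCompactSupport Ψ.hasCompactSupport_ψ₁
  set I₀ := ∫ z, ‖Ψ.ψ₀ z‖ with hI₀
  set I₁ := ∫ z, ‖Ψ.ψ₁ z‖ with hI₁
  set J := ∫ z : ℝ, ‖(z : ℂ) ^ (L + 1) * Ψ.ψ₁ z‖ with hJ
  have hI₀' : 0 ≤ I₀ := integral_nonneg fun _ => norm_nonneg _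
  have hI₁' : 0 ≤ I₁ := integral_nonneg fun _ => norm_nonneg _
  have hJ' : 0 ≤ J := integral_nonneg fun _ => norm_nonneg _
  refine ⟨1 + S₀ * I₀ + S₀ * I₁ + S₁ * 2 ^ (L + 1) * J, by positivity, fun c hc K ℓ j t => ?_⟩
  have hsup : ∀ x, ‖bumpSum c K x‖ ≤ S₀ := fun x => by
    simpa using norm_iteratedDeriv_bumpSum_le hS₀ h₀ hc K x
  cases ℓ with
  | zero =>
    have h1 : decay L 0 j = 1 := by
      rw [decay, pow_zero, div_one, min_eq_left]
      exact one_le_pow₀ (one_le_pow₀ one_le_two)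
    rw [h1, mul_one]
    refine (norm_integral_le_of_norm_le ((hi0.comp_sub_left t).norm.mul_const S₀)
      (Filter.Eventually.of_forall fun y => ?_)).trans ?_
    · rw [norm_mul]
      exact mul_le_mul_of_nonneg_left (hsup _) (norm_nonneg _)
    · rw [integral_mul_const, integral_sub_left_eq_self (fun y => ‖Ψ.ψ₀ y‖) volume t, mul_comm]
      have : 0 ≤ S₀ * I₁ + S₁ * 2 ^ (L + 1) * J := by positivity
      linarith
  | succ ℓ =>
    rw [integral_dilated_succ_mul, decay, mul_min_of_nonneg _ _ (by positivity), le_min_iff]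
    constructor
    · refine (norm_integral_le_of_norm_le (hi1.norm.mul_const S₀)
        (Filter.Eventually.of_forall fun y => ?_)).trans ?_
      · rw [norm_mul]
        exact mul_le_mul_of_nonneg_left (hsup _) (norm_nonneg _)
      · rw [integral_mul_const, mul_comm]
        have : 0 ≤ S₀ * I₀ + S₁ * 2 ^ (L + 1) * J := by positivity
        linarith
    · obtain ⟨b, hb⟩ := exists_taylor_approx (L + 1) (bumpSum c K) (contDiff_bumpSum c K)
        (norm_iteratedDeriv_bumpSum_le hS₁ h₁ hc K) ((2 : ℝ) ^ j * t)
      set h : ℝ := -((2 : ℝ) ^ j / 2 ^ ℓ) with hh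
      have harg : ∀ z : ℝ, (2 : ℝ) ^ j * (t - ((2 : ℝ) ^ ℓ)⁻¹ * z) = (2 : ℝ) ^ j * t + h * z :=
        fun z => by
          rw [hh]
          ring
      have hpoly : ∫ z : ℝ, Ψ.ψ₁ z * ∑ α ∈ Finset.range (L + 1), b α * ((h * z : ℝ) : ℂ) ^ α
          = 0 := by
        have h2 : ∀ z : ℝ, Ψ.ψ₁ z * ∑ α ∈ Finset.range (L + 1), b α * ((h * z : ℝ) : ℂ) ^ α
            = ∑ α ∈ Finset.range (L + 1), (b α * (h : ℂ) ^ α) * ((z : ℂ) ^ α * Ψ.ψ₁ z) :=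
          fun z => by
            rw [Finset.mul_sum]
            refine Finset.sum_congr rfl fun α _ => ?_
            push_cast
            ring
        simp_rw [h2]
        rw [integral_finsetSum _ fun α _ => (Ψ.integrable_pow_mul_ψ₁ α).const_mul _]
        refine Finset.sum_eq_zero fun α hα => ?_
        rw [integral_const_mul, Ψ.integral_pow_mul_ψ₁ (Nat.lt_succ_iff.1 (Finset.mem_range.1 hα)),
          mul_zero]
      have hcont : Continuous fun z : ℝ => bumpSum c K ((2 : ℝ) ^ j * t + h * z) :=
        (contDiff_bumpSum c K).continuous.comp (by fun_prop)
      have hpc : Continuous fun z : ℝ =>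
          ∑ α ∈ Finset.range (L + 1), b α * ((h * z : ℝ) : ℂ) ^ α := by fun_prop
      have hsub : ∫ z, Ψ.ψ₁ z * bumpSum c K ((2 : ℝ) ^ j * (t - ((2 : ℝ) ^ ℓ)⁻¹ * z))
          = ∫ z : ℝ, Ψ.ψ₁ z * (bumpSum c K ((2 : ℝ) ^ j * t + h * z)
            - ∑ α ∈ Finset.range (L + 1), b α * ((h * z : ℝ) : ℂ) ^ α) := by
        simp_rw [harg, mul_sub]
        rw [integral_sub, hpoly, sub_zero]
        · exact (Ψ.contDiff_ψ₁.continuous.mul hcont).integrable_of_hasCompactSupport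
            Ψ.hasCompactSupport_ψ₁.mul_right
        · exact (Ψ.contDiff_ψ₁.continuous.mul hpc).integrable_of_hasCompactSupport
            Ψ.hasCompactSupport_ψ₁.mul_right
      rw [hsub]
      refine (norm_integral_le_of_norm_le
        ((Ψ.integrable_pow_mul_ψ₁ (L + 1)).norm.const_mul (S₁ * |h| ^ (L + 1)))
        (Filter.Eventually.of_forall fun z => ?_)).trans ?_
      · rw [norm_mul]
        calc ‖Ψ.ψ₁ z‖ * _ ≤ ‖Ψ.ψ₁ z‖ * (S₁ * |h * z| ^ (L + 1)) :=
              mul_le_mul_of_nonneg_left (hb _) (norm_nonneg _)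
          _ = _ := by
            rw [norm_mul, norm_pow, Complex.norm_real, Real.norm_eq_abs, abs_mul, mul_pow]
            ring
      · rw [integral_const_mul]
        have h5 : |h| = 2 * ((2 : ℝ) ^ j / 2 ^ (ℓ + 1)) := by
          rw [hh, abs_neg, abs_of_pos (by positivity), pow_succ]
          field_simp
        rw [h5, mul_pow]
        have h6 : 0 ≤ ((2 : ℝ) ^ j / 2 ^ (ℓ + 1)) ^ (L + 1) := by positivity
        have h7 : 0 ≤ 1 + S₀ * I₀ + S₀ * I₁ := by positivity
        calc _ = S₁ * 2 ^ (L + 1) * J * ((2 : ℝ) ^ j / 2 ^ (ℓ + 1)) ^ (L + 1) := by ring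
          _ ≤ _ := by
            gcongr
            linarith

/-- The local mean at scale `ℓ` of the bump with index `k` and scale `j`. -/
noncomputable def bumpMean (ℓ j k : ℕ) (t : ℝ) : ℂ :=
  ∫ y, Ψ.dilated ℓ (t - y) * bump ((2 : ℝ) ^ j * y - k)

/-- The bound for bump sums is uniform over coefficients of modulus at most 1, so the coefficients
may be chosen as the conjugate phases of the single means at the given t. -/
theorem exists_sum_norm_bumpMean_le :
    ∃ C : ℝ, 0 < C ∧ ∀ (K ℓ j : ℕ) (t : ℝ),
      ∑ k ∈ Finset.range K, ‖Ψ.bumpMean ℓ j k t‖ ≤ C * decay L ℓ j := by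
  obtain ⟨C, hC, h⟩ := Ψ.exists_norm_integral_dilated_bumpSum_le
  refine ⟨C, hC, fun K ℓ j t => ?_⟩
  -- Where the mean vanishes, the quotient is 0/0 = 0, which is still admissible.
  set c : ℕ → ℂ := fun k => (starRingEnd ℂ) (Ψ.bumpMean ℓ j k t) / ‖Ψ.bumpMean ℓ j k t‖ with hc
  have hc1 : ∀ k, ‖c k‖ ≤ 1 := fun k => by
    rw [hc, norm_div, RCLike.norm_conj, Complex.norm_real, norm_norm]
    exact div_self_le_one _
  have hc2 : ∀ k, c k * Ψ.bumpMean ℓ j k t = (‖Ψ.bumpMean ℓ j k t‖ : ℂ) := fun k => by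
    rw [hc]
    simp only
    rw [div_mul_eq_mul_div, Complex.conj_mul', sq]
    exact mul_self_div_self _
  have h1 : ∫ y, Ψ.dilated ℓ (t - y) * bumpSum c K ((2 : ℝ) ^ j * y)
      = ∑ k ∈ Finset.range K, c k * Ψ.bumpMean ℓ j k t := by
    simp_rw [bumpMean, ← integral_const_mul]
    rw [← integral_finsetSum]
    · refine integral_congr_ae (Filter.Eventually.of_forall fun y => ?_)
      simp only [bumpSum, Finset.mul_sum]
      exact Finset.sum_congr rfl fun k _ => by ring
    · intro k _
      refine Integrable.const_mul ?_ _
      exact (((Ψ.continuous_dilated ℓ).comp (by fun_prop)).mul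
        (contDiff_bump.continuous.comp (by fun_prop))).integrable_of_hasCompactSupport
          (((Ψ.hasCompactSupport_dilated ℓ).comp_homeomorph (Homeomorph.subLeft t)).mul_right)
  have h2 := h c hc1 K ℓ j t
  rw [h1] at h2
  simp_rw [hc2] at h2
  rw [← Complex.ofReal_sum, Complex.norm_real] at h2
  exact (Real.le_norm_self _).trans h2

end LocalMeans


/-! ### The fooling function -/

/-- The dyadic box with index `k` of side lengths `2^{-j_i}`. -/
def dyadicBox {d : ℕ} (j k : Fin d → ℕ) : Set (EuclideanSpace ℝ (Fin d)) :=
  {x | ∀ i, (k i : ℝ) ≤ 2 ^ j i * x i ∧ 2 ^ j i * x i < k i + 1}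

theorem dyadicBox_index_eq {d : ℕ} {j k k' : Fin d → ℕ} {x : EuclideanSpace ℝ (Fin d)}
    (h : x ∈ dyadicBox j k) (h' : x ∈ dyadicBox j k') : k = k' := by
  funext i
  have h1 : (k i : ℝ) < k' i + 1 := (h i).1.trans_lt (h' i).2
  have h2 : (k' i : ℝ) < k i + 1 := (h' i).1.trans_lt (h i).2
  have h3 : k i < k' i + 1 := by exact_mod_cast h1
  have h4 : k' i < k i + 1 := by exact_mod_cast h2
  omega

theorem mem_cube_of_mem_dyadicBox {d : ℕ} {j k : Fin d → ℕ} (hk : ∀ i, k i < 2 ^ j i)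
    {x : EuclideanSpace ℝ (Fin d)} (h : x ∈ dyadicBox j k) : x ∈ unitCubeHalfOpen d := by
  intro i
  have h0 : (0 : ℝ) < 2 ^ j i := by positivity
  have h1 : (k i : ℝ) + 1 ≤ 2 ^ j i := by exact_mod_cast hk i
  have h2 : (0 : ℝ) ≤ k i := Nat.cast_nonneg _
  constructor
  · by_contra hlt
    have := mul_neg_of_pos_of_neg h0 (not_le.1 hlt)
    linarith [(h i).1]
  · by_contra hge
    have := le_mul_of_one_le_right h0.le (not_lt.1 hge)
    linarith [(h i).2]

/-- The bump in the dyadic box with index `k`. -/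
noncomputable def bumpTensor {d : ℕ} (j k : Fin d → ℕ) : 𝓢(EuclideanSpace ℝ (Fin d), ℂ) :=
  tensorSchwartz (fun i t => bump ((2 : ℝ) ^ j i * t - k i))
    (fun _ => contDiff_bump.comp ((contDiff_const.mul contDiff_id).sub contDiff_const))
    fun i => hasCompactSupport_bump.comp_homeomorph
      ((Homeomorph.mulLeft₀ ((2 : ℝ) ^ j i) (by positivity)).trans (Homeomorph.subRight (k i : ℝ)))

theorem bumpTensor_apply {d : ℕ} (j k : Fin d → ℕ) (x : EuclideanSpace ℝ (Fin d)) :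
    bumpTensor j k x = ∏ i, bump ((2 : ℝ) ^ j i * x i - k i) := rfl

theorem bumpTensor_eq_zero {d : ℕ} {j k : Fin d → ℕ} {x : EuclideanSpace ℝ (Fin d)}
    (h : x ∉ dyadicBox j k) : bumpTensor j k x = 0 := by
  obtain ⟨i, hi⟩ := not_forall.1 h
  rw [bumpTensor_apply]
  refine Finset.prod_eq_zero (Finset.mem_univ i) (bump_eq_zero fun hm => hi ?_)
  exact ⟨by linarith [hm.1], by linarith [hm.2]⟩

theorem integral_bump_scaled (j k : ℕ) :
    ∫ t : ℝ, bump ((2 : ℝ) ^ j * t - k) = (((2 : ℝ) ^ j)⁻¹ * ∫ t, unitBump t : ℝ) := by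
  have h := Measure.integral_comp_mul_left (fun t : ℝ => bump (t - k)) ((2 : ℝ) ^ j)
  rw [h, integral_sub_right_eq_self bump, abs_of_pos (by positivity), Complex.real_smul]
  push_cast
  congr 1
  exact integral_ofReal

theorem integral_bumpTensor {d : ℕ} (j k : Fin d → ℕ) :
    ∫ x, bumpTensor j k x
      = ((((2 : ℝ) ^ ∑ i, j i)⁻¹ * (∫ t, unitBump t) ^ d : ℝ) : ℂ) := by
  simp_rw [bumpTensor_apply]
  rw [integral_tensor fun i t => bump ((2 : ℝ) ^ j i * t - k i)]
  simp_rw [integral_bump_scaled]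
  rw [← Complex.ofReal_prod, Finset.prod_mul_distrib, Finset.prod_const, Finset.card_univ,
    Fintype.card_fin, Finset.prod_inv_distrib, Finset.prod_pow_eq_pow_sum]

open Classical in
/-- The dyadic boxes in the unit cube that do not contain a lattice point. -/
noncomputable def freeBoxes (d n : ℕ) (j : Fin d → ℕ) : Finset (Fin d → ℕ) :=
  {k ∈ Fintype.piFinset fun i => Finset.range (2 ^ j i) | ∀ κ, latticePoint d n κ ∉ dyadicBox j k}

/-- The boxes of one shape are disjoint, so the occupied ones number at most as many as the lattice
points in the unit cube, which are O(n). -/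
theorem exists_card_freeBoxes_ge {d : ℕ} (hd : 1 ≤ d) :
    ∃ C : ℝ, 0 < C ∧ ∀ n : ℕ, 1 ≤ n → ∀ j : Fin d → ℕ,
      (2 : ℝ) ^ ∑ i, j i ≤ (freeBoxes d n j).card + C * n := by
  obtain ⟨C, hC, h⟩ := exists_card_box_le hd
  refine ⟨1 + C, by positivity, fun n hn j => ?_⟩
  classical
  set P := Fintype.piFinset fun i => Finset.range (2 ^ j i) with hP
  set O := {k ∈ P | ¬ ∀ κ, latticePoint d n κ ∉ dyadicBox j k} with hO
  have hcard : P.card = (freeBoxes d n j).card + O.card := by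
    rw [hO, freeBoxes, ← Finset.card_filter_add_card_filter_not
      (fun k => ∀ κ, latticePoint d n κ ∉ dyadicBox j k)]
  have hPc : P.card = 2 ^ ∑ i, j i := by
    rw [hP, Fintype.card_piFinset]
    simp_rw [Finset.card_range]
    rw [Finset.prod_pow_eq_pow_sum]
  have hex : ∀ k ∈ O, ∃ κ, latticePoint d n κ ∈ dyadicBox j k := fun k hk => by
    simpa using (Finset.mem_filter.1 hk).2
  choose! κ hκ using hex
  have hinj : Set.InjOn κ O := fun k hk k' hk' he => by
    have h1 := hκ k hk
    rw [he] at h1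
    exact dyadicBox_index_eq h1 (hκ k' hk')
  have h2 := h n hn (fun _ => 0) (fun _ => 1) (fun _ => one_pos) (O.image κ) fun κ' hκ' i => by
    obtain ⟨k, hk, rfl⟩ := Finset.mem_image.1 hκ'
    rw [zero_add]
    exact mem_cube_of_mem_dyadicBox (fun i => Finset.mem_range.1
      (Fintype.mem_piFinset.1 (Finset.mem_filter.1 hk).1 i)) (hκ k hk) i
  rw [Finset.card_image_of_injOn hinj, Finset.prod_const_one, mul_one] at h2
  have h3 : ((2 : ℝ) ^ ∑ i, j i) = ((freeBoxes d n j).card : ℝ) + O.card := by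
    rw [← Nat.cast_add, ← hcard, hPc]
    push_cast
    rfl
  have hn' : (1 : ℝ) ≤ n := by exact_mod_cast hn
  rw [h3]
  linarith

/-- The sum of the bumps in the free boxes of volume `2^{-M}`. -/
noncomputable def fooling (d n M : ℕ) : 𝓢(EuclideanSpace ℝ (Fin d), ℂ) :=
  ∑ j ∈ levelSet d M, ∑ k ∈ freeBoxes d n j, bumpTensor j k

theorem fooling_apply (d n M : ℕ) (x : EuclideanSpace ℝ (Fin d)) :
    fooling d n M x = ∑ j ∈ levelSet d M, ∑ k ∈ freeBoxes d n j, bumpTensor j k x := by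
  simp only [fooling, sum_apply]

theorem lt_of_mem_freeBoxes {d n : ℕ} {j k : Fin d → ℕ} (hk : k ∈ freeBoxes d n j) (i : Fin d) :
    k i < 2 ^ j i := by
  classical
  exact Finset.mem_range.1 (Fintype.mem_piFinset.1 (Finset.mem_filter.1 hk).1 i)

theorem fooling_latticePoint (d n M : ℕ) (κ : Fin d → ℤ) :
    fooling d n M (latticePoint d n κ) = 0 := by
  classical
  rw [fooling_apply]
  exact Finset.sum_eq_zero fun j _ => Finset.sum_eq_zero fun k hk =>
    bumpTensor_eq_zero ((Finset.mem_filter.1 hk).2 κ)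

theorem fooling_eq_zero {d n M : ℕ} {x : EuclideanSpace ℝ (Fin d)}
    (hx : x ∉ unitCubeHalfOpen d) : fooling d n M x = 0 := by
  rw [fooling_apply]
  exact Finset.sum_eq_zero fun j _ => Finset.sum_eq_zero fun k hk =>
    bumpTensor_eq_zero fun h => hx (mem_cube_of_mem_dyadicBox (lt_of_mem_freeBoxes hk) h)

theorem integral_fooling (d n M : ℕ) :
    ∫ x, fooling d n M x = ((∑ j ∈ levelSet d M, ((freeBoxes d n j).card : ℝ)
      * (((2 : ℝ) ^ M)⁻¹ * (∫ t, unitBump t) ^ d) : ℝ) : ℂ) := by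
  simp_rw [fooling_apply]
  rw [integral_finsetSum _ fun j _ => integrable_finsetSum _ fun k _ =>
    (bumpTensor j k).integrable]
  rw [Complex.ofReal_sum]
  refine Finset.sum_congr rfl fun j hj => ?_
  rw [integral_finsetSum _ fun k _ => (bumpTensor j k).integrable]
  simp_rw [integral_bumpTensor, mem_levelSet.1 hj]
  rw [Finset.sum_const, nsmul_eq_mul]
  push_cast
  rfl

/-! ### The Besov norm of the fooling function -/

/-- The tempered distribution that is given by a multiple of the fooling function. -/
noncomputable def foolingDistribution (d n M : ℕ) (c : ℝ) :
    𝓢'(EuclideanSpace ℝ (Fin d), ℂ) :=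
  SchwartzMap.toTemperedDistributionCLM (EuclideanSpace ℝ (Fin d)) ℂ volume
    ((c : ℂ) • fooling d n M)

theorem foolingDistribution_apply (d n M : ℕ) (c : ℝ)
    (φ : 𝓢(EuclideanSpace ℝ (Fin d), ℂ)) :
    foolingDistribution d n M c φ = ∫ x, φ x * ((c : ℂ) * fooling d n M x) := by
  exact SchwartzMap.toTemperedDistributionCLM_apply_apply volume _ φ

theorem dsupport_foolingDistribution_subset (d n M : ℕ) (c : ℝ) :
    Distribution.dsupport (foolingDistribution d n M c) ⊆ unitCube d := by
  intro x hx
  by_contra hxc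
  refine (Distribution.notMem_dsupport_iff x).2 ⟨(unitCube d)ᶜ, fun φ hφ => ?_,
    (isClosed_unitCube d).isOpen_compl, hxc⟩ hx
  rw [foolingDistribution_apply]
  refine integral_eq_zero_of_ae (Filter.Eventually.of_forall fun y => ?_)
  simp only [Pi.zero_apply]
  by_cases hy : y ∈ unitCube d
  · rw [image_eq_zero_of_notMem_tsupport fun h => hφ h hy, zero_mul]
  · rw [fooling_eq_zero fun h => hy fun i => ⟨(h i).1, (h i).2.le⟩, mul_zero, mul_zero]

theorem LocalMeans.conv_foolingDistribution {L : ℕ} (Ψ : LocalMeans L) {d : ℕ} (n M : ℕ) (c : ℝ) (m : Fin d → ℕ)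
    (x : EuclideanSpace ℝ (Fin d)) :
    Ψ.conv m (foolingDistribution d n M c) x
      = (c : ℂ) * ∑ j ∈ levelSet d M, ∑ k ∈ freeBoxes d n j,
        ∏ i, Ψ.bumpMean (m i) (j i) (k i) (x i) := by
  rw [LocalMeans.conv, foolingDistribution_apply]
  have hterm : ∀ j k : Fin d → ℕ, ∫ y, Ψ.shifted m x y * bumpTensor j k y
      = ∏ i, Ψ.bumpMean (m i) (j i) (k i) (x i) := fun j k => by
    unfold LocalMeans.bumpMean
    rw [← integral_tensor]
    refine integral_congr_ae (Filter.Eventually.of_forall fun y => ?_)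
    simp only
    rw [LocalMeans.shifted_apply, LocalMeans.tensor, bumpTensor_apply, ← Finset.prod_mul_distrib]
    rfl
  have hint : ∀ j k : Fin d → ℕ, Integrable fun y => Ψ.shifted m x y * bumpTensor j k y :=
    fun j k => ((Ψ.shifted m x).continuous.mul
      (bumpTensor j k).continuous).integrable_of_hasCompactSupport
        (HasCompactSupport.mul_right
          ((Ψ.hasCompactSupport_tensor m).comp_homeomorph (Homeomorph.subLeft x)))
  have hsum : ∀ y, Ψ.shifted m x y * ((c : ℂ) * fooling d n M y)
      = (c : ℂ) * ∑ j ∈ levelSet d M, ∑ k ∈ freeBoxes d n j,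
        Ψ.shifted m x y * bumpTensor j k y := fun y => by
    rw [fooling_apply, mul_left_comm, Finset.mul_sum]
    simp_rw [Finset.mul_sum]
  simp_rw [hsum, ← hterm]
  rw [integral_const_mul,
    integral_finsetSum _ fun j _ => integrable_finsetSum _ fun k _ => hint j k]
  congr 1
  exact Finset.sum_congr rfl fun j _ => integral_finsetSum _ fun k _ => hint j k


theorem exists_eLpNorm_le_of_eq_zero_off_box (p : ℝ≥0∞) (d : ℕ) (B : ℝ) :
    ∃ V : ℝ, 0 < V ∧ ∀ (f : EuclideanSpace ℝ (Fin d) → ℂ) (A : ℝ), 0 ≤ A → (∀ x, ‖f x‖ ≤ A) →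
      (∀ x, x ∉ DualMeans.centeredBox d B → f x = 0) →
      eLpNorm f p volume ≤ ENNReal.ofReal (V * A) := by
  have hK := isCompact_centeredBox d B
  have htop : volume (DualMeans.centeredBox d B) ^ p.toReal⁻¹ ≠ ⊤ :=
    ENNReal.rpow_ne_top_of_nonneg (by positivity) hK.measure_lt_top.ne
  refine ⟨(volume (DualMeans.centeredBox d B) ^ p.toReal⁻¹).toReal + 1, by positivity,
    fun f A hA hf h0 => ?_⟩
  have hind : (DualMeans.centeredBox d B).indicator f = f :=
    Set.indicator_eq_self.2 fun x hx => by
      by_contra h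
      exact hx (h0 x h)
  rw [← hind, eLpNorm_indicator_eq_eLpNorm_restrict hK.measurableSet]
  refine (eLpNorm_le_of_ae_bound (Filter.Eventually.of_forall hf)).trans ?_
  rw [Measure.restrict_apply_univ, ENNReal.ofReal_mul (by positivity)]
  gcongr
  rw [ENNReal.ofReal_add (by positivity) zero_le_one, ENNReal.ofReal_toReal htop]
  exact le_self_add

/-- Once absolute values are inside, the sum over free boxes may be enlarged to all boxes of the
same shape, where it factorizes over the coordinates. The bound is therefore blind to which boxes
are free. -/
theorem LocalMeans.exists_norm_conv_foolingDistribution_le {L : ℕ} (Ψ : LocalMeans L) (d : ℕ) :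
    ∃ C : ℝ, 0 < C ∧ ∀ (n M : ℕ) (c : ℝ) (m : Fin d → ℕ) (x : EuclideanSpace ℝ (Fin d)),
      ‖Ψ.conv m (foolingDistribution d n M c) x‖
        ≤ C * (|c| * ∑ j ∈ levelSet d M, ∏ i, LocalMeans.decay L (m i) (j i)) := by
  obtain ⟨C, hC, h⟩ := Ψ.exists_sum_norm_bumpMean_le
  refine ⟨C ^ d, by positivity, fun n M c m x => ?_⟩
  classical
  rw [Ψ.conv_foolingDistribution, norm_mul, Complex.norm_real, Real.norm_eq_abs, mul_left_comm,
    Finset.mul_sum]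
  refine mul_le_mul_of_nonneg_left ((norm_sum_le _ _).trans (Finset.sum_le_sum fun j _ => ?_))
    (abs_nonneg c)
  calc ‖∑ k ∈ freeBoxes d n j, ∏ i, Ψ.bumpMean (m i) (j i) (k i) (x i)‖
      ≤ ∑ k ∈ freeBoxes d n j, ∏ i, ‖Ψ.bumpMean (m i) (j i) (k i) (x i)‖ :=
        (norm_sum_le _ _).trans_eq (Finset.sum_congr rfl fun k _ => norm_prod _ _)
    _ ≤ ∑ k ∈ Fintype.piFinset fun i => Finset.range (2 ^ j i),
          ∏ i, ‖Ψ.bumpMean (m i) (j i) (k i) (x i)‖ :=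
        Finset.sum_le_sum_of_subset_of_nonneg (Finset.filter_subset _ _) fun _ _ _ =>
          Finset.prod_nonneg fun _ _ => norm_nonneg _
    _ = ∏ i, ∑ k ∈ Finset.range (2 ^ j i), ‖Ψ.bumpMean (m i) (j i) k (x i)‖ :=
        (Finset.prod_univ_sum (fun i => Finset.range (2 ^ j i))
          fun i k => ‖Ψ.bumpMean (m i) (j i) k (x i)‖).symm
    _ ≤ ∏ i, C * LocalMeans.decay L (m i) (j i) :=
        Finset.prod_le_prod (fun _ _ => Finset.sum_nonneg fun _ _ => norm_nonneg _)
          fun i _ => h _ _ _ _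
    _ = _ := by
        rw [Finset.prod_mul_distrib, Finset.prod_const, Finset.card_univ, Fintype.card_fin]

/-- For m ≤ j the weight itself decays away from j, by 2^{-s(j-m)}, and no cancellation is needed.
For m ≥ j the vanishing moments beat the growth of the weight, by 2^{-(L+1-s)(m-j)}. -/
theorem weight_mul_decay_le {s δ : ℝ} {L : ℕ} (h1 : δ ≤ s) (h2 : δ ≤ L + 1 - s) (m j : ℕ) :
    (2 : ℝ) ^ (s * m) * LocalMeans.decay L m j
      ≤ (2 : ℝ) ^ (s * j) * ((2 : ℝ) ^ (-δ)) ^ ((m : ℤ) - j).natAbs := by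
  rcases le_total m j with h | h
  · obtain ⟨k, rfl⟩ := Nat.exists_eq_add_of_le h
    have hk : ((m : ℤ) - (m + k : ℕ)).natAbs = k := by omega
    rw [hk, ← Real.rpow_mul_natCast two_pos.le, ← Real.rpow_add two_pos]
    refine (mul_le_of_le_one_right (by positivity) (min_le_left _ _)).trans ?_
    refine Real.rpow_le_rpow_of_exponent_le one_le_two ?_
    push_cast
    nlinarith [mul_le_mul_of_nonneg_right h1 (Nat.cast_nonneg (α := ℝ) k)]
  · obtain ⟨k, rfl⟩ := Nat.exists_eq_add_of_le h
    have hk : (((j + k : ℕ) : ℤ) - j).natAbs = k := by omega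
    rw [hk, ← Real.rpow_mul_natCast two_pos.le, ← Real.rpow_add two_pos]
    refine (mul_le_mul_of_nonneg_left (min_le_right _ _) (by positivity)).trans ?_
    have h3 : ((2 : ℝ) ^ j / 2 ^ (j + k)) ^ (L + 1) = (2 : ℝ) ^ (-((k : ℝ) * (L + 1))) := by
      rw [pow_add 2 j k, div_mul_cancel_left₀ (by positivity), inv_pow, ← pow_mul, Real.rpow_neg two_pos.le,
        ← Real.rpow_natCast]
      push_cast
      rfl
    rw [h3, ← Real.rpow_add two_pos]
    refine Real.rpow_le_rpow_of_exponent_le one_le_two ?_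
    push_cast
    nlinarith [mul_le_mul_of_nonneg_right h2 (Nat.cast_nonneg (α := ℝ) k)]

/-- The decay in the distance of two multi-indices. -/
noncomputable def offDiagonal {d : ℕ} (r : ℝ) (m j : Fin d → ℕ) : ℝ≥0∞ :=
  ∏ i, ENNReal.ofReal (r ^ ((m i : ℤ) - j i).natAbs)

theorem offDiagonal_comm {d : ℕ} (r : ℝ) (m j : Fin d → ℕ) :
    offDiagonal r m j = offDiagonal r j m :=
  Finset.prod_congr rfl fun i _ => by rw [← Int.natAbs_neg, neg_sub]

theorem exists_tsum_offDiagonal_le (d : ℕ) {r : ℝ} (hr0 : 0 ≤ r) (hr1 : r < 1) :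
    ∃ G : ℝ, 0 < G ∧ ∀ j : Fin d → ℕ, ∑' m, offDiagonal r m j ≤ ENNReal.ofReal G := by
  have hs : Summable fun z : ℤ => r ^ z.natAbs := by
    refine Summable.of_nat_of_neg ?_ ?_ <;>
      simpa using summable_geometric_of_lt_one hr0 hr1
  have hle : ∀ j : ℕ, ∑' m : ℕ, ENNReal.ofReal (r ^ ((m : ℤ) - j).natAbs)
      ≤ ENNReal.ofReal (∑' z : ℤ, r ^ z.natAbs) := fun j => by
    rw [ENNReal.ofReal_tsum_of_nonneg (fun _ => by positivity) hs]
    exact ENNReal.tsum_comp_le_tsum_of_injective (f := fun m : ℕ => (m : ℤ) - j)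
      (fun a b hab => by simpa using hab) fun z : ℤ => ENNReal.ofReal (r ^ z.natAbs)
  have hpos : 0 < ∑' z : ℤ, r ^ z.natAbs :=
    hs.tsum_pos (fun _ => by positivity) 0 (by simp)
  refine ⟨(∑' z : ℤ, r ^ z.natAbs) ^ d, by positivity, fun j => ?_⟩
  unfold offDiagonal
  rw [tsum_pi_prod fun i (ℓ : ℕ) => ENNReal.ofReal (r ^ ((ℓ : ℤ) - j i).natAbs),
    ENNReal.ofReal_pow hpos.le]
  refine (Finset.prod_le_prod' fun i _ => hle (j i)).trans_eq ?_
  rw [Finset.prod_const, Finset.card_univ, Fintype.card_fin]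

theorem LocalMeans.exists_besovTerm_foolingDistribution_le {L : ℕ} (Ψ : LocalMeans L) (d : ℕ)
    (p : ℝ≥0∞) {s δ : ℝ} (h1 : δ ≤ s) (h2 : δ ≤ L + 1 - s) :
    ∃ C : ℝ, 0 < C ∧ ∀ (n M : ℕ) (c : ℝ) (m : Fin d → ℕ),
      Ψ.besovTerm p s (foolingDistribution d n M c) m
        ≤ ENNReal.ofReal (C * (|c| * 2 ^ (s * M)))
          * ∑ j ∈ levelSet d M, offDiagonal ((2 : ℝ) ^ (-δ)) m j := by
  obtain ⟨B, hB⟩ := Ψ.exists_conv_eq_zero d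
  obtain ⟨C, hC, hconv⟩ := Ψ.exists_norm_conv_foolingDistribution_le d
  obtain ⟨V, hV, hnorm⟩ := exists_eLpNorm_le_of_eq_zero_off_box p d B
  refine ⟨V * C, by positivity, fun n M c m => ?_⟩
  have hdec : ∀ j ∈ levelSet d M, 0 ≤ ∏ i, LocalMeans.decay L (m i) (j i) := fun j _ =>
    Finset.prod_nonneg fun i _ => le_min zero_le_one (by positivity)
  have hsum : (2 : ℝ) ^ (s * ((∑ i, m i : ℕ) : ℝ))
      * ∑ j ∈ levelSet d M, ∏ i, LocalMeans.decay L (m i) (j i)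
      ≤ 2 ^ (s * M) * ∑ j ∈ levelSet d M, ∏ i, ((2 : ℝ) ^ (-δ)) ^ ((m i : ℤ) - j i).natAbs := by
    have hw : ∀ j : Fin d → ℕ, (2 : ℝ) ^ (s * ((∑ i, j i : ℕ) : ℝ)) = ∏ i, (2 : ℝ) ^ (s * j i) :=
      fun j => by
        rw [Nat.cast_sum, Finset.mul_sum, Real.rpow_sum_of_pos two_pos]
    rw [Finset.mul_sum, Finset.mul_sum]
    refine Finset.sum_le_sum fun j hj => ?_
    rw [← mem_levelSet.1 hj, hw, hw, ← Finset.prod_mul_distrib, ← Finset.prod_mul_distrib]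
    exact Finset.prod_le_prod (fun i _ => mul_nonneg (by positivity)
      (le_min zero_le_one (by positivity))) fun i _ => weight_mul_decay_le h1 h2 _ _
  have hle := hnorm (Ψ.conv m (foolingDistribution d n M c))
    (C * (|c| * ∑ j ∈ levelSet d M, ∏ i, LocalMeans.decay L (m i) (j i)))
    (mul_nonneg hC.le (mul_nonneg (abs_nonneg c) (Finset.sum_nonneg hdec)))
    (hconv n M c m) (hB m _ (dsupport_foolingDistribution_subset d n M c))
  have hoff : ∑ j ∈ levelSet d M, offDiagonal ((2 : ℝ) ^ (-δ)) m j = ENNReal.ofReal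
      (∑ j ∈ levelSet d M, ∏ i, ((2 : ℝ) ^ (-δ)) ^ ((m i : ℤ) - j i).natAbs) := by
    rw [ENNReal.ofReal_sum_of_nonneg fun j _ => by positivity]
    exact Finset.sum_congr rfl fun j _ =>
      (ENNReal.ofReal_prod_of_nonneg fun i _ => by positivity).symm
  rw [hoff, ← ENNReal.ofReal_mul (by positivity), LocalMeans.besovTerm]
  refine (mul_le_mul_right hle _).trans ?_
  rw [← ENNReal.ofReal_mul (by positivity)]
  refine ENNReal.ofReal_le_ofReal ?_
  calc _ = V * C * |c| * ((2 : ℝ) ^ (s * ((∑ i, m i : ℕ) : ℝ))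
        * ∑ j ∈ levelSet d M, ∏ i, LocalMeans.decay L (m i) (j i)) := by ring
    _ ≤ V * C * |c| * (2 ^ (s * M)
        * ∑ j ∈ levelSet d M, ∏ i, ((2 : ℝ) ^ (-δ)) ^ ((m i : ℤ) - j i).natAbs) := by gcongr
    _ = _ := by ring

/-- The weighted terms are bounded by a sum over the level set of geometrically decaying functions
of m - j. Their supremum over m is bounded independently of the level set, and their sum over m is
proportional to its cardinality; interpolation gives the power 1/θ. -/
theorem LocalMeans.exists_besovNorm_foolingDistribution_le {L : ℕ} (Ψ : LocalMeans L) (d : ℕ)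
    (p : ℝ≥0∞) {θ : ℝ≥0∞} (hθ : 1 ≤ θ) {s : ℝ} (hs : 0 < s) (hL : s < (L : ℝ) + 1) :
    ∃ C : ℝ, 0 < C ∧ ∀ (n M : ℕ) (c : ℝ),
      Ψ.besovNorm p θ s (foolingDistribution d n M c)
        ≤ ENNReal.ofReal (C * (|c| * 2 ^ (s * M)
          * ((levelSet d M).card : ℝ) ^ (θ⁻¹).toReal)) := by
  set δ := min s (L + 1 - s) with hδ
  have hδ0 : 0 < δ := lt_min hs (by linarith)
  obtain ⟨C, hC, hterm⟩ := Ψ.exists_besovTerm_foolingDistribution_le d p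
    (min_le_left s (L + 1 - s)) (min_le_right s (L + 1 - s))
  obtain ⟨G, hG, hoff⟩ := exists_tsum_offDiagonal_le d (r := (2 : ℝ) ^ (-δ)) (by positivity)
    (Real.rpow_lt_one_of_one_lt_of_neg one_lt_two (by linarith))
  refine ⟨C * G, by positivity, fun n M c => ?_⟩
  set E := ENNReal.ofReal (C * (|c| * 2 ^ (s * M))) with hE
  set t := (θ⁻¹).toReal with ht
  have ht0 : 0 ≤ t := ENNReal.toReal_nonneg
  have ht1 : t ≤ 1 := by
    rw [ht, ← ENNReal.toReal_one]
    exact ENNReal.toReal_mono ENNReal.one_ne_top (ENNReal.inv_le_one.2 hθ)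
  have hA : ∀ m, Ψ.besovTerm p s (foolingDistribution d n M c) m ≤ E * ENNReal.ofReal G :=
    fun m => (hterm n M c m).trans (mul_le_mul_right (by
      refine (ENNReal.sum_le_tsum _).trans ?_
      simp_rw [offDiagonal_comm _ m]
      exact hoff m) _)
  have hB : ∑' m, Ψ.besovTerm p s (foolingDistribution d n M c) m
      ≤ E * ENNReal.ofReal G * ((levelSet d M).card : ℝ≥0∞) := by
    refine (ENNReal.tsum_le_tsum (hterm n M c)).trans ?_
    rw [ENNReal.tsum_mul_left, mul_assoc]
    refine mul_le_mul_right ?_ _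
    rw [Summable.tsum_finsetSum fun _ _ => ENNReal.summable]
    refine (Finset.sum_le_sum fun j _ => hoff j).trans_eq ?_
    rw [Finset.sum_const, nsmul_eq_mul, mul_comm]
  rw [DualMeans.besovNorm_eq_ellNorm]
  refine (ellNorm_le_interp hθ _ hA hB).trans_eq ?_
  rw [ENNReal.mul_rpow_of_nonneg _ _ ht0, ← mul_assoc,
    ← ENNReal.rpow_add_of_nonneg _ _ (by linarith) ht0, sub_add_cancel, ENNReal.rpow_one,
    ← ENNReal.ofReal_natCast, ENNReal.ofReal_rpow_of_nonneg (by positivity) ht0, hE,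
    ← ENNReal.ofReal_mul (by positivity), ← ENNReal.ofReal_mul (by positivity)]
  congr 1
  ring


/-! ### The lower bound -/

/-- The error is an infimum over representing functions, so a lower bound for it must treat every
such function; there is only one. -/
theorem IsRepresentedBy.eq_fooling {d n M : ℕ} {c : ℝ} {f : EuclideanSpace ℝ (Fin d) →ᵇ ℂ}
    (hf : IsRepresentedBy (foolingDistribution d n M c) f) (x : EuclideanSpace ℝ (Fin d)) :
    f x = (c : ℂ) * fooling d n M x := by
  have hc : Continuous fun x => (c : ℂ) * fooling d n M x :=
    continuous_const.mul (fooling d n M).continuous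
  have hae : ∀ᵐ x, f x = (c : ℂ) * fooling d n M x := by
    refine ae_eq_of_integral_contDiff_smul_eq f.continuous.locallyIntegrable hc.locallyIntegrable
      fun g hg hgs => ?_
    have hgc : HasCompactSupport fun x => (g x : ℂ) := hgs.comp_left Complex.ofReal_zero
    let φ : 𝓢(EuclideanSpace ℝ (Fin d), ℂ) :=
      hgc.toSchwartzMap (Complex.ofRealCLM.contDiff.comp hg)
    have h1 := hf φ
    rw [foolingDistribution_apply] at h1
    exact h1.symm
  exact congrFun ((f.continuous.ae_eq_iff_eq volume hc).1 hae) x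

theorem frolovRule_eq_zero {d n : ℕ} {f : EuclideanSpace ℝ (Fin d) → ℂ}
    (h : ∀ κ, f (latticePoint d n κ) = 0) : frolovRule d n f = 0 := by
  rw [frolovRule, finsum_mem_eq_zero_of_forall_eq_zero, mul_zero]
  rintro _ ⟨⟨κ, rfl⟩, -⟩
  exact h κ

theorem le_frolovError_foolingDistribution (d n M : ℕ) (c : ℝ) :
    ENNReal.ofReal (c * ∑ j ∈ levelSet d M, ((freeBoxes d n j).card : ℝ)
      * (((2 : ℝ) ^ M)⁻¹ * (∫ t, unitBump t) ^ d))
        ≤ frolovError n (foolingDistribution d n M c) := by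
  refine le_iInf₂ fun f hf => ENNReal.ofReal_le_ofReal ?_
  have hfx := hf.eq_fooling
  rw [frolovRule_eq_zero fun κ => by rw [hfx, fooling_latticePoint, mul_zero], sub_zero,
    integral_unitCube_eq fun x hx => by rw [hfx, fooling_eq_zero hx, mul_zero]]
  simp_rw [hfx]
  rw [integral_const_mul, integral_fooling, ← Complex.ofReal_mul, Complex.norm_real]
  exact Real.le_norm_self _

theorem exists_le_worstCaseError {d : ℕ} (hd : 1 ≤ d) (p : ℝ≥0∞) {θ : ℝ≥0∞} (hθ : 1 ≤ θ) {s : ℝ}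
    (hs : 0 < s) {L : ℕ} (hL : s < (L : ℝ) + 1) (Ψ : LocalMeans L) :
    ∃ c : ℝ, 0 < c ∧ ∀ n : ℕ, 2 ≤ n →
      ENNReal.ofReal (c * ((n : ℝ) ^ (-s) * Real.log n ^ (((d : ℝ) - 1) * (1 - (θ⁻¹).toReal))))
        ≤ worstCaseError Ψ d p θ s n := by
  obtain ⟨K, hK, hfree⟩ := exists_card_freeBoxes_ge hd
  obtain ⟨C, hC, hnorm⟩ := Ψ.exists_besovNorm_foolingDistribution_le d p hθ hs hL
  -- From 2^M ≥ an follows Kn ≤ 2^M/2, so at least half of the 2^M boxes of each shape are free. The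
  -- additional 2 ensures M ≠ 0 and n ≤ 2^M.
  set a : ℝ := 2 * K + 2 with ha
  have ha0 : 0 < a := by positivity
  obtain ⟨_, _, hlevel⟩ := exists_level ha0
  set t := (θ⁻¹).toReal with ht
  have ht1 : t ≤ 1 := by
    rw [ht, ← ENNReal.toReal_one]
    exact ENNReal.toReal_mono ENNReal.one_ne_top (ENNReal.inv_le_one.2 hθ)
  set J := (∫ t, unitBump t) ^ d with hJ
  have hJ0 : 0 < J := pow_pos unitBump.integral_pos d
  have hd0 : (0 : ℝ) < d := by exact_mod_cast hd
  have hd1 : (0 : ℝ) ≤ (d : ℝ) - 1 := by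
    have : (1 : ℝ) ≤ d := by exact_mod_cast hd
    linarith
  set e := ((d : ℝ) - 1) * (1 - t) with he
  have he0 : 0 ≤ e := mul_nonneg hd1 (by linarith)
  refine ⟨J / (2 * C) * ((2 * a) ^ (-s) * (d : ℝ)⁻¹ ^ e), by positivity, fun n hn => ?_⟩
  obtain ⟨M, hMlt, hMge, -⟩ := hlevel n hn
  have hn2 : (2 : ℝ) ≤ n := by exact_mod_cast hn
  have hn0 : (0 : ℝ) < n := by linarith
  have hM0 : M ≠ 0 := by
    rintro rfl
    rw [pow_zero] at hMge
    nlinarith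
  have hMle : (2 : ℝ) ^ M ≤ 2 * a * n := by
    obtain ⟨l, rfl⟩ := Nat.exists_eq_succ_of_ne_zero hM0
    have := hMlt l (Nat.lt_succ_self l)
    rw [pow_succ]
    linarith
  have hlog0 : 0 ≤ Real.log n := Real.log_nonneg (by linarith)
  have hlog : Real.log n ≤ (M : ℝ) + 1 := by
    have h1 : (n : ℝ) ≤ 2 ^ M := by nlinarith
    have h2 := Real.log_le_log hn0 h1
    rw [Real.log_pow] at h2
    have h3 : (M : ℝ) * Real.log 2 ≤ M * 1 :=
      mul_le_mul_of_nonneg_left (by linarith [Real.log_two_lt_d9]) (Nat.cast_nonneg M)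
    linarith
  set N : ℝ := ((levelSet d M).card : ℝ) with hN
  have hNge : (((M : ℝ) + 1) / d) ^ (d - 1) ≤ N := card_levelSet_ge hd M
  have hN0 : 0 < N := lt_of_lt_of_le (by positivity) hNge
  have hNlog : (d : ℝ)⁻¹ ^ e * Real.log n ^ e ≤ N ^ (1 - t) := by
    rw [← Real.mul_rpow (by positivity) hlog0, he, Real.rpow_mul (by positivity)]
    refine Real.rpow_le_rpow (by positivity) (le_trans ?_ hNge) (by linarith)
    have h1 : ((d : ℝ) - 1) = ((d - 1 : ℕ) : ℝ) := by
      rw [Nat.cast_sub hd, Nat.cast_one]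
    rw [h1, Real.rpow_natCast, inv_mul_eq_div]
    gcongr
  -- The factor that scales the Besov norm to at most 1; times an integral of order N it leaves
  -- 2^{-sM} N^{1-1/θ}.
  set c : ℝ := (C * (2 ^ (s * M) * N ^ t))⁻¹ with hc
  have hc0 : 0 < c := by positivity
  have hone : Ψ.besovNorm p θ s (foolingDistribution d n M c) ≤ 1 := by
    refine (hnorm n M c).trans_eq ?_
    rw [abs_of_pos hc0, ← ENNReal.ofReal_one]
    congr 1
    rw [← hN, hc]
    field_simp
  refine le_trans ?_ (le_iSup₂_of_le (foolingDistribution d n M c)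
    ⟨⟨hone.trans_lt ENNReal.one_lt_top, dsupport_foolingDistribution_subset d n M c⟩, hone⟩
    (le_frolovError_foolingDistribution d n M c))
  refine ENNReal.ofReal_le_ofReal ?_
  have hcard : ∀ j ∈ levelSet d M, J / 2
      ≤ ((freeBoxes d n j).card : ℝ) * (((2 : ℝ) ^ M)⁻¹ * J) := fun j hj => by
    have h1 := hfree n (by omega) j
    rw [mem_levelSet.1 hj] at h1
    have h2 : (2 : ℝ) ^ M / 2 ≤ (freeBoxes d n j).card := by nlinarith
    calc J / 2 = (2 : ℝ) ^ M / 2 * (((2 : ℝ) ^ M)⁻¹ * J) := by field_simp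
      _ ≤ _ := by gcongr
  have hsum : N * (J / 2) ≤ ∑ j ∈ levelSet d M,
      ((freeBoxes d n j).card : ℝ) * (((2 : ℝ) ^ M)⁻¹ * J) := by
    rw [hN, ← nsmul_eq_mul, ← Finset.sum_const]
    exact Finset.sum_le_sum hcard
  have hpow : (2 * a) ^ (-s) * (n : ℝ) ^ (-s) ≤ (2 : ℝ) ^ (-(s * M)) := by
    rw [← Real.mul_rpow (by positivity) hn0.le, mul_comm s, ← mul_neg,
      Real.rpow_mul two_pos.le, Real.rpow_natCast]
    exact Real.rpow_le_rpow_of_nonpos (by positivity) hMle (by linarith)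
  calc J / (2 * C) * ((2 * a) ^ (-s) * (d : ℝ)⁻¹ ^ e) * ((n : ℝ) ^ (-s) * Real.log n ^ e)
      = J / (2 * C) * (((2 * a) ^ (-s) * (n : ℝ) ^ (-s)) * ((d : ℝ)⁻¹ ^ e * Real.log n ^ e)) := by
        ring
    _ ≤ J / (2 * C) * ((2 : ℝ) ^ (-(s * M)) * N ^ (1 - t)) := by gcongr
    _ = c * (N * (J / 2)) := by
        rw [hc, Real.rpow_neg two_pos.le, Real.rpow_sub hN0, Real.rpow_one]
        field_simp
    _ ≤ _ := by gcongr

end FrolovBesov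

theorem theorem5p1 (d : ℕ) (hd : 1 ≤ d) (p θ : ℝ≥0∞) (hp : 1 ≤ p) (hθ : 1 ≤ θ)
    (s : ℝ) (hs : (p⁻¹).toReal < s)
    (L : ℕ) (hL : s < (L : ℝ) + 1) (Ψ : FrolovBesov.LocalMeans L) :
    ∃ c C : ℝ, 0 < c ∧ 0 < C ∧ ∀ n : ℕ, 2 ≤ n →
      ENNReal.ofReal
          (c * ((n : ℝ) ^ (-s) * Real.log n ^ (((d : ℝ) - 1) * (1 - (θ⁻¹).toReal))))
        ≤ FrolovBesov.worstCaseError Ψ d p θ s n ∧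
      FrolovBesov.worstCaseError Ψ d p θ s n ≤
        ENNReal.ofReal
          (C * ((n : ℝ) ^ (-s) * Real.log n ^ (((d : ℝ) - 1) * (1 - (θ⁻¹).toReal)))) := by
  obtain ⟨c, hc, hlower⟩ := FrolovBesov.exists_le_worstCaseError hd p hθ
    (ENNReal.toReal_nonneg.trans_lt hs) hL Ψ
  obtain ⟨C, hC, hupper⟩ := FrolovBesov.exists_worstCaseError_le hd hp hθ hs Ψ
  exact ⟨c, C, hc, hC, fun n hn => ⟨hlower n hn, hupper n hn⟩⟩
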